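/- Let $(V_0,R,V_0^\vee,R^\vee)$ be a finite reduced real root system (not required to be crystallographic), with $R$ spanning $V_0$ and $R^\vee$ spanning $V_0^\vee$, whose Coxeter diagram is of type $I_2(n)$ for some $n\ge 3$, of type $H_3$, or of type $H_4$ (in particular, every noncrystallographic type $I_2(n)$ with $n=5$ or $n\ge 7$, $H_3$, $H_4$ is included). Let $W\subset GL(V_0^\vee)$ be its reflection group, and let $\langle\,,\rangle$ be a $W$-invariant inner product on $V_0^\vee$ with $\langle\alpha^\vee,\alpha^\vee\rangle=2$ for all $\alpha^\vee\in R^\vee$. Let $C(V_0^\vee)$ be the real Clifford algebra with relations $\omega\omega'+\omega'\omega=-2\langle\omega,\omega'\rangle$, let $\epsilon$ be its automorphism and $a\mapsto a^t$ its anti-automorphism that are $-1$ on $V_0^\vee$, let $\mathrm{Pin}(V_0^\vee)$ be the group of invertible $a$ with $a^t=a^{-1}$ and $\epsilon(a)V_0^\vee a^{-1}\subset V_0^\vee$, and let $p:\mathrm{Pin}(V_0^\vee)\to O(V_0^\vee)$, $p(a)\omega=\epsilon(a)\omega a^{-1}$. Put $\widetilde W=p^{-1}(W)$ and $W_{\mathrm{even}}=W\cap\ker\det$;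 let $W'=W$ if $\dim V_0$ is odd and $W'=W_{\mathrm{even}}$ if $\dim V_0$ is even, and $\widetilde W'=p^{-1}(W')$. For a finite group $\Gamma$, let $R(\Gamma)$ be its representation ring with complex coefficients, and let $R_{\mathrm{gen}}(\widetilde W')\subset R(\widetilde W')$ be the subspace spanned by the genuine representations, i.e. those in which $-1$ acts by $-1$. Define $\widetilde W'$-representations $S^\pm$ as follows, where $V^\vee=\mathbb C\otimes V_0^\vee$ carries the $\mathbb C$-bilinear extension of $\langle\,,\rangle$. * If $\dim V_0$ is even, write $V^\vee=U\oplus U^*$ with $U,U^*$ isotropic. Then $S=\bigwedge^\bullet U$ is a module of the complex Clifford algebra $C(V^\vee)$, with $u\in U$ acting by $u\wedge\cdot$ and $u^*\in U^*$ by $u_1\wedge\cdots\wedge u_k\mapsto\sum_i(-1)^i\,2\langle u^*,u_i\rangle\,u_1\wedge\cdots\widehat{u_i}\cdots\wedge u_k$. The restrictions of $\bigwedge^{\mathrm{even}}U$ and $\bigwedge^{\mathrm{odd}}U$ to $\widetilde W'$ are $S^+$ and $S^-$. * If $\dim V_0$ is odd, write $V^\vee=U\oplus U^*\oplus\mathbb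 C u_0$ with $U,U^*$ isotropic, $\langle u_0,u_0\rangle=1$ and $u_0$ orthogonal to $U$ and $U^*$. Let $U,U^*$ act on $\bigwedge^\bullet U$ as above and let $u_0$ act by $z$ on $\bigwedge^{\mathrm{even}}U$ and by $-z$ on $\bigwedge^{\mathrm{odd}}U$. The restrictions to $\widetilde W'$ for $z=\sqrt{-1}$ and $z=-\sqrt{-1}$ are $S^+$ and $S^-$. Let $i_S^\pm:R(W)\to R_{\mathrm{gen}}(\widetilde W')$, $\sigma\mapsto\sigma\otimes(S^+-S^-)$, where $\sigma$ is viewed as a representation of $\widetilde W'$ through $p$. Let $\iota$ be the involution of $R_{\mathrm{gen}}(\widetilde W')$ given by $\widetilde\sigma\mapsto\mathrm{sgn}\otimes\widetilde\sigma$ if $\dim V_0$ is odd, where $\mathrm{sgn}=\det\circ p$, and induced by the automorphism $a\mapsto xax^{-1}$ of $\widetilde W'$, for any $x\in\widetilde W\setminus p^{-1}(W_{\mathrm{even}})$, if $\dim V_0$ is even. Then, for all choices of $U,U^*,u_0,x$ as above, $$\mathrm{im}(i_S^\pm)=\ker(1+\iota).$$ -/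

import Mathlib

open scoped TensorProduct

noncomputable section

namespace SpinReflection

/-! ### The complex representation ring of a finite group -/

section RepresentationRing

/-- The representation ring `R(Γ)` over `ℂ`: a finite-dimensional complex representation is
identified with its character, and `R(Γ)` is the complex span of all characters, inside the
functions on `Γ`. Sums, tensor products and multiplication by `-1` of virtual representations are
pointwise sums, products and negatives. -/
def repRing (Γ : Type*) [Group Γ] : Submodule ℂ (Γ → ℂ) :=
  Submodule.span ℂ {χ | ∃ (n : ℕ) (ρ : Representation ℂ Γ (Fin n → ℂ)), χ = ρ.character}

/-- A representation on `M`, transported to a representation by matrices. -/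
def toMatrixRep {Γ M : Type*} [Group Γ] [AddCommGroup M] [Module ℂ M] [FiniteDimensional ℂ M]
    (ρ : Representation ℂ Γ M) : Representation ℂ Γ (Fin (Module.finrank ℂ M) → ℂ) :=
  ((Module.finBasis ℂ M).equivFun.conjRingEquiv).toMonoidHom.comp ρ

lemma toMatrixRep_apply {Γ M : Type*} [Group Γ] [AddCommGroup M] [Module ℂ M]
    [FiniteDimensional ℂ M] (ρ : Representation ℂ Γ M) (g : Γ) :
    toMatrixRep ρ g = (Module.finBasis ℂ M).equivFun.conj (ρ g) := rfl

lemma toMatrixRep_character {Γ M : Type*} [Group Γ] [AddCommGroup M] [Module ℂ M]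
    [FiniteDimensional ℂ M] (ρ : Representation ℂ Γ M) :
    (toMatrixRep ρ).character = ρ.character := by
  funext g
  exact LinearMap.trace_conj' (ρ g) (Module.finBasis ℂ M).equivFun

end RepresentationRing

/-! ### The covering of a group of orthogonal transformations inside the Clifford algebra -/

section Cover

open CliffordAlgebra

variable {V : Type*} [AddCommGroup V] [Module ℝ V]

lemma ι_injective (Q : QuadraticForm ℝ V) : Function.Injective (ι Q) := by
  intro v w h
  have := congrArg (equivExterior Q) h
  simpa [equivExterior, changeFormEquiv, changeForm_ι] using this

/-- The preimage `p⁻¹(H)` in the Pin group of a group `H` of orthogonal transformations of `V`: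
the units `a` of the Clifford algebra with `aᵗ = a⁻¹` (`star` is the anti-automorphism `ᵗ`, which
is `-1` on `V`) such that `p(a) : v ↦ ε(a) v a⁻¹` preserves `V` and acts on it as an
element of `H` (`involute` is the automorphism `ε`, which is `-1` on `V`). -/
def pinPreimage (Q : QuadraticForm ℝ V) (H : Subgroup (V ≃ₗ[ℝ] V)) :
    Subgroup (CliffordAlgebra Q)ˣ where
  carrier := {a | star (a : CliffordAlgebra Q) = ↑a⁻¹ ∧
    ∃ g ∈ H, ∀ v, involute (a : CliffordAlgebra Q) * ι Q v * ↑a⁻¹ = ι Q (g v)}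
  one_mem' := ⟨by simp, 1, H.one_mem, by simp⟩
  mul_mem' := by
    rintro a b ⟨ha, g, hg, hag⟩ ⟨hb, h, hh, hbh⟩
    refine ⟨by simp [star_mul, ha, hb], g * h, H.mul_mem hg hh, fun v => ?_⟩
    have : involute ((a * b : (CliffordAlgebra Q)ˣ) : CliffordAlgebra Q) * ι Q v * ↑(a * b)⁻¹ =
        involute (a : CliffordAlgebra Q) *
          (involute (b : CliffordAlgebra Q) * ι Q v * ↑b⁻¹) * ↑a⁻¹ := by
      simp [mul_assoc]
    rw [this, hbh, hag]
    rfl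
  inv_mem' := by
    rintro a ⟨ha, g, hg, hag⟩
    refine ⟨?_, g⁻¹, H.inv_mem hg, fun v => ?_⟩
    · rw [← ha, star_star, inv_inv]
    · have h1 := hag (g⁻¹ v)
      have h2 : g (g⁻¹ v) = v := g.apply_symm_apply v
      rw [h2] at h1
      rw [← h1]
      have h3 : involute ((a⁻¹ : (CliffordAlgebra Q)ˣ) : CliffordAlgebra Q) *
          involute (a : CliffordAlgebra Q) = 1 := by
        rw [← map_mul]; simp
      simp only [← mul_assoc, h3, inv_inv, one_mul]
      simp [mul_assoc]

variable {Q : QuadraticForm ℝ V} {H : Subgroup (V ≃ₗ[ℝ] V)}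

/-- The covering homomorphism `p`, with `ε(a) v a⁻¹ = p(a) v`. -/
def pinProj (Q : QuadraticForm ℝ V) (H : Subgroup (V ≃ₗ[ℝ] V)) : pinPreimage Q H →* H where
  toFun a := ⟨a.2.2.choose, a.2.2.choose_spec.1⟩
  map_one' := by
    apply Subtype.ext
    apply LinearEquiv.ext
    intro v
    apply ι_injective Q
    rw [← (1 : pinPreimage Q H).2.2.choose_spec.2 v]
    simp
  map_mul' a b := by
    apply Subtype.ext
    apply LinearEquiv.ext
    intro v
    apply ι_injective Q
    rw [← (a * b).2.2.choose_spec.2 v]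
    have h1 := a.2.2.choose_spec.2 (b.2.2.choose v)
    rw [← b.2.2.choose_spec.2 v] at h1
    refine Eq.trans ?_ h1
    simp [mul_assoc]

lemma ι_pinProj (a : pinPreimage Q H) (v : V) :
    ι Q ((pinProj Q H a : V ≃ₗ[ℝ] V) v) =
      involute ((a : (CliffordAlgebra Q)ˣ) : CliffordAlgebra Q) * ι Q v *
        (((a : (CliffordAlgebra Q)ˣ)⁻¹ : (CliffordAlgebra Q)ˣ) : CliffordAlgebra Q) :=
  (a.2.2.choose_spec.2 v).symm

/-- The element `-1` of `p⁻¹(H)`. -/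
def negOne (Q : QuadraticForm ℝ V) (H : Subgroup (V ≃ₗ[ℝ] V)) : pinPreimage Q H :=
  ⟨-1, by simp, 1, H.one_mem, by simp⟩

lemma pinProj_negOne : pinProj Q H (negOne Q H) = 1 := by
  apply Subtype.ext
  apply LinearEquiv.ext
  intro v
  apply ι_injective Q
  rw [ι_pinProj]
  simp [negOne]

/-- A representation of `p⁻¹(H)` is genuine if `-1` acts by `-1`. (For an irreducible
representation this says that it does not factor through `p`.) -/
def IsGenuine {M : Type*} [AddCommGroup M] [Module ℂ M]
    (ρ : Representation ℂ (pinPreimage Q H) M) : Prop :=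
  ρ (negOne Q H) = -1

/-- The subspace `R_gen` of the representation ring of `p⁻¹(H)` spanned by the genuine
representations. -/
def genRing (Q : QuadraticForm ℝ V) (H : Subgroup (V ≃ₗ[ℝ] V)) :
    Submodule ℂ (pinPreimage Q H → ℂ) :=
  Submodule.span ℂ {χ | ∃ (n : ℕ) (ρ : Representation ℂ (pinPreimage Q H) (Fin n → ℂ)),
    IsGenuine ρ ∧ χ = ρ.character}

lemma genRing_le_repRing : genRing Q H ≤ repRing (pinPreimage Q H) :=
  Submodule.span_mono fun _ ⟨n, ρ, _, h⟩ => ⟨n, ρ, h⟩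

lemma character_mem_genRing {M : Type*} [AddCommGroup M] [Module ℂ M] [FiniteDimensional ℂ M]
    {ρ : Representation ℂ (pinPreimage Q H) M} (h : IsGenuine ρ) : ρ.character ∈ genRing Q H := by
  refine Submodule.subset_span ⟨_, toMatrixRep ρ, ?_, (toMatrixRep_character ρ).symm⟩
  unfold IsGenuine at h ⊢
  rw [toMatrixRep_apply, h]
  apply LinearMap.ext
  intro x
  rw [LinearEquiv.conj_apply_apply, LinearMap.neg_apply, LinearMap.neg_apply, Module.End.one_apply,
    Module.End.one_apply, map_neg, LinearEquiv.apply_symm_apply]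

/-- For `H ≤ K` and genuine representations `S⁺`, `S⁻` of `p⁻¹(H)`, the linear map
`R(K) → R_gen(p⁻¹(H))`, `σ ↦ σ ⊗ (S⁺ - S⁻)`, where `σ` is regarded as a representation of
`p⁻¹(H)` by restriction to `H` and composition with `p`. -/
def tensorDiff {K : Subgroup (V ≃ₗ[ℝ] V)} (hHK : H ≤ K)
    {M N : Type*} [AddCommGroup M] [Module ℂ M] [FiniteDimensional ℂ M]
    [AddCommGroup N] [Module ℂ N] [FiniteDimensional ℂ N]
    (Sp : Representation ℂ (pinPreimage Q H) M) (Sm : Representation ℂ (pinPreimage Q H) N)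
    (hp : IsGenuine Sp) (hm : IsGenuine Sm) : repRing K →ₗ[ℂ] genRing Q H :=
  LinearMap.restrict
    ({ toFun := fun f a => f (Subgroup.inclusion hHK (pinProj Q H a)) *
          (Sp.character a - Sm.character a)
       map_add' := fun f g => by funext a; simp [add_mul]
       map_smul' := fun c f => by funext a; simp [mul_assoc] } :
      (K → ℂ) →ₗ[ℂ] (pinPreimage Q H → ℂ)) <| by
    intro f hf
    induction hf using Submodule.span_induction with
    | mem f hf =>
      obtain ⟨n, σ, rfl⟩ := hf
      let τ : Representation ℂ (pinPreimage Q H) (Fin n → ℂ) :=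
        σ.comp ((Subgroup.inclusion hHK).comp (pinProj Q H))
      have hτ : τ (negOne Q H) = 1 := by simp [τ, pinProj_negOne]
      have key : ∀ {L : Type _} [AddCommGroup L] [Module ℂ L] [FiniteDimensional ℂ L]
          (ρ : Representation ℂ (pinPreimage Q H) L), IsGenuine ρ →
          τ.character * ρ.character ∈ genRing Q H := by
        intro L _ _ _ ρ hρ
        rw [← Representation.char_tensor]
        apply character_mem_genRing
        unfold IsGenuine at hρ ⊢
        rw [Representation.tprod_apply, hτ, hρ]
        ext x y
        simp [TensorProduct.tmul_neg]
      have key' : ∀ {L : Type _} [AddCommGroup L] [Module ℂ L] [FiniteDimensional ℂ L]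
          (ρ : Representation ℂ (pinPreimage Q H) L), IsGenuine ρ →
          τ.character * ρ.character ∈ genRing Q H := by
        intro L _ _ _ ρ hρ
        rw [← Representation.char_tensor]
        apply character_mem_genRing
        unfold IsGenuine at hρ ⊢
        rw [Representation.tprod_apply, hτ, hρ]
        ext x y
        simp [TensorProduct.tmul_neg]
      have := (genRing Q H).sub_mem (key Sp hp) (key' Sm hm)
      rw [← mul_sub] at this
      exact this
    | zero => rw [map_zero]; exact Submodule.zero_mem _
    | add f g _ _ hf hg => rw [map_add]; exact Submodule.add_mem _ hf hg
    | smul c f _ hf => rw [map_smul]; exact Submodule.smul_mem _ c hf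

/-- The sign character of a group of orthogonal transformations: the determinant. -/
def sgn (H : Subgroup (V ≃ₗ[ℝ] V)) : H →* ℂ :=
  (Complex.ofRealHom : ℝ →* ℂ).comp ((Units.coeHom ℝ).comp (LinearEquiv.det.comp H.subtype))

/-- The map `σ̃ ↦ sgn ⊗ σ̃` on `R_gen(p⁻¹(H))`. -/
def sgnTwist (Q : QuadraticForm ℝ V) (H : Subgroup (V ≃ₗ[ℝ] V)) :
    genRing Q H →ₗ[ℂ] genRing Q H :=
  LinearMap.restrict
    ({ toFun := fun f a => sgn H (pinProj Q H a) * f a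
       map_add' := fun f g => by funext a; simp [mul_add]
       map_smul' := fun c f => by funext a; simp [mul_left_comm] } :
      (pinPreimage Q H → ℂ) →ₗ[ℂ] (pinPreimage Q H → ℂ)) <| by
    intro f hf
    induction hf using Submodule.span_induction with
    | mem f hf =>
      obtain ⟨n, ρ, hρ, rfl⟩ := hf
      let τ : Representation ℂ (pinPreimage Q H) (Fin n → ℂ) :=
        { toFun := fun a => sgn H (pinProj Q H a) • ρ a
          map_one' := by simp
          map_mul' := fun a b => by
            simp only [map_mul, smul_mul_smul_comm] }
      refine Submodule.subset_span ⟨n, τ, ?_, ?_⟩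
      · unfold IsGenuine at hρ ⊢
        change sgn H (pinProj Q H (negOne Q H)) • ρ (negOne Q H) = -1
        rw [pinProj_negOne, map_one, one_smul, hρ]
      · funext a
        change _ = LinearMap.trace ℂ _ (sgn H (pinProj Q H a) • ρ a)
        rw [map_smul]
        rfl
    | zero => rw [map_zero]; exact Submodule.zero_mem _
    | add f g _ _ hf hg => rw [map_add]; exact Submodule.add_mem _ hf hg
    | smul c f _ hf => rw [map_smul]; exact Submodule.smul_mem _ c hf

/-- The elements of determinant one in `K`. -/
def evenPart (K : Subgroup (V ≃ₗ[ℝ] V)) : Subgroup (V ≃ₗ[ℝ] V) :=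
  K ⊓ (LinearEquiv.det : (V ≃ₗ[ℝ] V) →* ℝˣ).ker

lemma evenPart_le (K : Subgroup (V ≃ₗ[ℝ] V)) : evenPart K ≤ K := inf_le_left

/-- Conjugation of `p⁻¹(K_even)` by an element of `p⁻¹(K)`. -/
def conjHom {K : Subgroup (V ≃ₗ[ℝ] V)} (x : pinPreimage Q K) :
    pinPreimage Q (evenPart K) →* pinPreimage Q (evenPart K) where
  toFun a := ⟨x * a * (x : (CliffordAlgebra Q)ˣ)⁻¹, by
    have ha : (a : (CliffordAlgebra Q)ˣ) ∈ pinPreimage Q K :=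
      ⟨a.2.1, (pinProj _ _ a : V ≃ₗ[ℝ] V), (pinProj _ _ a).2.1, fun v => (ι_pinProj a v).symm⟩
    let y : pinPreimage Q K := x * ⟨a, ha⟩ * x⁻¹
    refine ⟨y.2.1, (pinProj _ _ y : V ≃ₗ[ℝ] V), ⟨(pinProj _ _ y).2, ?_⟩,
      fun v => (ι_pinProj y v).symm⟩
    have h1 : (pinProj Q K ⟨a, ha⟩ : V ≃ₗ[ℝ] V) = pinProj Q (evenPart K) a := by
      apply LinearEquiv.ext
      intro v
      apply ι_injective Q
      rw [ι_pinProj, ι_pinProj]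
    have h2 : LinearEquiv.det (pinProj Q (evenPart K) a : V ≃ₗ[ℝ] V) = 1 :=
      (pinProj Q (evenPart K) a).2.2
    change LinearEquiv.det (pinProj Q K y : V ≃ₗ[ℝ] V) = 1
    simp only [y, map_mul, map_inv, Subgroup.coe_mul, h1, h2, Subgroup.coe_inv]
    simp⟩
  map_one' := by apply Subtype.ext; simp
  map_mul' a b := by apply Subtype.ext; simp [mul_assoc]

lemma conjHom_negOne {K : Subgroup (V ≃ₗ[ℝ] V)} (x : pinPreimage Q K) :
    conjHom x (negOne Q (evenPart K)) = negOne Q (evenPart K) := by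
  apply Subtype.ext
  simp [conjHom, negOne]

/-- The map induced on `R_gen(p⁻¹(K_even))` by the automorphism `a ↦ x a x⁻¹`. -/
def conjTwist {K : Subgroup (V ≃ₗ[ℝ] V)} (x : pinPreimage Q K) :
    genRing Q (evenPart K) →ₗ[ℂ] genRing Q (evenPart K) :=
  LinearMap.restrict
    ({ toFun := fun f a => f (conjHom x a)
       map_add' := fun f g => rfl
       map_smul' := fun c f => rfl } :
      (pinPreimage Q (evenPart K) → ℂ) →ₗ[ℂ] (pinPreimage Q (evenPart K) → ℂ)) <| by
    intro f hf
    induction hf using Submodule.span_induction with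
    | mem f hf =>
      obtain ⟨n, ρ, hρ, rfl⟩ := hf
      refine Submodule.subset_span ⟨n, ρ.comp (conjHom x), ?_, rfl⟩
      unfold IsGenuine at hρ ⊢
      rw [MonoidHom.comp_apply, conjHom_negOne, hρ]
    | zero => rw [map_zero]; exact Submodule.zero_mem _
    | add f g _ _ hf hg => rw [map_add]; exact Submodule.add_mem _ hf hg
    | smul c f _ hf => rw [map_smul]; exact Submodule.smul_mem _ c hf

end Cover

/-! ### Spin modules -/

section Spin

open CliffordAlgebra

section Fock

variable {X : Type*} [AddCommGroup X] [Module ℂ X] (β : LinearMap.BilinForm ℂ X)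

/-- A decomposition `X = U ⊕ U'` of a complex space with a symmetric bilinear form `β` into two
isotropic subspaces (for `β` nondegenerate, so that `U'` is the dual `U*`). -/
structure EvenPolarization where
  U : Submodule ℂ X
  U' : Submodule ℂ X
  isotropic : ∀ u ∈ U, ∀ v ∈ U, β u v = 0
  isotropic' : ∀ u ∈ U', ∀ v ∈ U', β u v = 0
  isCompl : IsCompl U U'

/-- A decomposition `X = (U ⊕ U') ⊕ ℂ u₀` where `U`, `U'` are isotropic and `u₀` is a
unit vector orthogonal to both of them. -/
structure OddPolarization where
  U : Submodule ℂ X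
  U' : Submodule ℂ X
  u₀ : X
  isotropic : ∀ u ∈ U, ∀ v ∈ U, β u v = 0
  isotropic' : ∀ u ∈ U', ∀ v ∈ U', β u v = 0
  unit : β u₀ u₀ = 1
  orthogonal : ∀ u ∈ U, β u₀ u = 0
  orthogonal' : ∀ u ∈ U', β u₀ u = 0
  isCompl : IsCompl U (U' ⊔ Submodule.span ℂ {u₀})

/-- For `X = U ⊕ K`, the operator of `v ∈ X` on `⋀ U`: exterior multiplication by the
`U`-component of `v`, minus the contraction with the functional `2 β(v, ·)` on `U`. On `u ∈ U`
(isotropic) this is `u ∧ ·`, and on `u*` in an isotropic complement it is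
`u₁ ∧ ⋯ ∧ u_k ↦ ∑ i, (-1) ^ i 2 β(u*, u_i) u₁ ∧ ⋯ û_i ⋯ ∧ u_k`. -/
def fock {U K : Submodule ℂ X} (h : IsCompl U K) :
    X →ₗ[ℂ] Module.End ℂ (ExteriorAlgebra ℂ U) :=
  LinearMap.mul ℂ (ExteriorAlgebra ℂ U) ∘ₗ ExteriorAlgebra.ι ℂ ∘ₗ Submodule.projectionOnto U K h -
    contractLeft (Q := (0 : QuadraticForm ℂ U)) ∘ₗ U.subtype.dualMap ∘ₗ ((2 : ℂ) • β)

/-- The parity automorphism of `⋀ U`, `(-1)^k` on `⋀^k U`. -/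
def parity (U : Submodule ℂ X) : Module.End ℂ (ExteriorAlgebra ℂ U) :=
  (involute (Q := (0 : QuadraticForm ℂ U))).toLinearMap

lemma fock_apply {U K : Submodule ℂ X} (h : IsCompl U K) (v : X) (s : ExteriorAlgebra ℂ U) :
    fock β h v s = ι (0 : QuadraticForm ℂ U) (Submodule.projectionOnto U K h v) * s -
      contractLeft (Q := (0 : QuadraticForm ℂ U)) (U.subtype.dualMap ((2 : ℂ) • β v)) s := rfl

lemma involute_contractLeft {M : Type*} [AddCommGroup M] [Module ℂ M] {q : QuadraticForm ℂ M}
    (d : Module.Dual ℂ M) (x : CliffordAlgebra q) :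
    involute (contractLeft d x) = -contractLeft d (involute x) := by
  induction x using CliffordAlgebra.left_induction with
  | algebraMap r => simp
  | add x y hx hy => simp only [map_add, hx, hy, neg_add]
  | ι_mul x m hx =>
    simp only [contractLeft_ι_mul, map_sub, map_smul, map_mul, involute_ι, hx, neg_mul, map_neg,
      mul_neg, neg_neg, neg_sub]

lemma fock_parity {U K : Submodule ℂ X} (h : IsCompl U K) (v : X) (s : ExteriorAlgebra ℂ U) :
    parity U (fock β h v s) = -fock β h v (parity U s) := by
  simp only [parity, fock_apply, AlgHom.toLinearMap_apply, map_sub, map_mul, involute_ι,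
    involute_contractLeft]
  rw [neg_mul]
  abel

lemma parity_parity (U : Submodule ℂ X) (s : ExteriorAlgebra ℂ U) :
    parity U (parity U s) = s := involute_involute (Q := (0 : QuadraticForm ℂ U)) s

lemma fock_sq {U K : Submodule ℂ X} (h : IsCompl U K) (v : X) (s : ExteriorAlgebra ℂ U) :
    fock β h v (fock β h v s) = (-(2 * β v (Submodule.projectionOnto U K h v))) • s := by
  simp only [fock_apply, map_sub, contractLeft_ι_mul, contractLeft_contractLeft]
  rw [← mul_assoc, ι_sq_scalar]
  simp

/-- The quadratic form `v ↦ -β(v, v)`; its Clifford algebra has the relations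
`v w + w v = -2 β(v, w)`. -/
def negForm {k Y : Type*} [CommRing k] [AddCommGroup Y] [Module k Y]
    (b : LinearMap.BilinForm k Y) : QuadraticForm k Y :=
  -LinearMap.BilinMap.toQuadraticMap b

lemma negForm_apply {k Y : Type*} [CommRing k] [AddCommGroup Y] [Module k Y]
    (b : LinearMap.BilinForm k Y) (v : Y) : negForm b v = -b v v := rfl

variable {β}

/-- In even dimension: the spin module `S = ⋀ U` of the complex Clifford algebra. -/
def EvenPolarization.spinHom (D : EvenPolarization β) (hβ : ∀ v w, β v w = β w v) :
    CliffordAlgebra (negForm β) →ₐ[ℂ] Module.End ℂ (ExteriorAlgebra ℂ D.U) :=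
  CliffordAlgebra.lift (negForm β) ⟨fock β D.isCompl, by
    intro v
    apply LinearMap.ext
    intro s
    rw [Module.End.mul_apply, fock_sq, negForm_apply, Module.algebraMap_end_apply]
    congr 2
    obtain ⟨u, hu, w, hw, rfl⟩ : ∃ u ∈ D.U, ∃ w ∈ D.U', u + w = v := by
      rw [← Submodule.mem_sup, D.isCompl.sup_eq_top]; trivial
    rw [map_add (Submodule.projectionOnto D.U _ D.isCompl),
      Submodule.projectionOnto_apply_of_mem_left _ hu,
      Submodule.projectionOnto_apply_of_mem_right _ hw]
    simp only [add_zero, map_add, LinearMap.add_apply, D.isotropic u hu u hu,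
      D.isotropic' w hw w hw, hβ u w]
    ring⟩

lemma EvenPolarization.spinHom_ι (D : EvenPolarization β) (hβ : ∀ v w, β v w = β w v) (v : X) :
    D.spinHom hβ (ι _ v) = fock β D.isCompl v := by
  simp [EvenPolarization.spinHom]

lemma EvenPolarization.parity_spinHom (D : EvenPolarization β) (hβ : ∀ v w, β v w = β w v)
    (x : CliffordAlgebra (negForm β)) (s : ExteriorAlgebra ℂ D.U) :
    parity D.U (D.spinHom hβ x s) = D.spinHom hβ (involute x) (parity D.U s) := by
  induction x using CliffordAlgebra.left_induction generalizing s with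
  | algebraMap r => simp
  | add x y hx hy => simp only [map_add, LinearMap.add_apply, hx, hy]
  | ι_mul x m hx =>
    simp only [map_mul, Module.End.mul_apply, involute_ι, map_neg, LinearMap.neg_apply, ← hx,
      D.spinHom_ι, fock_parity, neg_mul]

/-- In odd dimension: the two spin modules of the complex Clifford algebra, on `⋀ U`, for `z = i`
and `z = -i`. The subspace `U ⊕ U'` acts as in even dimension, and `u₀` acts by `z` on
the even part of `⋀ U` and by `-z` on the odd part (so that it anticommutes with `U ⊕ U'`). -/
def OddPolarization.spinHom (D : OddPolarization β) (hβ : ∀ v w, β v w = β w v)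
    (z : ℂ) (hz : z ^ 2 = -1) :
    CliffordAlgebra (negForm β) →ₐ[ℂ] Module.End ℂ (ExteriorAlgebra ℂ D.U) :=
  CliffordAlgebra.lift (negForm β)
    ⟨fock β D.isCompl + (β D.u₀).smulRight (z • parity D.U), by
    intro v
    apply LinearMap.ext
    intro s
    simp only [Module.End.mul_apply, LinearMap.add_apply, LinearMap.smulRight_apply,
      LinearMap.smul_apply, map_add, map_smul, fock_sq, fock_parity, parity_parity,
      Module.algebraMap_end_apply, negForm_apply, smul_neg]
    obtain ⟨u, hu, w', hw', rfl⟩ : ∃ u ∈ D.U, ∃ w ∈ D.U' ⊔ Submodule.span ℂ {D.u₀}, u + w = v := by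
      rw [← Submodule.mem_sup, D.isCompl.sup_eq_top]; trivial
    rw [map_add (Submodule.projectionOnto D.U _ D.isCompl),
      Submodule.projectionOnto_apply_of_mem_left _ hu,
      Submodule.projectionOnto_apply_of_mem_right _ hw', add_zero]
    obtain ⟨w, hw, y, hy, rfl⟩ := Submodule.mem_sup.1 hw'
    obtain ⟨c, rfl⟩ := Submodule.mem_span_singleton.1 hy
    generalize fock β D.isCompl (u + (w + c • D.u₀)) (parity D.U s) = r
    simp only [map_add, LinearMap.add_apply, D.isotropic u hu u hu,
      D.isotropic' w hw w hw, hβ u w, map_smul, LinearMap.smul_apply, D.unit,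
      D.orthogonal u hu, D.orthogonal' w hw, hβ u D.u₀, hβ w D.u₀, smul_eq_mul, mul_zero,
      mul_one, zero_add, add_zero]
    have e : -(β w u + (β w u + c * c)) = -(2 * β w u) + c * (z * (c * z)) := by
      linear_combination (-c ^ 2) * hz
    rw [e, add_smul]
    simp only [smul_smul]
    module⟩

end Fock

end Spin

/-! ### Elements of the cover lying over determinant one are even -/

section Parity

open CliffordAlgebra

lemma ι_mul_sub_involute_mul_ι {V : Type*} [AddCommGroup V] [Module ℝ V]
    {B : LinearMap.BilinForm ℝ V} (hB : ∀ v w, B v w = B w v) (v : V)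
    (x : CliffordAlgebra (negForm B)) :
    contractLeft ((-2 : ℝ) • B v) x = ι _ v * x - involute x * ι _ v := by
  induction x using CliffordAlgebra.left_induction with
  | algebraMap r => simp [Algebra.commutes]
  | add x y hx hy => simp only [map_add, hx, hy, mul_add, add_mul]; abel
  | ι_mul x m hx =>
    have h : ι (negForm B) v * ι _ m + ι _ m * ι _ v =
        algebraMap ℝ _ (((-2 : ℝ) • B v) m) := by
      rw [ι_mul_ι_add_swap]
      congr 1
      simp only [QuadraticMap.polar, negForm_apply, map_add, LinearMap.add_apply, hB m v,
        LinearMap.smul_apply, smul_eq_mul]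
      ring
    rw [contractLeft_ι_mul, hx, Algebra.smul_def, ← h, map_mul, involute_ι]
    noncomm_ring

lemma exterior_mem_range_of_contractLeft_eq_zero {V : Type*} [AddCommGroup V] [Module ℝ V]
    [FiniteDimensional ℝ V] (x : ExteriorAlgebra ℝ V)
    (hx : ∀ d, contractLeft (Q := (0 : QuadraticForm ℝ V)) d x = 0) :
    ∃ r : ℝ, x = algebraMap ℝ (ExteriorAlgebra ℝ V) r := by
  let b := Module.finBasis ℝ V
  let N : ExteriorAlgebra ℝ V →ₗ[ℝ] ExteriorAlgebra ℝ V :=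
    ∑ i, LinearMap.mulLeft ℝ (ι (0 : QuadraticForm ℝ V) (b i)) ∘ₗ contractLeft (b.coord i)
  have hN : ∀ y, N y = ∑ i, ι (0 : QuadraticForm ℝ V) (b i) * contractLeft (b.coord i) y := by
    intro y
    simp [N]
  have hmul : ∀ (m : V) (y : ExteriorAlgebra ℝ V),
      N (ExteriorAlgebra.ι ℝ m * y) = ExteriorAlgebra.ι ℝ m * y + ExteriorAlgebra.ι ℝ m * N y := by
    intro m y
    have h1 : ∀ i, ι (0 : QuadraticForm ℝ V) (b i) *
        contractLeft (b.coord i) (ι (0 : QuadraticForm ℝ V) m * y) =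
        ι (0 : QuadraticForm ℝ V) (b.coord i m • b i) * y +
          ι (0 : QuadraticForm ℝ V) m *
            (ι (0 : QuadraticForm ℝ V) (b i) * contractLeft (b.coord i) y) := by
      intro i
      have h2 : ι (0 : QuadraticForm ℝ V) (b i) * ι _ m = - (ι _ m * ι _ (b i)) := by
        rw [eq_neg_iff_add_eq_zero, ι_mul_ι_add_swap]
        simp [QuadraticMap.polar]
      rw [contractLeft_ι_mul, mul_sub, ← mul_assoc (ι _ (b i)) (ι _ m), h2]
      simp [mul_assoc]
    rw [hN, hN]
    refine (Finset.sum_congr rfl fun i _ => h1 i).trans ?_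
    rw [Finset.sum_add_distrib, ← Finset.sum_mul, ← map_sum, ← Finset.mul_sum]
    congr 3
    exact b.sum_repr m
  have hdeg : ∀ (k : ℕ) (y : ExteriorAlgebra ℝ V), y ∈ ⋀[ℝ]^k V → N y = (k : ℝ) • y := by
    intro k y hy
    induction hy using Submodule.pow_induction_on_left' with
    | algebraMap r => rw [hN]; simp
    | add x y i _ _ hx hy => rw [map_add, hx, hy, smul_add]
    | mem_mul m hm i y _ ih =>
      obtain ⟨m, rfl⟩ := hm
      rw [hmul, ih]
      push_cast
      rw [add_smul, one_smul, mul_smul_comm, add_comm]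
  have h0 : N x = 0 := by rw [hN]; simp [hx]
  let D := DirectSum.decompose (fun k : ℕ => ⋀[ℝ]^k V) x
  classical
  have hsum : x = ∑ k ∈ D.support, (D k : ExteriorAlgebra ℝ V) :=
    (DirectSum.sum_support_decompose (fun k : ℕ => ⋀[ℝ]^k V) x).symm
  have h3 : ∑ k ∈ D.support, (((k : ℝ) • D k : ⋀[ℝ]^k V) : ExteriorAlgebra ℝ V) = 0 := by
    rw [← h0]
    conv_rhs => rw [hsum, map_sum]
    exact Finset.sum_congr rfl fun k _ => (hdeg k _ (D k).2).symm
  have h4 : ∀ k ∈ D.support, ((k : ℝ) • D k : ⋀[ℝ]^k V) = 0 := by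
    intro k hk
    have h5 := congrArg (fun y => (DirectSum.decompose (fun k : ℕ => ⋀[ℝ]^k V) y) k) h3
    simp only [DirectSum.decompose_sum, DirectSum.decompose_coe, DirectSum.decompose_zero] at h5
    rw [DFinsupp.finsetSum_apply, Finset.sum_eq_single k] at h5
    · simpa using h5
    · intro j _ hj
      exact DirectSum.of_eq_of_ne _ _ _ hj.symm
    · intro h; exact absurd hk h
  have h6 : x ∈ (1 : Submodule ℝ (ExteriorAlgebra ℝ V)) := by
    rw [hsum]
    refine Submodule.sum_mem _ fun k hk => ?_
    rcases Nat.eq_zero_or_pos k with rfl | hpos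
    · have h7 := (D 0).2
      exact h7
    · have h7 := h4 k hk
      rw [smul_eq_zero] at h7
      rcases h7 with h7 | h7
      · exact absurd (Nat.cast_eq_zero.1 h7) hpos.ne'
      · rw [h7]; exact Submodule.zero_mem _
  obtain ⟨r, hr⟩ := Submodule.mem_one.1 h6
  exact ⟨r, hr.symm⟩

lemma involute_eq_self_of_twisted_central {V : Type*} [AddCommGroup V] [Module ℝ V]
    [FiniteDimensional ℝ V] {B : LinearMap.BilinForm ℝ V} (hB : ∀ v w, B v w = B w v)
    (hpos : ∀ v, v ≠ 0 → 0 < B v v) (x : CliffordAlgebra (negForm B))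
    (hx : ∀ v, involute x * ι _ v = ι _ v * x) : involute x = x := by
  have hinj : Function.Injective B := by
    rw [injective_iff_map_eq_zero]
    intro v hv
    by_contra h
    have := hpos v h
    rw [hv] at this
    simp at this
  have hsurj : Function.Surjective B :=
    (LinearMap.injective_iff_surjective_of_finrank_eq_finrank
      (Subspace.dual_finrank_eq (K := ℝ) (V := V)).symm).1 hinj
  have h1 : ∀ d, contractLeft d x = 0 := by
    intro d
    obtain ⟨v, rfl⟩ := hsurj d
    have h2 := ι_mul_sub_involute_mul_ι hB v x
    rw [hx, sub_self, map_smul, LinearMap.smul_apply, smul_eq_zero] at h2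
    exact h2.resolve_left (by norm_num)
  obtain ⟨r, hr⟩ := exterior_mem_range_of_contractLeft_eq_zero (equivExterior (negForm B) x)
    (fun d => by
      have := changeForm_contractLeft (changeForm.associated_neg_proof (Q := negForm B)) d x
      change contractLeft d (changeForm changeForm.associated_neg_proof x) = 0
      rw [← this, h1, map_zero])
  have h3 : x = algebraMap ℝ _ r := by
    apply (equivExterior (negForm B)).injective
    rw [hr]
    exact (changeForm_algebraMap (changeForm.associated_neg_proof (Q := negForm B)) r).symm
  rw [h3, AlgHom.commutes]

end Parity

/-! ### Root systems -/

section Roots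

open CliffordAlgebra

variable {ι V₀ V : Type*} [AddCommGroup V₀] [Module ℝ V₀] [AddCommGroup V] [Module ℝ V]

/-- The roots `b 0, …, b (r - 1)` are the simple roots of some system of positive roots. -/
def IsSimpleSystem (P : RootPairing ι ℝ V₀ V) {r : ℕ} (b : Fin r → ι) : Prop :=
  LinearIndependent ℝ (fun k => P.root (b k)) ∧
    ∀ i, ∃ c : Fin r → ℝ, P.root i = ∑ k, c k • P.root (b k) ∧
      ((∀ k, 0 ≤ c k) ∨ ∀ k, c k ≤ 0)

/-- The Coxeter diagram of the root system is the one encoded by `M`: for some simple roots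
`α₁, …, α_r`, the order of `s_{α_i} s_{α_j}` is `M i j`. -/
def HasCoxeterType (P : RootPairing ι ℝ V₀ V) {r : ℕ} (M : CoxeterMatrix (Fin r)) : Prop :=
  ∃ b : Fin r → ι, IsSimpleSystem P b ∧
    ∀ i j, orderOf (P.reflection (b i) * P.reflection (b j)) = M i j

/-- The root systems of type `I₂(n)` (`n ≥ 3`), `H₃` and `H₄`. (Mathlib's `CoxeterMatrix.I m`
is the Coxeter matrix of `I₂(m + 2)`.) -/
def IsDihedralOrH (P : RootPairing ι ℝ V₀ V) : Prop :=
  (∃ n : ℕ, 3 ≤ n ∧ HasCoxeterType P (CoxeterMatrix.I (n - 2))) ∨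
    HasCoxeterType P CoxeterMatrix.H₃ ∨ HasCoxeterType P CoxeterMatrix.H₄

/-- The reflection group `W`, acting on the space `V = V₀^∨` of the coroots. -/
def reflGroup (P : RootPairing ι ℝ V₀ V) : Subgroup (V ≃ₗ[ℝ] V) :=
  Subgroup.closure (Set.range P.coreflection)

/-- A `W`-invariant inner product on `V₀^∨` with `⟨α^∨, α^∨⟩ = 2` for all coroots. -/
structure IsNormalizedInner (P : RootPairing ι ℝ V₀ V) (B : LinearMap.BilinForm ℝ V) : Prop where
  symm : ∀ v w, B v w = B w v
  pos : ∀ v, v ≠ 0 → 0 < B v v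
  invariant : ∀ g ∈ reflGroup P, ∀ v w, B (g v) (g w) = B v w
  norm_coroot : ∀ i, B (P.coroot i) (P.coroot i) = 2

variable {P : RootPairing ι ℝ V₀ V} {B : LinearMap.BilinForm ℝ V}

lemma IsNormalizedInner.root_eq (hB : IsNormalizedInner P B) (i : ι) (v : V) :
    P.root' i v = B (P.coroot i) v := by
  have h := hB.invariant (P.coreflection i) (Subgroup.subset_closure ⟨i, rfl⟩) v (P.coroot i)
  rw [P.coreflection_apply_self, P.coreflection_apply] at h
  simp only [map_neg, map_sub, map_smul, LinearMap.sub_apply, LinearMap.smul_apply,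
    hB.norm_coroot, smul_eq_mul, hB.symm v (P.coroot i)] at h
  linarith

lemma det_coreflection [FiniteDimensional ℝ V] (P : RootPairing ι ℝ V₀ V) (i : ι) :
    LinearMap.det (P.coreflection i : V →ₗ[ℝ] V) = -1 := by
  let b := Module.finBasis ℝ V
  have h : LinearMap.toMatrix b b (P.coreflection i : V →ₗ[ℝ] V) =
      1 + Matrix.replicateCol Unit (fun k => -b.repr (P.coroot i) k) *
        Matrix.replicateRow Unit (fun l => P.root' i (b l)) := by
    ext k l
    rw [LinearMap.toMatrix_apply]
    simp only [LinearEquiv.coe_coe, P.coreflection_apply, map_sub, map_smul, Finsupp.sub_apply,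
      Finsupp.smul_apply, Module.Basis.repr_self, Matrix.add_apply, Matrix.one_apply,
      Matrix.mul_apply, Finset.univ_unique, Finset.sum_singleton, Matrix.replicateCol_apply,
      Matrix.replicateRow_apply, Finsupp.single_apply, smul_eq_mul, eq_comm (a := k)]
    ring
  rw [← LinearMap.det_toMatrix b, h, Matrix.det_one_add_replicateCol_mul_replicateRow]
  have h2 : P.root' i (P.coroot i) = 2 := P.root_coroot_two i
  rw [← b.sum_repr (P.coroot i), map_sum] at h2
  simp only [map_smul, smul_eq_mul] at h2
  simp only [dotProduct, mul_neg, Finset.sum_neg_distrib]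
  rw [Finset.sum_congr rfl fun k _ => mul_comm _ _, h2]
  norm_num

lemma IsNormalizedInner.exists_lift [FiniteDimensional ℝ V] (hB : IsNormalizedInner P B)
    {g : V ≃ₗ[ℝ] V} (hg : g ∈ reflGroup P) :
    ∃ b : (CliffordAlgebra (negForm B))ˣ,
      (∀ v, involute (b : CliffordAlgebra (negForm B)) * CliffordAlgebra.ι _ v =
        CliffordAlgebra.ι _ (g v) * (b : CliffordAlgebra (negForm B))) ∧
      involute (b : CliffordAlgebra (negForm B)) =
        LinearMap.det (g : V →ₗ[ℝ] V) • (b : CliffordAlgebra (negForm B)) := by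
  have hmul : ∀ x y : V ≃ₗ[ℝ] V, LinearMap.det ((x * y : V ≃ₗ[ℝ] V) : V →ₗ[ℝ] V) =
      LinearMap.det (x : V →ₗ[ℝ] V) * LinearMap.det (y : V →ₗ[ℝ] V) := by
    intro x y
    rw [← map_mul]
    rfl
  induction hg using Subgroup.closure_induction with
  | mem g hg =>
    obtain ⟨i, rfl⟩ := hg
    have hsq : CliffordAlgebra.ι (negForm B) (P.coroot i) * CliffordAlgebra.ι _ (P.coroot i) =
        algebraMap ℝ _ (-2) := by
      rw [ι_sq_scalar, negForm_apply, hB.norm_coroot]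
    refine ⟨⟨CliffordAlgebra.ι _ (P.coroot i), (-1 / 2 : ℝ) • CliffordAlgebra.ι _ (P.coroot i),
      ?_, ?_⟩, fun v => ?_, ?_⟩
    · rw [mul_smul_comm, hsq, Algebra.smul_def, ← map_mul]
      norm_num
    · rw [smul_mul_assoc, hsq, Algebra.smul_def, ← map_mul]
      norm_num
    · have hadd : CliffordAlgebra.ι (negForm B) (P.coroot i) * CliffordAlgebra.ι _ v +
          CliffordAlgebra.ι _ v * CliffordAlgebra.ι _ (P.coroot i) =
          algebraMap ℝ _ (-2 * P.root' i v) := by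
        rw [ι_mul_ι_add_swap]
        congr 1
        simp only [QuadraticMap.polar, negForm_apply, map_add, LinearMap.add_apply,
          hB.symm v (P.coroot i), hB.root_eq]
        ring
      change involute (CliffordAlgebra.ι _ (P.coroot i)) * CliffordAlgebra.ι _ v =
        CliffordAlgebra.ι _ (P.coreflection i v) * CliffordAlgebra.ι _ (P.coroot i)
      rw [involute_ι, P.coreflection_apply, map_sub, map_smul, sub_mul, smul_mul_assoc, hsq,
        Algebra.smul_def, ← (algebraMap ℝ (CliffordAlgebra (negForm B))).map_mul, neg_mul,
        mul_comm (P.root' i v) (-2 : ℝ), ← hadd]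
      abel
    · change involute (CliffordAlgebra.ι _ (P.coroot i)) = _ • CliffordAlgebra.ι _ (P.coroot i)
      rw [involute_ι, det_coreflection, neg_one_smul]
  | one => exact ⟨1, by simp, by simp⟩
  | mul x y hx hy ihx ihy =>
    obtain ⟨b, hb, hb'⟩ := ihx
    obtain ⟨c, hc, hc'⟩ := ihy
    refine ⟨b * c, fun v => ?_, ?_⟩
    · rw [Units.val_mul, map_mul, mul_assoc, hc, ← mul_assoc, hb, mul_assoc]
      rfl
    · rw [Units.val_mul, map_mul, hb', hc', smul_mul_smul_comm, hmul]
  | inv x hx ih =>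
    obtain ⟨b, hb, hb'⟩ := ih
    have h1 : involute ((b⁻¹ : (CliffordAlgebra (negForm B))ˣ) : CliffordAlgebra (negForm B)) *
        involute (b : CliffordAlgebra (negForm B)) = 1 := by
      rw [← map_mul]; simp
    refine ⟨b⁻¹, fun v => ?_, ?_⟩
    · have h2 := hb (x⁻¹ v)
      rw [show x (x⁻¹ v) = v from x.apply_symm_apply v] at h2
      rw [(Units.eq_mul_inv_iff_mul_eq b).2 h2.symm, ← mul_assoc, ← mul_assoc, h1, one_mul]
    · have h2 := hmul x⁻¹ x
      rw [inv_mul_cancel] at h2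
      have h3 : LinearMap.det ((1 : V ≃ₗ[ℝ] V) : V →ₗ[ℝ] V) = 1 := LinearMap.det_id
      rw [h3] at h2
      rw [hb', mul_smul_comm, ← smul_mul_assoc] at h1
      have h4 := (Units.mul_eq_one_iff_eq_inv).1 h1
      rw [← h4, smul_smul, ← h2, one_smul, h4]

/-- Elements of the cover over elements of `W` of determinant one are even. -/
lemma IsNormalizedInner.involute_eq [FiniteDimensional ℝ V] (hB : IsNormalizedInner P B)
    (a : pinPreimage (negForm B) (evenPart (reflGroup P))) :
    involute ((a : (CliffordAlgebra (negForm B))ˣ) : CliffordAlgebra (negForm B)) =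
      ((a : (CliffordAlgebra (negForm B))ˣ) : CliffordAlgebra (negForm B)) := by
  obtain ⟨a, ha, g, ⟨hg, hdet⟩, hga⟩ := a
  obtain ⟨b, hb, hb'⟩ := hB.exists_lift hg
  have hdet' : LinearMap.det (g : V →ₗ[ℝ] V) = 1 := by
    have h : LinearEquiv.det g = 1 := hdet
    rw [← LinearEquiv.coe_det, h, Units.val_one]
  rw [hdet', one_smul] at hb'
  rw [hb'] at hb
  have key : involute ((b⁻¹ * a : (CliffordAlgebra (negForm B))ˣ) : CliffordAlgebra (negForm B)) =
      ((b⁻¹ * a : (CliffordAlgebra (negForm B))ˣ) : CliffordAlgebra (negForm B)) := by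
    apply involute_eq_self_of_twisted_central hB.symm hB.pos
    intro v
    have h1 : involute (a : CliffordAlgebra (negForm B)) * CliffordAlgebra.ι _ v =
        CliffordAlgebra.ι _ (g v) * (a : CliffordAlgebra (negForm B)) := by
      rw [← hga v]; simp
    have h2 : involute ((b⁻¹ : (CliffordAlgebra (negForm B))ˣ) : CliffordAlgebra (negForm B)) =
        ((b⁻¹ : (CliffordAlgebra (negForm B))ˣ) : CliffordAlgebra (negForm B)) := by
      have h3 : involute ((b⁻¹ : (CliffordAlgebra (negForm B))ˣ) : CliffordAlgebra (negForm B)) *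
          involute (b : CliffordAlgebra (negForm B)) = 1 := by
        rw [← map_mul]; simp
      rw [hb'] at h3
      exact (Units.mul_eq_one_iff_eq_inv).1 h3
    rw [Units.val_mul, map_mul, h2, mul_assoc, h1, ← mul_assoc, ← mul_assoc]
    congr 1
    rw [Units.inv_mul_eq_iff_eq_mul, ← mul_assoc]
    exact (Units.eq_mul_inv_iff_mul_eq b).2 (hb v).symm
  have h4 : ((a : (CliffordAlgebra (negForm B))ˣ) : CliffordAlgebra (negForm B)) =
      b * ((b⁻¹ * a : (CliffordAlgebra (negForm B))ˣ) : CliffordAlgebra (negForm B)) := by simp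
  change involute (a : CliffordAlgebra (negForm B)) = a
  rw [h4, map_mul, key, hb']

/-- The canonical map from the real Clifford algebra of `V` to the complex Clifford algebra of the
complexification `ℂ ⊗ V`. -/
def toComplex (B : LinearMap.BilinForm ℝ V) :
    CliffordAlgebra (negForm B) →ₐ[ℝ] CliffordAlgebra (negForm (B.baseChange ℂ)) :=
  CliffordAlgebra.lift (negForm B)
    ⟨(CliffordAlgebra.ι (negForm (B.baseChange ℂ))).restrictScalars ℝ ∘ₗ
      TensorProduct.mk ℝ ℂ V 1, fun v => by
        simp only [LinearMap.comp_apply, LinearMap.restrictScalars_apply, TensorProduct.mk_apply,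
          ι_sq_scalar, negForm_apply, LinearMap.BilinForm.baseChange_tmul]
        rw [IsScalarTower.algebraMap_apply ℝ ℂ]
        congr 1
        simp⟩

lemma toComplex_involute (B : LinearMap.BilinForm ℝ V) (x : CliffordAlgebra (negForm B)) :
    toComplex B (involute x) = involute (toComplex B x) := by
  induction x using CliffordAlgebra.left_induction with
  | algebraMap r =>
    rw [AlgHom.commutes, AlgHom.commutes, IsScalarTower.algebraMap_apply ℝ ℂ, AlgHom.commutes]
  | add x y hx hy => simp only [map_add, hx, hy]
  | ι_mul x m hx =>
    simp only [map_mul, hx, involute_ι, map_neg]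
    simp [toComplex]

lemma baseChange_symm (hB : ∀ v w, B v w = B w v) (v w : ℂ ⊗[ℝ] V) :
    B.baseChange ℂ v w = B.baseChange ℂ w v :=
  (LinearMap.BilinForm.IsSymm.baseChange ℂ (B₂ := B) ⟨hB⟩).eq v w

instance exteriorAlgebra_finite {X : Type*} [AddCommGroup X] [Module ℂ X] [FiniteDimensional ℂ X] :
    FiniteDimensional ℂ (ExteriorAlgebra ℂ X) :=
  Module.Finite.of_basis (Module.finBasis ℂ X).ExteriorAlgebra

/-- The restriction to `p⁻¹(H)` of a module of the complex Clifford algebra. -/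
def pinRep (B : LinearMap.BilinForm ℝ V) (H : Subgroup (V ≃ₗ[ℝ] V)) {M : Type*} [AddCommGroup M]
    [Module ℂ M] (φ : CliffordAlgebra (negForm (B.baseChange ℂ)) →ₐ[ℂ] Module.End ℂ M) :
    Representation ℂ (pinPreimage (negForm B) H) M where
  toFun a := φ (toComplex B ((a : (CliffordAlgebra (negForm B))ˣ) : CliffordAlgebra (negForm B)))
  map_one' := by simp
  map_mul' a b := by simp

lemma isGenuine_pinRep (H : Subgroup (V ≃ₗ[ℝ] V)) {M : Type*} [AddCommGroup M] [Module ℂ M]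
    (φ : CliffordAlgebra (negForm (B.baseChange ℂ)) →ₐ[ℂ] Module.End ℂ M) :
    IsGenuine (pinRep B H φ) := by
  simp [IsGenuine, pinRep, negOne]

/-- In even dimension: the half-spin modules `S⁺` (for `c = 1`) and `S⁻` (for `c = -1`) as
representations of `p⁻¹(W_even)`, on the even part and the odd part of `S = ⋀ U`, i.e. on the
`c`-eigenspace of the parity automorphism. -/
def halfSpin [FiniteDimensional ℝ V] (hB : IsNormalizedInner P B)
    (D : EvenPolarization (B.baseChange ℂ)) (c : ℂ) :
    Representation ℂ (pinPreimage (negForm B) (evenPart (reflGroup P)))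
      (Module.End.eigenspace (parity D.U) c) :=
  (pinRep B (evenPart (reflGroup P)) (D.spinHom (baseChange_symm hB.symm))).subrepresentation
    (Module.End.eigenspace (parity D.U) c) <| by
    intro a s hs
    rw [Submodule.mem_comap, Module.End.mem_eigenspace_iff] at *
    change parity D.U (D.spinHom (baseChange_symm hB.symm) _ s) =
      c • D.spinHom (baseChange_symm hB.symm) _ s
    rw [D.parity_spinHom, ← toComplex_involute, hB.involute_eq, hs, map_smul]

lemma isGenuine_halfSpin [FiniteDimensional ℝ V] (hB : IsNormalizedInner P B)
    (D : EvenPolarization (B.baseChange ℂ)) (c : ℂ) : IsGenuine (halfSpin hB D c) := by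
  apply LinearMap.ext
  intro s
  apply Subtype.ext
  exact congrArg (fun f => f (s : ExteriorAlgebra ℂ D.U)) (isGenuine_pinRep
    (evenPart (reflGroup P)) (D.spinHom (baseChange_symm hB.symm)))

/-- In even dimension: the map `R(W) → R_gen(p⁻¹(W_even))`, `σ ↦ σ ⊗ (S⁺ - S⁻)`. -/
def iSEven [FiniteDimensional ℝ V] (hB : IsNormalizedInner P B)
    (D : EvenPolarization (B.baseChange ℂ)) :
    repRing (reflGroup P) →ₗ[ℂ] genRing (negForm B) (evenPart (reflGroup P)) :=
  tensorDiff (evenPart_le _) (halfSpin hB D 1) (halfSpin hB D (-1))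
    (isGenuine_halfSpin hB D 1) (isGenuine_halfSpin hB D (-1))

/-- In odd dimension: the spin modules `S⁺` (for `z = i`) and `S⁻` (for `z = -i`) as
representations of `p⁻¹(W)`. -/
def oddSpin (hB : IsNormalizedInner P B) (D : OddPolarization (B.baseChange ℂ))
    (z : ℂ) (hz : z ^ 2 = -1) :
    Representation ℂ (pinPreimage (negForm B) (reflGroup P)) (ExteriorAlgebra ℂ D.U) :=
  pinRep B (reflGroup P) (D.spinHom (baseChange_symm hB.symm) z hz)

/-- In odd dimension: the map `R(W) → R_gen(p⁻¹(W))`, `σ ↦ σ ⊗ (S⁺ - S⁻)`. -/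
def iSOdd [FiniteDimensional ℝ V] (hB : IsNormalizedInner P B)
    (D : OddPolarization (B.baseChange ℂ)) :
    repRing (reflGroup P) →ₗ[ℂ] genRing (negForm B) (reflGroup P) :=
  tensorDiff le_rfl (oddSpin hB D Complex.I Complex.I_sq)
    (oddSpin hB D (-Complex.I) (by rw [neg_sq, Complex.I_sq]))
    (isGenuine_pinRep _ _) (isGenuine_pinRep _ _)

end Roots

end SpinReflection

end

/-!
Write `θ` for the virtual character of `S⁺ - S⁻` on the covering `p⁻¹(W')`, and `n` for the
dimension. The representation ring of a finite group is identified with its class functions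
(`mem_repRing_of_classFunction`, from Maschke and Wedderburn), so that the image of the map in the
theorem is the set of products `(f ∘ p) θ` with `f` a class function on `W`. Since `θ` changes sign
under conjugation by odd elements (`n` even), or is supported on odd elements (`n` odd), the image
lies in the kernel of `1 + ι`.

Conversely, let `h` be in the kernel. Then `h` and `θ` have the same behaviour under multiplication
by `-1` and under conjugation by the covering of `W`, so the quotient `h / θ` descends to a class
function on `W` as soon as `h` vanishes wherever `θ` does (`exists_classFunction`). For `n` odd,
`h` vanishes on even elements by assumption. The rest is shown in two steps.

* If `p a` has no nonzero fixed vector (and `a` is odd in case `n` is odd), then `θ a ≠ 0`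
  (`EvenPolarization.supertrace_ne_zero`, `OddPolarization.trace_sub_ne_zero`). Indeed the
  functional `b ↦ str (b a)` on the real Clifford algebra satisfies a twisted cyclicity that
  determines it by its value at `1`, as `1 - p a` is invertible (`eq_zero_of_twisted_cyclic`). If
  that value were zero, the supertrace would vanish identically; but the volume element acts, by
  Schur's lemma on `⋀ U` (`exists_eq_smul_of_commute_fock`), as a nonzero multiple of an operator
  whose supertrace is the dimension of `⋀ U`.
* If `g = p a` has a nonzero fixed vector and `det g = (-1) ^ n`, then `g` fixes a coroot `α`
  (`IsDihedralOrH.exists_fixed_coroot`). The fixed space of `g` has dimension at least two because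
  of the determinant, so after conjugation `g` lies in a parabolic subgroup generated by at most
  `n - 2` simple reflections, and in types `I₂(n)`, `H₃` and `H₄` any `n - 2` simple coroots have
  a common orthogonal coroot (`IsDihedralOrH.exists_orthogonal`). This is where the type enters.
  The lift `α / √2` of the reflection in `α` then commutes with `a` (`n` even) or anticommutes
  with it (`n` odd), and either relation forces `h a = - h a`.
-/

noncomputable section

namespace SpinReflection

/-! ### Class functions and characters -/

section ClassFunctions

/-- A linear functional on a matrix algebra that vanishes on commutators is a multiple of the
trace. -/
lemma exists_eq_mul_trace {n : Type*} [Fintype n] [DecidableEq n]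
    (G : Matrix n n ℂ →ₗ[ℂ] ℂ) (hG : ∀ A B, G (A * B) = G (B * A)) :
    ∃ c : ℂ, ∀ A, G A = c * A.trace := by
  rcases isEmpty_or_nonempty n with hn | ⟨⟨o⟩⟩
  · exact ⟨0, fun A => by rw [Subsingleton.elim A 0, map_zero, zero_mul]⟩
  obtain ⟨c, h⟩ : ∃ c, ∀ j k, G (Matrix.single j k 1) = if j = k then c else 0 := by
    refine ⟨G (Matrix.single o o 1), fun j k => ?_⟩
    have h1 : Matrix.single j k (1 : ℂ) = Matrix.single j o 1 * Matrix.single o k 1 := by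
      rw [Matrix.single_mul_single_same, mul_one]
    rw [h1, hG]
    split_ifs with hjk
    · rw [hjk, Matrix.single_mul_single_same, mul_one]
    · rw [Matrix.single_mul_single_of_ne (h := Ne.symm hjk), map_zero]
  refine ⟨c, fun A => ?_⟩
  have h2 : ∀ j k, G (Matrix.single j k (A j k)) = A j k * G (Matrix.single j k 1) := by
    intro j k
    rw [← smul_eq_mul, ← map_smul, Matrix.smul_single, smul_eq_mul, mul_one]
  conv_lhs => rw [Matrix.matrix_eq_sum_single A]
  simp only [map_sum, h2, h, mul_ite, mul_zero, Finset.sum_ite_eq, Finset.mem_univ, if_true]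
  rw [← Finset.sum_mul, mul_comm]
  rfl

/-- The characters of a finite group span the class functions: by Maschke and Wedderburn the
group algebra is a product of matrix algebras, on which every tracial functional is a combination
of the traces of the factors. -/
lemma mem_repRing_of_classFunction {Γ : Type*} [Group Γ] [Finite Γ] (f : Γ → ℂ)
    (hf : ∀ x y, f (x * y) = f (y * x)) : f ∈ repRing Γ := by
  classical
  obtain ⟨n, d, hd, ⟨e⟩⟩ :=
    IsSemisimpleRing.exists_algEquiv_pi_matrix_of_isAlgClosed ℂ (MonoidAlgebra ℂ Γ)
  let b : Module.Basis Γ ℂ (MonoidAlgebra ℂ Γ) := MonoidAlgebra.basis Γ ℂ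
  have hb : ∀ g, b g = MonoidAlgebra.of ℂ Γ g := fun g => by simp [b]
  let F : MonoidAlgebra ℂ Γ →ₗ[ℂ] ℂ := b.constr ℂ f
  have hFg : ∀ g, F (MonoidAlgebra.of ℂ Γ g) = f g := fun g => by
    rw [← hb]; exact b.constr_basis ℂ f g
  have hF : ∀ x y, F (x * y) = F (y * x) := by
    have : (LinearMap.mul ℂ (MonoidAlgebra ℂ Γ)).compr₂ F =
        ((LinearMap.mul ℂ (MonoidAlgebra ℂ Γ)).flip).compr₂ F := by
      refine b.ext fun x => b.ext fun y => ?_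
      simp only [LinearMap.compr₂_apply, LinearMap.flip_apply, LinearMap.mul_apply', hb, ← map_mul,
        hFg, hf x y]
    intro x y
    exact LinearMap.congr_fun (LinearMap.congr_fun this x) y
  let G : ∀ i, Matrix (Fin (d i)) (Fin (d i)) ℂ →ₗ[ℂ] ℂ := fun i =>
    F ∘ₗ e.symm.toLinearMap ∘ₗ LinearMap.single ℂ (fun i => Matrix (Fin (d i)) (Fin (d i)) ℂ) i
  have hG : ∀ i, ∃ c : ℂ, ∀ A, G i A = c * A.trace := by
    intro i
    refine exists_eq_mul_trace (G i) fun A B => ?_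
    simp only [G, LinearMap.comp_apply, LinearMap.single_apply, Pi.single_mul,
      AlgEquiv.toLinearMap_apply, map_mul, hF (e.symm (Pi.single i A))]
  choose c hc using hG
  let ρ : ∀ i, Representation ℂ Γ (Fin (d i) → ℂ) := fun i =>
    ((Matrix.toLinAlgEquiv' : Matrix (Fin (d i)) (Fin (d i)) ℂ ≃ₐ[ℂ] _).toAlgHom :
      _ →* Module.End ℂ (Fin (d i) → ℂ)).comp
      ((Pi.evalMonoidHom (fun i => Matrix (Fin (d i)) (Fin (d i)) ℂ) i).comp
        ((e : MonoidAlgebra ℂ Γ →* ∀ i, Matrix (Fin (d i)) (Fin (d i)) ℂ).comp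
          (MonoidAlgebra.of ℂ Γ)))
  have hρ : ∀ i g, (ρ i).character g = (e (MonoidAlgebra.of ℂ Γ g) i).trace := by
    intro i g
    change LinearMap.trace ℂ _ (Matrix.toLin' (e (MonoidAlgebra.of ℂ Γ g) i)) = _
    rw [Matrix.trace_toLin'_eq]
  have key : f = ∑ i, c i • (ρ i).character := by
    funext g
    rw [← hFg, Finset.sum_apply]
    have h1 : MonoidAlgebra.of ℂ Γ g =
        ∑ i, e.symm (Pi.single i (e (MonoidAlgebra.of ℂ Γ g) i)) := by
      rw [← map_sum, Finset.univ_sum_single, AlgEquiv.symm_apply_apply]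
    conv_lhs => rw [h1, map_sum]
    refine Finset.sum_congr rfl fun i _ => ?_
    rw [Pi.smul_apply, hρ, smul_eq_mul, ← hc i]
    rfl
  rw [key]
  exact Submodule.sum_mem _ fun i _ => Submodule.smul_mem _ _ (Submodule.subset_span ⟨_, _, rfl⟩)

lemma repRing_mul_comm {Γ : Type*} [Group Γ] {f : Γ → ℂ} (hf : f ∈ repRing Γ) (x y : Γ) :
    f (x * y) = f (y * x) := by
  induction hf using Submodule.span_induction with
  | mem f hf => obtain ⟨n, ρ, rfl⟩ := hf; exact ρ.char_mul_comm y x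
  | zero => rfl
  | add f g _ _ hf hg => simp only [Pi.add_apply, hf, hg]
  | smul c f _ hf => simp only [Pi.smul_apply, hf]

variable {V : Type*} [AddCommGroup V] [Module ℝ V] {Q : QuadraticForm ℝ V}
  {H : Subgroup (V ≃ₗ[ℝ] V)}

lemma genRing_negOne_mul {f : pinPreimage Q H → ℂ} (hf : f ∈ genRing Q H) (a : pinPreimage Q H) :
    f (negOne Q H * a) = -f a := by
  induction hf using Submodule.span_induction with
  | mem f hf =>
    obtain ⟨n, ρ, hρ, rfl⟩ := hf
    unfold IsGenuine at hρ
    change LinearMap.trace ℂ _ (ρ (negOne Q H * a)) = -LinearMap.trace ℂ _ (ρ a)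
    rw [map_mul, hρ, ← map_neg]
    exact congrArg _ (neg_one_mul (ρ a))
  | zero => simp
  | add f g _ _ hf hg => simp only [Pi.add_apply, hf, hg, neg_add]
  | smul c f _ hf => simp only [Pi.smul_apply, hf, smul_neg]

/-- For a linear involution `J` and an operator `T` commuting with it, the trace of `J T` is the
difference of the traces of `T` on the two eigenspaces of `J`. -/
lemma trace_involution_mul {M : Type*} [AddCommGroup M] [Module ℂ M] [FiniteDimensional ℂ M]
    (J T : Module.End ℂ M) (hJ : ∀ s, J (J s) = s)
    (hT : ∀ c : ℂ, ∀ s ∈ Module.End.eigenspace J c, T s ∈ Module.End.eigenspace J c) :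
    LinearMap.trace ℂ M (J * T) =
      LinearMap.trace ℂ (Module.End.eigenspace J 1) (T.restrict (hT 1)) -
        LinearMap.trace ℂ (Module.End.eigenspace J (-1)) (T.restrict (hT (-1))) := by
  let N : Bool → Submodule ℂ M := fun e => Module.End.eigenspace J (if e then 1 else -1)
  have hN : DirectSum.IsInternal N := by
    rw [DirectSum.isInternal_submodule_iff_isCompl N (i := true) (j := false) (by simp)
      (by ext x; cases x <;> simp)]
    constructor
    · rw [Submodule.disjoint_def]
      intro s h1 h2
      simp only [N, Module.End.mem_eigenspace_iff, if_true] at h1 h2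
      rw [h1] at h2
      simp only [one_smul, Bool.false_eq_true, if_false, neg_smul] at h2
      have h3 : (2 : ℂ) • s = 0 := by rw [two_smul]; nth_rewrite 1 [h2]; simp
      exact (smul_eq_zero.1 h3).resolve_left two_ne_zero
    · rw [codisjoint_iff, Submodule.eq_top_iff']
      intro s
      rw [Submodule.mem_sup]
      refine ⟨(1 / 2 : ℂ) • (s + J s), ?_, (1 / 2 : ℂ) • (s - J s), ?_, ?_⟩
      · simp only [N, Module.End.mem_eigenspace_iff, if_true, map_smul, map_add, hJ, one_smul]
        rw [add_comm]
      · simp only [N, Module.End.mem_eigenspace_iff, Bool.false_eq_true, if_false, map_smul,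
          map_sub, hJ]
        module
      · module
  have hJT : ∀ e, Set.MapsTo (J * T) (N e) (N e) := by
    intro e s hs
    have h1 := hT _ s hs
    have h2 := Module.End.mem_eigenspace_iff.1 h1
    rw [Module.End.mul_apply]
    change J (T s) ∈ Module.End.eigenspace J _
    rw [h2]
    exact Submodule.smul_mem _ _ h1
  rw [LinearMap.trace_eq_sum_trace_restrict hN hJT, Fintype.sum_bool, sub_eq_add_neg, ← map_neg]
  congr 2
  · apply LinearMap.ext
    intro s
    apply Subtype.ext
    exact (Module.End.mem_eigenspace_iff.1 (hT 1 s s.2)).trans (one_smul _ _)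
  · apply LinearMap.ext
    intro s
    apply Subtype.ext
    exact (Module.End.mem_eigenspace_iff.1 (hT (-1) s s.2)).trans (neg_one_smul _ _)

end ClassFunctions

/-! ### The commutant of the spin module -/

section Commutant

open CliffordAlgebra

/-- An element of the exterior algebra that is killed by all contractions is a scalar: the number
operator `∑ eᵢ ∧ (eᵢ* ⌋ ·)` acts as `k` on the component of degree `k`. -/
lemma exterior_eq_algebraMap_of_contractLeft_eq_zero {K M : Type*} [Field K] [CharZero K]
    [AddCommGroup M] [Module K M] [FiniteDimensional K M] (x : ExteriorAlgebra K M)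
    (hx : ∀ d, contractLeft (Q := (0 : QuadraticForm K M)) d x = 0) :
    ∃ r : K, x = algebraMap K (ExteriorAlgebra K M) r := by
  let b := Module.finBasis K M
  let N : ExteriorAlgebra K M →ₗ[K] ExteriorAlgebra K M :=
    ∑ i, LinearMap.mulLeft K (ι (0 : QuadraticForm K M) (b i)) ∘ₗ contractLeft (b.coord i)
  have hN : ∀ y, N y = ∑ i, ι (0 : QuadraticForm K M) (b i) * contractLeft (b.coord i) y := by
    intro y
    simp [N]
  have hmul : ∀ (m : M) (y : ExteriorAlgebra K M),
      N (ExteriorAlgebra.ι K m * y) = ExteriorAlgebra.ι K m * y + ExteriorAlgebra.ι K m * N y := by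
    intro m y
    have h1 : ∀ i, ι (0 : QuadraticForm K M) (b i) *
        contractLeft (b.coord i) (ι (0 : QuadraticForm K M) m * y) =
        ι (0 : QuadraticForm K M) (b.coord i m • b i) * y +
          ι (0 : QuadraticForm K M) m *
            (ι (0 : QuadraticForm K M) (b i) * contractLeft (b.coord i) y) := by
      intro i
      have h2 : ι (0 : QuadraticForm K M) (b i) * ι _ m = - (ι _ m * ι _ (b i)) := by
        rw [eq_neg_iff_add_eq_zero, ι_mul_ι_add_swap]
        simp [QuadraticMap.polar]
      rw [contractLeft_ι_mul, mul_sub, ← mul_assoc (ι _ (b i)) (ι _ m), h2]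
      simp [mul_assoc]
    rw [hN, hN]
    refine (Finset.sum_congr rfl fun i _ => h1 i).trans ?_
    rw [Finset.sum_add_distrib, ← Finset.sum_mul, ← map_sum, ← Finset.mul_sum]
    congr 3
    exact b.sum_repr m
  have hdeg : ∀ (k : ℕ) (y : ExteriorAlgebra K M), y ∈ ⋀[K]^k M → N y = (k : K) • y := by
    intro k y hy
    induction hy using Submodule.pow_induction_on_left' with
    | algebraMap r => rw [hN]; simp
    | add x y i _ _ hx hy => rw [map_add, hx, hy, smul_add]
    | mem_mul m hm i y _ ih =>
      obtain ⟨m, rfl⟩ := hm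
      rw [hmul, ih]
      push_cast
      rw [add_smul, one_smul, mul_smul_comm, add_comm]
  have h0 : N x = 0 := by rw [hN]; simp [hx]
  let D := DirectSum.decompose (fun k : ℕ => ⋀[K]^k M) x
  classical
  have hsum : x = ∑ k ∈ D.support, (D k : ExteriorAlgebra K M) :=
    (DirectSum.sum_support_decompose (fun k : ℕ => ⋀[K]^k M) x).symm
  have h3 : ∑ k ∈ D.support, (((k : K) • D k : ⋀[K]^k M) : ExteriorAlgebra K M) = 0 := by
    rw [← h0]
    conv_rhs => rw [hsum, map_sum]
    exact Finset.sum_congr rfl fun k _ => (hdeg k _ (D k).2).symm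
  have h4 : ∀ k ∈ D.support, ((k : K) • D k : ⋀[K]^k M) = 0 := by
    intro k hk
    have h5 := congrArg (fun y => (DirectSum.decompose (fun k : ℕ => ⋀[K]^k M) y) k) h3
    simp only [DirectSum.decompose_sum, DirectSum.decompose_coe, DirectSum.decompose_zero] at h5
    rw [DFinsupp.finsetSum_apply, Finset.sum_eq_single k] at h5
    · simpa using h5
    · intro j _ hj
      exact DirectSum.of_eq_of_ne _ _ _ hj.symm
    · intro h; exact absurd hk h
  have h6 : x ∈ (1 : Submodule K (ExteriorAlgebra K M)) := by
    rw [hsum]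
    refine Submodule.sum_mem _ fun k hk => ?_
    rcases Nat.eq_zero_or_pos k with rfl | hpos
    · exact (D 0).2
    · rw [(smul_eq_zero.1 (h4 k hk)).resolve_left (Nat.cast_ne_zero.2 hpos.ne')]
      exact Submodule.zero_mem _
  obtain ⟨r, hr⟩ := Submodule.mem_one.1 h6
  exact ⟨r, hr.symm⟩

/-- Schur's lemma for the Fock space `⋀ U`: an operator commuting with multiplication by `U` and
with all contractions is a scalar, as it maps the vacuum `1` to a vector killed by all
contractions, and `1` generates `⋀ U`. -/
lemma exists_eq_smul_of_commute_fock {X : Type*} [AddCommGroup X] [Module ℂ X]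
    [FiniteDimensional ℂ X] (β : LinearMap.BilinForm ℂ X) {U K : Submodule ℂ X} (h : IsCompl U K)
    (hU : ∀ u ∈ U, ∀ v ∈ U, β u v = 0) (T : Module.End ℂ (ExteriorAlgebra ℂ U))
    (hTU : ∀ u ∈ U, ∀ s, T (fock β h u s) = fock β h u (T s))
    (hTK : ∀ d : Module.Dual ℂ U, ∃ w ∈ K, (∀ u : U, β w u = d u) ∧
      ∀ s, T (fock β h w s) = fock β h w (T s)) :
    ∃ κ : ℂ, T = κ • 1 := by
  obtain ⟨κ, hκ⟩ := exterior_eq_algebraMap_of_contractLeft_eq_zero (T 1) fun d => by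
    obtain ⟨w, hw, hwd, hwT⟩ := hTK ((1 / 2 : ℂ) • d)
    have h1 := hwT 1
    have h2 : U.subtype.dualMap ((2 : ℂ) • β w) = d := by
      ext u
      simp [hwd]
    simp only [fock_apply, Submodule.projectionOnto_apply_of_mem_right _ hw, map_zero, zero_mul,
      h2, contractLeft_one, sub_zero, zero_sub] at h1
    exact neg_eq_zero.1 h1.symm
  refine ⟨κ, LinearMap.ext fun s => ?_⟩
  rw [LinearMap.smul_apply, Module.End.one_apply]
  induction s using CliffordAlgebra.left_induction with
  | algebraMap r =>
    rw [Algebra.algebraMap_eq_smul_one, map_smul]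
    change r • T 1 = _
    rw [hκ, Algebra.algebraMap_eq_smul_one, smul_comm]
  | add x y hx hy => rw [map_add, hx, hy, smul_add]
  | ι_mul x m hx =>
    have h1 : ∀ s, fock β h m s = ι (0 : QuadraticForm ℂ U) m * s := by
      intro s
      have h2 : U.subtype.dualMap ((2 : ℂ) • β m) = 0 := by
        ext u
        simp [hU m m.2 u u.2]
      rw [fock_apply, h2, map_zero, LinearMap.zero_apply, sub_zero,
        Submodule.projectionOnto_apply_of_mem_left _ m.2]
    rw [← h1, hTU m m.2, hx, map_smul]

end Commutant

/-! ### The volume element -/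

section Volume

open CliffordAlgebra

variable {V : Type*} [AddCommGroup V] [Module ℝ V] {B : LinearMap.BilinForm ℝ V}

lemma ι_mul_ι_of_ortho (hB : ∀ v w, B v w = B w v) {v w : V} (h : B v w = 0) :
    ι (negForm B) v * ι (negForm B) w = -(ι (negForm B) w * ι (negForm B) v) := by
  rw [eq_neg_iff_add_eq_zero, ι_mul_ι_add_swap]
  simp [QuadraticMap.polar, negForm_apply, h, hB w v]

/-- The product `ω` of an orthogonal basis satisfies `v ω = -ε(ω) v` for all vectors `v`, the
negative of the sign rule. -/
lemma exists_volume [FiniteDimensional ℝ V] (hB : ∀ v w, B v w = B w v)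
    (hpos : ∀ v, v ≠ 0 → 0 < B v v) :
    ∃ ω : CliffordAlgebra (negForm B), IsUnit ω ∧
      involute ω = (-1 : ℝ) ^ Module.finrank ℝ V • ω ∧
      ∀ v, ι _ v * ω = -(involute ω * ι _ v) := by
  obtain ⟨e, he⟩ := LinearMap.BilinForm.exists_orthogonal_basis (B := B) ⟨hB⟩
  have hprod : ∀ l : List V, l.Pairwise (fun v w => B v w = 0) →
      (involute (l.map (ι (negForm B))).prod =
        (-1 : ℝ) ^ l.length • (l.map (ι (negForm B))).prod) ∧
      (∀ v, (∀ w ∈ l, B v w = 0) → ι (negForm B) v * (l.map (ι (negForm B))).prod =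
        involute (l.map (ι (negForm B))).prod * ι _ v) ∧
      ∀ v ∈ l, ι (negForm B) v * (l.map (ι (negForm B))).prod =
        -(involute (l.map (ι (negForm B))).prod * ι _ v) := by
    intro l hl
    induction l with
    | nil => simp
    | cons w l ih =>
      rw [List.pairwise_cons] at hl
      obtain ⟨ih1, ih2, ih3⟩ := ih hl.2
      simp only [List.map_cons, List.prod_cons, List.length_cons, List.mem_cons, map_mul,
        involute_ι]
      refine ⟨?_, fun v hv => ?_, ?_⟩
      · rw [ih1, pow_succ]
        simp
      · rw [← mul_assoc, ι_mul_ι_of_ortho hB (hv w (Or.inl rfl)), neg_mul, mul_assoc,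
          ih2 v fun x hx => hv x (Or.inr hx)]
        simp only [neg_mul, mul_assoc]
      · rintro v (rfl | hv)
        · rw [ih2 v hl.1]
          simp only [neg_mul, neg_neg, mul_assoc]
        · have h1 : B v w = 0 := by rw [hB]; exact hl.1 v hv
          rw [← mul_assoc, ι_mul_ι_of_ortho hB h1, neg_mul, mul_assoc, ih3 v hv]
          simp only [neg_mul, mul_neg, mul_assoc]
  let l := List.ofFn e
  have hl : l.Pairwise (fun v w => B v w = 0) := by
    rw [List.pairwise_ofFn]
    intro i j hij
    exact he hij.ne
  obtain ⟨h1, -, h3⟩ := hprod l hl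
  refine ⟨(l.map (ι (negForm B))).prod, ?_, ?_, fun v => ?_⟩
  rotate_left
  · rw [h1, List.length_ofFn]
  · have h4 : (LinearMap.mulRight ℝ (l.map (ι (negForm B))).prod ∘ₗ ι (negForm B)) =
        -(LinearMap.mulLeft ℝ (involute (l.map (ι (negForm B))).prod) ∘ₗ ι (negForm B)) := by
      refine e.ext fun i => ?_
      exact h3 (e i) (List.mem_ofFn.2 ⟨i, rfl⟩)
    exact LinearMap.congr_fun h4 v
  · have h5 : ∀ l : List V, (∀ v ∈ l, v ≠ 0) → IsUnit (l.map (ι (negForm B))).prod := by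
      intro l hl
      induction l with
      | nil => simp
      | cons v l ih =>
        rw [List.map_cons, List.prod_cons]
        refine IsUnit.mul ?_ (ih fun w hw => hl w (List.mem_cons_of_mem _ hw))
        refine (isUnit_pow_iff two_ne_zero).1 ?_
        rw [pow_two, ι_sq_scalar]
        exact (IsUnit.mk0 _ (neg_ne_zero.2 (hpos v (hl v List.mem_cons_self)).ne')).map _
    refine h5 l fun v hv => ?_
    obtain ⟨i, rfl⟩ := List.mem_ofFn.1 hv
    exact e.ne_zero i

end Volume

/-! ### Supertraces of elements over transformations without fixed vectors -/

section Supertrace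

open CliffordAlgebra

variable {V : Type*} [AddCommGroup V] [Module ℝ V] {B : LinearMap.BilinForm ℝ V}

/-- Moving a vector cyclically around a functional `f` replaces it by its image under `g`, up to
the sign rule and terms of lower degree; if `1 - g` is surjective, this determines `f` from its
value at `1`. -/
lemma eq_zero_of_twisted_cyclic (hB : ∀ v w, B v w = B w v)
    (f : CliffordAlgebra (negForm B) →ₗ[ℝ] ℂ) (g : V →ₗ[ℝ] V)
    (hg : Function.Surjective fun v => v - g v)
    (hf : ∀ b v, f (b * ι _ v) = -f (ι _ (g v) * b)) (hε : ∀ b, f (involute b) = f b)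
    (h1 : f 1 = 0) : f = 0 := by
  have key : ∀ b v, f (b * ι _ (v - g v)) = -f (contractLeft ((-2 : ℝ) • B (g v)) b) := by
    intro b v
    have h2 : f (involute b * ι _ (g v)) = -f (b * ι _ (g v)) := by
      rw [← hε, map_mul, involute_involute, involute_ι, mul_neg, map_neg]
    rw [ι_mul_sub_involute_mul_ι hB, map_sub, map_sub, mul_sub, map_sub, hf, h2]
    ring
  -- `S ^ k` consists of the elements of filtration degree at most `k`.
  let S : Submodule ℝ (CliffordAlgebra (negForm B)) := 1 ⊔ LinearMap.range (ι (negForm B))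
  have hS1 : 1 ≤ S := le_sup_left
  have hmono : ∀ k, S ^ k ≤ S ^ (k + 1) := fun k => by
    rw [pow_succ]; exact le_mul_of_one_le_right' hS1
  have hcontr : ∀ d k, ∀ b ∈ S ^ k, contractLeft d b ∈ S ^ k := by
    intro d k
    induction k with
    | zero =>
      intro b hb
      rw [pow_zero] at hb
      obtain ⟨r, rfl⟩ := Submodule.mem_one.1 hb
      rw [contractLeft_algebraMap]
      exact Submodule.zero_mem _
    | succ k ih =>
      intro b hb
      have hb' := hb
      rw [pow_succ'] at hb'
      induction hb' using Submodule.mul_induction_on' with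
      | mem_mul_mem s hs b hb0 =>
        obtain ⟨y, hy, z, ⟨m, rfl⟩, rfl⟩ := Submodule.mem_sup.1 hs
        obtain ⟨r, rfl⟩ := Submodule.mem_one.1 hy
        rw [add_mul, map_add, contractLeft_ι_mul, contractLeft_algebraMap_mul]
        refine Submodule.add_mem _ ?_ (Submodule.sub_mem _ ?_ ?_)
        · rw [← Algebra.smul_def]
          exact hmono k (Submodule.smul_mem _ _ (ih b hb0))
        · exact hmono k (Submodule.smul_mem _ _ hb0)
        · rw [pow_succ']
          exact Submodule.mul_mem_mul (Submodule.mem_sup_right ⟨m, rfl⟩) (ih b hb0)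
      | add x hx y hy ihx ihy =>
        rw [← pow_succ'] at hx hy
        rw [map_add]
        exact Submodule.add_mem _ (ihx hx) (ihy hy)
  have hvan : ∀ k, ∀ b ∈ S ^ k, f b = 0 := by
    intro k
    induction k with
    | zero =>
      intro b hb
      rw [pow_zero] at hb
      obtain ⟨r, rfl⟩ := Submodule.mem_one.1 hb
      rw [Algebra.algebraMap_eq_smul_one, map_smul, h1, smul_zero]
    | succ k ih =>
      intro b hb
      rw [pow_succ] at hb
      induction hb using Submodule.mul_induction_on' with
      | mem_mul_mem b hb0 s hs =>
        obtain ⟨y, hy, z, ⟨m, rfl⟩, rfl⟩ := Submodule.mem_sup.1 hs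
        obtain ⟨r, rfl⟩ := Submodule.mem_one.1 hy
        obtain ⟨v, rfl⟩ := hg m
        rw [mul_add, map_add, key, ih _ (hcontr _ k b hb0), ← Algebra.commutes, ← Algebra.smul_def,
          map_smul, ih b hb0, smul_zero, neg_zero, add_zero]
      | add x hx y hy ihx ihy => rw [map_add, ihx, ihy, add_zero]
  have hall : ∀ b : CliffordAlgebra (negForm B), ∃ k, b ∈ S ^ k := by
    intro b
    induction b using CliffordAlgebra.left_induction with
    | algebraMap r => exact ⟨0, by rw [pow_zero]; exact Submodule.mem_one.2 ⟨r, rfl⟩⟩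
    | add x y hx hy =>
      obtain ⟨k, hk⟩ := hx
      obtain ⟨l, hl⟩ := hy
      have hm : Monotone fun k => S ^ k := monotone_nat_of_le_succ hmono
      exact ⟨max k l, Submodule.add_mem _ (hm (le_max_left k l) hk) (hm (le_max_right k l) hl)⟩
    | ι_mul x m hx =>
      obtain ⟨k, hk⟩ := hx
      exact ⟨k + 1, by
        rw [pow_succ']; exact Submodule.mul_mem_mul (Submodule.mem_sup_right ⟨m, rfl⟩) hk⟩
  refine LinearMap.ext fun b => ?_
  obtain ⟨k, hk⟩ := hall b
  exact hvan k b hk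

/-- A supertrace (`σ = 1`), or a trace on odd elements (`σ = -1`), that vanishes at an element
of the Pin group lying over a transformation without fixed vectors is identically zero. -/
lemma supertrace_eq_zero [FiniteDimensional ℝ V] (hB : ∀ v w, B v w = B w v)
    {H : Subgroup (V ≃ₗ[ℝ] V)} (τ : CliffordAlgebra (negForm B) →ₗ[ℝ] ℂ) (σ : ℝ) (hσ : σ * σ = 1)
    (hτ : ∀ b v, τ (b * ι _ v) = -(σ • τ (ι _ v * b))) (hε : ∀ b, τ (involute b) = σ • τ b)
    (a : pinPreimage (negForm B) H)
    (ha : involute ((a : (CliffordAlgebra (negForm B))ˣ) : CliffordAlgebra (negForm B)) =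
      σ • ((a : (CliffordAlgebra (negForm B))ˣ) : CliffordAlgebra (negForm B)))
    (hfix : ∀ v, (pinProj (negForm B) H a : V ≃ₗ[ℝ] V) v = v → v = 0)
    (h0 : τ ((a : (CliffordAlgebra (negForm B))ˣ) : CliffordAlgebra (negForm B)) = 0) :
    τ = 0 := by
  set x := (a : (CliffordAlgebra (negForm B))ˣ)
  set g := (pinProj (negForm B) H a : V ≃ₗ[ℝ] V)
  have hcomm : ∀ v, ι (negForm B) v * (x : CliffordAlgebra (negForm B)) =
      σ • ((x : CliffordAlgebra (negForm B)) * ι _ (g.symm v)) := by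
    intro v
    have h1 := ι_pinProj a (g.symm v)
    rw [show (pinProj (negForm B) H a : V ≃ₗ[ℝ] V) (g.symm v) = v from g.apply_symm_apply v, ha]
      at h1
    rw [h1, mul_assoc, Units.inv_mul, mul_one, smul_mul_assoc]
  let f : CliffordAlgebra (negForm B) →ₗ[ℝ] ℂ :=
    τ ∘ₗ LinearMap.mulRight ℝ (x : CliffordAlgebra (negForm B))
  have hfb : ∀ b, f b = τ (b * (x : CliffordAlgebra (negForm B))) := fun b => rfl
  have hinj : Function.Injective ((LinearMap.id - (g.symm : V →ₗ[ℝ] V) : V →ₗ[ℝ] V)) := by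
    rw [injective_iff_map_eq_zero]
    intro v hv
    refine hfix v ?_
    have h1 : v = g.symm v := sub_eq_zero.1 hv
    exact (LinearEquiv.eq_symm_apply g).1 h1
  have hf : f = 0 := by
    refine eq_zero_of_twisted_cyclic hB f (g.symm : V →ₗ[ℝ] V)
      (LinearMap.injective_iff_surjective.1 hinj) (fun b v => ?_) (fun b => ?_) ?_
    · simp only [hfb, LinearEquiv.coe_coe]
      rw [mul_assoc, hcomm, mul_smul_comm, map_smul, ← mul_assoc, hτ, smul_neg, smul_smul, hσ,
        one_smul, mul_assoc]
    · have h1 := hε (b * (x : CliffordAlgebra (negForm B)))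
      rw [map_mul, ha, mul_smul_comm, map_smul] at h1
      have h2 := congrArg (fun c => σ • c) h1
      simp only [smul_smul, hσ, one_smul] at h2
      exact h2
    · rw [hfb, one_mul, h0]
  refine LinearMap.ext fun b => ?_
  have h1 := LinearMap.congr_fun hf
    (b * ((x⁻¹ : (CliffordAlgebra (negForm B))ˣ) : CliffordAlgebra (negForm B)))
  rw [hfb, mul_assoc, Units.inv_mul, mul_one] at h1
  exact h1

end Supertrace

/-! ### Nonvanishing of the virtual spin character -/

section Spinors

open CliffordAlgebra

variable {V : Type*} [AddCommGroup V] [Module ℝ V]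
  {B : LinearMap.BilinForm ℝ V}

/-- The complexification of a definite form represents every functional. -/
lemma baseChange_surjective [FiniteDimensional ℝ V] (hpos : ∀ v, v ≠ 0 → 0 < B v v) :
    Function.Surjective (B.baseChange ℂ) := by
  have hinj : Function.Injective B := by
    rw [injective_iff_map_eq_zero]
    intro v hv
    by_contra h
    have := hpos v h
    rw [hv] at this
    simp at this
  have hsurj : Function.Surjective B :=
    (LinearMap.injective_iff_surjective_of_finrank_eq_finrank
      (Subspace.dual_finrank_eq (K := ℝ) (V := V)).symm).1 hinj
  intro d
  let d' : V →ₗ[ℝ] ℂ := d.restrictScalars ℝ ∘ₗ TensorProduct.mk ℝ ℂ V 1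
  obtain ⟨v, hv⟩ := hsurj (Complex.reLm ∘ₗ d')
  obtain ⟨w, hw⟩ := hsurj (Complex.imLm ∘ₗ d')
  refine ⟨1 ⊗ₜ v + Complex.I ⊗ₜ w, TensorProduct.AlgebraTensorModule.curry_injective ?_⟩
  refine LinearMap.ext_ring (LinearMap.ext fun y => ?_)
  have h1 : B v y = (d (1 ⊗ₜ y)).re := LinearMap.congr_fun hv y
  have h2 : B w y = (d (1 ⊗ₜ y)).im := LinearMap.congr_fun hw y
  change B.baseChange ℂ (1 ⊗ₜ v + Complex.I ⊗ₜ w) (1 ⊗ₜ y) = d (1 ⊗ₜ y)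
  rw [map_add, LinearMap.add_apply, LinearMap.BilinForm.baseChange_tmul,
    LinearMap.BilinForm.baseChange_tmul, h1, h2]
  conv_rhs => rw [← Complex.re_add_im (d (1 ⊗ₜ y))]
  simp [mul_comm]

lemma toComplex_ι (v : V) : toComplex B (ι _ v) = ι (negForm (B.baseChange ℂ)) (1 ⊗ₜ v) := by
  simp [toComplex]

/-- Operators commuting with the real vectors commute with all complex vectors. -/
lemma commute_of_commute_real {M : Type*} [AddCommGroup M] [Module ℂ M]
    (φ : CliffordAlgebra (negForm (B.baseChange ℂ)) →ₐ[ℂ] Module.End ℂ M) (T : Module.End ℂ M)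
    (hT : ∀ v, T * φ (toComplex B (ι _ v)) = φ (toComplex B (ι _ v)) * T) (x : ℂ ⊗[ℝ] V) :
    T * φ (ι _ x) = φ (ι _ x) * T := by
  induction x using TensorProduct.induction_on with
  | zero => simp
  | tmul c v =>
    have h1 : c ⊗ₜ[ℝ] v = c • ((1 : ℂ) ⊗ₜ[ℝ] v) := by simp [TensorProduct.smul_tmul']
    rw [h1, map_smul, map_smul, mul_smul_comm, smul_mul_assoc, ← toComplex_ι, hT]
  | add x y hx hy => rw [map_add, map_add, mul_add, add_mul, hx, hy]

/-- Functionals on `U` are represented by vectors of the isotropic complement `U'`. -/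
lemma EvenPolarization.exists_representing [FiniteDimensional ℝ V]
    {D : EvenPolarization (B.baseChange ℂ)}
    (hpos : ∀ v, v ≠ 0 → 0 < B v v) (d : Module.Dual ℂ D.U) :
    ∃ w ∈ D.U', ∀ u : D.U, B.baseChange ℂ w u = d u := by
  obtain ⟨x, hx⟩ := baseChange_surjective hpos (d ∘ₗ Submodule.projectionOnto D.U _ D.isCompl)
  obtain ⟨u, hu, w, hw, rfl⟩ : ∃ u ∈ D.U, ∃ w ∈ D.U', u + w = x := by
    rw [← Submodule.mem_sup, D.isCompl.sup_eq_top]; trivial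
  refine ⟨w, hw, fun y => ?_⟩
  have h1 := LinearMap.congr_fun hx (y : ℂ ⊗[ℝ] V)
  rw [map_add, LinearMap.add_apply, D.isotropic u hu y y.2, zero_add, LinearMap.comp_apply,
    Submodule.projectionOnto_apply_of_mem_left _ y.2] at h1
  exact h1

lemma OddPolarization.exists_representing [FiniteDimensional ℝ V]
    {D : OddPolarization (B.baseChange ℂ)}
    (hpos : ∀ v, v ≠ 0 → 0 < B v v) (d : Module.Dual ℂ D.U) :
    ∃ w ∈ D.U', ∀ u : D.U, B.baseChange ℂ w u = d u := by
  obtain ⟨x, hx⟩ := baseChange_surjective hpos (d ∘ₗ Submodule.projectionOnto D.U _ D.isCompl)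
  obtain ⟨u, hu, w', hw', rfl⟩ : ∃ u ∈ D.U, ∃ w ∈ D.U' ⊔ Submodule.span ℂ {D.u₀}, u + w = x := by
    rw [← Submodule.mem_sup, D.isCompl.sup_eq_top]; trivial
  obtain ⟨w, hw, y, hy, rfl⟩ := Submodule.mem_sup.1 hw'
  obtain ⟨c, rfl⟩ := Submodule.mem_span_singleton.1 hy
  refine ⟨w, hw, fun y => ?_⟩
  have h1 := LinearMap.congr_fun hx (y : ℂ ⊗[ℝ] V)
  simp only [map_add, LinearMap.add_apply, D.isotropic u hu y y.2, zero_add, LinearMap.comp_apply,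
    map_smul, LinearMap.smul_apply, D.orthogonal y y.2, smul_zero, add_zero,
    Submodule.projectionOnto_apply_of_mem_left _ y.2] at h1
  exact h1

lemma OddPolarization.spinHom_ι {X : Type*} [AddCommGroup X] [Module ℂ X]
    {β : LinearMap.BilinForm ℂ X} (D : OddPolarization β) (hβ : ∀ v w, β v w = β w v)
    (z : ℂ) (hz : z ^ 2 = -1) (v : X) (s : ExteriorAlgebra ℂ D.U) :
    D.spinHom hβ z hz (ι _ v) s = fock β D.isCompl v s + β D.u₀ v • z • parity D.U s := by
  simp [OddPolarization.spinHom]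

/-- The spin module for `-z` is the one for `z`, twisted by the parity automorphism. -/
lemma OddPolarization.parity_spinHom {X : Type*} [AddCommGroup X] [Module ℂ X]
    {β : LinearMap.BilinForm ℂ X} (D : OddPolarization β) (hβ : ∀ v w, β v w = β w v)
    (z : ℂ) (hz : z ^ 2 = -1) (hz' : (-z) ^ 2 = -1) (x : CliffordAlgebra (negForm β))
    (s : ExteriorAlgebra ℂ D.U) :
    parity D.U (D.spinHom hβ (-z) hz' x s) = D.spinHom hβ z hz (involute x) (parity D.U s) := by
  induction x using CliffordAlgebra.left_induction generalizing s with
  | algebraMap r => simp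
  | add x y hx hy => simp only [map_add, LinearMap.add_apply, hx, hy]
  | ι_mul x m hx =>
    simp only [map_mul, Module.End.mul_apply, involute_ι, map_neg, LinearMap.neg_apply, ← hx,
      D.spinHom_ι, fock_parity, neg_mul, map_add, map_smul, neg_smul, smul_neg, neg_add]

lemma OddPolarization.trace_spinHom_neg [FiniteDimensional ℝ V]
    (D : OddPolarization (B.baseChange ℂ))
    (hβ : ∀ v w, B.baseChange ℂ v w = B.baseChange ℂ w v)
    (z : ℂ) (hz : z ^ 2 = -1) (hz' : (-z) ^ 2 = -1)
    (x : CliffordAlgebra (negForm (B.baseChange ℂ))) :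
    LinearMap.trace ℂ _ (D.spinHom hβ (-z) hz' x) =
      LinearMap.trace ℂ _ (D.spinHom hβ z hz (involute x)) := by
  have h1 : D.spinHom hβ (-z) hz' x =
      parity D.U * (D.spinHom hβ z hz (involute x) * parity D.U) := by
    refine LinearMap.ext fun s => ?_
    rw [Module.End.mul_apply, Module.End.mul_apply, ← D.parity_spinHom hβ z hz hz',
      parity_parity]
  have h2 : parity D.U * parity D.U = 1 := LinearMap.ext fun s => parity_parity D.U s
  rw [h1, LinearMap.trace_mul_comm, mul_assoc, h2, mul_one]

/-- If the supertrace of a module with grading operator `Γ` vanishes at an even element of the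
Pin group over a transformation without fixed vectors, it vanishes identically. -/
lemma trace_parity_mul_eq_zero [FiniteDimensional ℝ V] {M : Type*} [AddCommGroup M] [Module ℂ M]
    [FiniteDimensional ℂ M] (hB : ∀ v w, B v w = B w v) {H : Subgroup (V ≃ₗ[ℝ] V)}
    (φ : CliffordAlgebra (negForm (B.baseChange ℂ)) →ₐ[ℂ] Module.End ℂ M) (Γ : Module.End ℂ M)
    (hΓφ : ∀ x, Γ * φ x = φ (involute x) * Γ) (a : pinPreimage (negForm B) H)
    (ha : involute ((a : (CliffordAlgebra (negForm B))ˣ) : CliffordAlgebra (negForm B)) =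
      ((a : (CliffordAlgebra (negForm B))ˣ) : CliffordAlgebra (negForm B)))
    (hfix : ∀ v, (pinProj (negForm B) H a : V ≃ₗ[ℝ] V) v = v → v = 0)
    (h0 : LinearMap.trace ℂ M (Γ * φ (toComplex B
      ((a : (CliffordAlgebra (negForm B))ˣ) : CliffordAlgebra (negForm B)))) = 0)
    (b : CliffordAlgebra (negForm B)) : LinearMap.trace ℂ M (Γ * φ (toComplex B b)) = 0 := by
  have hm : ∀ x y, φ (toComplex B (x * y)) = φ (toComplex B x) * φ (toComplex B y) :=
    fun x y => by rw [map_mul, map_mul]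
  let τ : CliffordAlgebra (negForm B) →ₗ[ℝ] ℂ :=
    ((LinearMap.trace ℂ _ ∘ₗ LinearMap.mulLeft ℂ Γ ∘ₗ φ.toLinearMap).restrictScalars ℝ) ∘ₗ
      (toComplex B).toLinearMap
  have hτb : ∀ b, τ b = LinearMap.trace ℂ _ (Γ * φ (toComplex B b)) := fun b => rfl
  have hτ : τ = 0 := by
    refine supertrace_eq_zero hB τ 1 (one_mul 1) (fun b v => ?_) (fun b => ?_) a
      (by rw [ha, one_smul]) hfix h0
    · rw [one_smul, hτb, hτb, hm, hm, ← mul_assoc, LinearMap.trace_mul_comm, ← mul_assoc,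
        ← mul_assoc, hΓφ, ← toComplex_involute, involute_ι,
        map_neg, map_neg, neg_mul, neg_mul, map_neg, neg_neg]
    · rw [one_smul, hτb, hτb, toComplex_involute, hΓφ, involute_involute,
        LinearMap.trace_mul_comm]
  exact LinearMap.congr_fun hτ b

/-- If the difference of the traces of a module and of its twist by the automorphism `ε` vanishes
at an odd element of the Pin group over a transformation without fixed vectors, it vanishes
identically. -/
lemma trace_sub_involute_eq_zero [FiniteDimensional ℝ V] {M : Type*} [AddCommGroup M] [Module ℂ M]
    [FiniteDimensional ℂ M] (hB : ∀ v w, B v w = B w v) {H : Subgroup (V ≃ₗ[ℝ] V)}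
    (φ : CliffordAlgebra (negForm (B.baseChange ℂ)) →ₐ[ℂ] Module.End ℂ M)
    (a : pinPreimage (negForm B) H)
    (ha : involute ((a : (CliffordAlgebra (negForm B))ˣ) : CliffordAlgebra (negForm B)) =
      -((a : (CliffordAlgebra (negForm B))ˣ) : CliffordAlgebra (negForm B)))
    (hfix : ∀ v, (pinProj (negForm B) H a : V ≃ₗ[ℝ] V) v = v → v = 0)
    (h0 : LinearMap.trace ℂ M (φ (toComplex B
        ((a : (CliffordAlgebra (negForm B))ˣ) : CliffordAlgebra (negForm B)))) -
      LinearMap.trace ℂ M (φ (involute (toComplex B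
        ((a : (CliffordAlgebra (negForm B))ˣ) : CliffordAlgebra (negForm B))))) = 0)
    (b : CliffordAlgebra (negForm B)) : LinearMap.trace ℂ M (φ (toComplex B b)) -
      LinearMap.trace ℂ M (φ (toComplex B (involute b))) = 0 := by
  have hm : ∀ x y, φ (toComplex B (x * y)) = φ (toComplex B x) * φ (toComplex B y) :=
    fun x y => by rw [map_mul, map_mul]
  let τ : CliffordAlgebra (negForm B) →ₗ[ℝ] ℂ :=
    ((LinearMap.trace ℂ _ ∘ₗ φ.toLinearMap).restrictScalars ℝ) ∘ₗ
      ((toComplex B).toLinearMap - (toComplex B).toLinearMap ∘ₗ involute.toLinearMap)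
  have hτb : ∀ b, τ b = LinearMap.trace ℂ _ (φ (toComplex B b)) -
      LinearMap.trace ℂ _ (φ (toComplex B (involute b))) := fun b => by simp [τ]
  have hτ : τ = 0 := by
    refine supertrace_eq_zero hB τ (-1) (by norm_num) (fun b v => ?_) (fun b => ?_) a
      (by rw [ha, neg_one_smul]) hfix ?_
    · rw [neg_smul, one_smul, neg_neg, hτb, hτb, map_mul involute, map_mul involute, hm, hm, hm,
        hm, LinearMap.trace_mul_comm, LinearMap.trace_mul_comm ℂ (φ (toComplex B (involute b)))]
    · rw [neg_one_smul, hτb, hτb, involute_involute, neg_sub]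
    · rw [hτb, toComplex_involute]; exact h0
  rw [← hτb, hτ, LinearMap.zero_apply]

/-- In even dimension, the product of the parity and the volume element commutes with all
vectors. -/
lemma parity_mul_volume_comm {M : Type*} [AddCommGroup M] [Module ℂ M]
    (φ : CliffordAlgebra (negForm (B.baseChange ℂ)) →ₐ[ℂ] Module.End ℂ M) (Γ : Module.End ℂ M)
    (hΓφ : ∀ x, Γ * φ x = φ (involute x) * Γ) {ω : CliffordAlgebra (negForm B)}
    (hω : involute ω = ω) (hωv : ∀ v, ι _ v * ω = -(involute ω * ι _ v)) (v : V) :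
    Γ * φ (toComplex B ω) * φ (toComplex B (ι _ v)) =
      φ (toComplex B (ι _ v)) * (Γ * φ (toComplex B ω)) := by
  have h1 : φ (toComplex B (ι _ v)) * φ (toComplex B ω) =
      -(φ (toComplex B ω) * φ (toComplex B (ι _ v))) := by
    rw [← map_mul, ← map_mul, ← map_mul, ← map_mul, hωv, hω, map_neg, map_neg]
  have h2 : Γ * φ (toComplex B (ι _ v)) = -(φ (toComplex B (ι _ v)) * Γ) := by
    rw [hΓφ, ← toComplex_involute, involute_ι, map_neg, map_neg, neg_mul]
  have h3 : φ (toComplex B (ι _ v)) * Γ = -(Γ * φ (toComplex B (ι _ v))) := by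
    rw [h2, neg_neg]
  rw [← mul_assoc, h3, neg_mul, mul_assoc, mul_assoc, h1, mul_neg, neg_neg]

/-- The supertrace of an even element of the Pin group over a transformation without fixed
vectors does not vanish: otherwise the supertrace would vanish identically, but the volume element
acts by a nonzero multiple of the parity. -/
lemma EvenPolarization.supertrace_ne_zero [FiniteDimensional ℝ V] (hB : ∀ v w, B v w = B w v)
    (hpos : ∀ v, v ≠ 0 → 0 < B v v) (hV : Even (Module.finrank ℝ V))
    (D : EvenPolarization (B.baseChange ℂ)) {H : Subgroup (V ≃ₗ[ℝ] V)}
    (a : pinPreimage (negForm B) H)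
    (ha : involute ((a : (CliffordAlgebra (negForm B))ˣ) : CliffordAlgebra (negForm B)) =
      ((a : (CliffordAlgebra (negForm B))ˣ) : CliffordAlgebra (negForm B)))
    (hfix : ∀ v, (pinProj (negForm B) H a : V ≃ₗ[ℝ] V) v = v → v = 0) :
    LinearMap.trace ℂ _ (parity D.U * D.spinHom (baseChange_symm hB)
      (toComplex B ((a : (CliffordAlgebra (negForm B))ˣ) : CliffordAlgebra (negForm B)))) ≠ 0 := by
  intro h0
  obtain ⟨φ, hφ⟩ : ∃ φ, φ = D.spinHom (baseChange_symm hB) := ⟨_, rfl⟩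
  obtain ⟨Γ, hΓ⟩ : ∃ Γ, Γ = parity D.U := ⟨_, rfl⟩
  rw [← hφ, ← hΓ] at h0
  have hΓφ : ∀ x, Γ * φ x = φ (involute x) * Γ := fun x =>
    LinearMap.ext fun s => by rw [hφ, hΓ]; exact D.parity_spinHom (baseChange_symm hB) x s
  have hΓΓ : Γ * Γ = 1 := LinearMap.ext fun s => by rw [hΓ]; exact parity_parity D.U s
  have hτ := trace_parity_mul_eq_zero hB φ Γ hΓφ a ha hfix h0
  obtain ⟨ω, hω, hω', hωv⟩ := exists_volume hB hpos
  rw [hV.neg_one_pow, one_smul] at hω'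
  obtain ⟨T, hTdef⟩ : ∃ T, T = Γ * φ (toComplex B ω) := ⟨_, rfl⟩
  have hT : ∀ v, T * φ (toComplex B (ι _ v)) = φ (toComplex B (ι _ v)) * T := by
    rw [hTdef]
    exact parity_mul_volume_comm φ Γ hΓφ hω' hωv
  have hTx := commute_of_commute_real φ T hT
  have hTf : ∀ x s, T (fock (B.baseChange ℂ) D.isCompl x s) =
      fock (B.baseChange ℂ) D.isCompl x (T s) := by
    intro x s
    have h1 := LinearMap.congr_fun (hTx x) s
    rwa [Module.End.mul_apply, Module.End.mul_apply, hφ, D.spinHom_ι] at h1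
  obtain ⟨κ, hκ⟩ := exists_eq_smul_of_commute_fock (B.baseChange ℂ) D.isCompl D.isotropic T
    (fun u _ s => hTf u s) fun d => by
      obtain ⟨w, hw, hwd⟩ := D.exists_representing hpos d
      exact ⟨w, hw, hwd, hTf w⟩
  have h1 := hτ ω
  rw [← hTdef, hκ, map_smul, LinearMap.trace_one, smul_eq_mul] at h1
  have hTu : IsUnit T := by
    rw [hTdef]
    exact (IsUnit.of_mul_eq_one Γ hΓΓ).mul ((hω.map (toComplex B)).map φ)
  have h2 : (Module.finrank ℂ (ExteriorAlgebra ℂ D.U) : ℂ) ≠ 0 :=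
    Nat.cast_ne_zero.2 Module.finrank_pos.ne'
  rw [(mul_eq_zero.1 h1).resolve_right h2, zero_smul] at hκ
  exact hTu.ne_zero hκ

/-- The traces of an odd element of the Pin group over a transformation without fixed vectors, in
the two spin modules in odd dimension, are different: otherwise the two traces would agree
identically, but the volume element acts by opposite nonzero scalars. -/
lemma OddPolarization.trace_sub_ne_zero [FiniteDimensional ℝ V] (hB : ∀ v w, B v w = B w v)
    (hpos : ∀ v, v ≠ 0 → 0 < B v v) (hV : Odd (Module.finrank ℝ V))
    (D : OddPolarization (B.baseChange ℂ)) {H : Subgroup (V ≃ₗ[ℝ] V)}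
    (z : ℂ) (hz : z ^ 2 = -1) (a : pinPreimage (negForm B) H)
    (ha : involute ((a : (CliffordAlgebra (negForm B))ˣ) : CliffordAlgebra (negForm B)) =
      -((a : (CliffordAlgebra (negForm B))ˣ) : CliffordAlgebra (negForm B)))
    (hfix : ∀ v, (pinProj (negForm B) H a : V ≃ₗ[ℝ] V) v = v → v = 0) :
    LinearMap.trace ℂ _ (D.spinHom (baseChange_symm hB) z hz
        (toComplex B ((a : (CliffordAlgebra (negForm B))ˣ) : CliffordAlgebra (negForm B)))) -
      LinearMap.trace ℂ _ (D.spinHom (baseChange_symm hB) z hz (involute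
        (toComplex B ((a : (CliffordAlgebra (negForm B))ˣ) : CliffordAlgebra (negForm B))))) ≠
      0 := by
  intro h0
  obtain ⟨φ, hφ⟩ : ∃ φ, φ = D.spinHom (baseChange_symm hB) z hz := ⟨_, rfl⟩
  rw [← hφ] at h0
  have hτ := trace_sub_involute_eq_zero hB φ a ha hfix h0
  obtain ⟨ω, hω, hω', hωv⟩ := exists_volume hB hpos
  rw [hV.neg_one_pow, neg_one_smul] at hω'
  obtain ⟨T, hTdef⟩ : ∃ T, T = φ (toComplex B ω) := ⟨_, rfl⟩
  have hT : ∀ v, T * φ (toComplex B (ι _ v)) = φ (toComplex B (ι _ v)) * T := by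
    intro v
    rw [hTdef, ← map_mul, ← map_mul, ← map_mul, ← map_mul, hωv, hω', neg_mul, neg_neg]
  have hTx := commute_of_commute_real φ T hT
  have hTf : ∀ x, B.baseChange ℂ D.u₀ x = 0 → ∀ s,
      T (fock (B.baseChange ℂ) D.isCompl x s) = fock (B.baseChange ℂ) D.isCompl x (T s) := by
    intro x hx s
    have h1 := LinearMap.congr_fun (hTx x) s
    rwa [Module.End.mul_apply, Module.End.mul_apply, hφ, D.spinHom_ι, D.spinHom_ι, hx, zero_smul,
      zero_smul, add_zero, add_zero] at h1
  obtain ⟨κ, hκ⟩ := exists_eq_smul_of_commute_fock (B.baseChange ℂ) D.isCompl D.isotropic T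
    (fun u hu s => hTf u (D.orthogonal u hu) s) fun d => by
      obtain ⟨w, hw, hwd⟩ := D.exists_representing hpos d
      exact ⟨w, Submodule.mem_sup_left hw, hwd, hTf w (D.orthogonal' w hw)⟩
  have h1 := hτ ω
  rw [hω', map_neg, map_neg, map_neg, ← hTdef, hκ, map_smul, LinearMap.trace_one, smul_eq_mul,
    sub_neg_eq_add, ← two_mul] at h1
  have hTu : IsUnit T := by
    rw [hTdef]
    exact (hω.map (toComplex B)).map φ
  have h2 : (Module.finrank ℂ (ExteriorAlgebra ℂ D.U) : ℂ) ≠ 0 :=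
    Nat.cast_ne_zero.2 Module.finrank_pos.ne'
  rw [(mul_eq_zero.1 ((mul_eq_zero.1 h1).resolve_left two_ne_zero)).resolve_right h2,
    zero_smul] at hκ
  exact hTu.ne_zero hκ

end Spinors

/-! ### Finite reflection groups: lengths and stabilizers -/

section ReflectionGroups

variable {ι V₀ V : Type*} [AddCommGroup V₀] [Module ℝ V₀] [AddCommGroup V] [Module ℝ V]
  {P : RootPairing ι ℝ V₀ V} {B : LinearMap.BilinForm ℝ V}

lemma IsNormalizedInner.injective (hB : IsNormalizedInner P B) : Function.Injective B := by
  rw [injective_iff_map_eq_zero]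
  intro v hv
  by_contra h
  have := hB.pos v h
  rw [hv] at this
  simp at this

lemma IsNormalizedInner.surjective [FiniteDimensional ℝ V] (hB : IsNormalizedInner P B) :
    Function.Surjective B :=
  (LinearMap.injective_iff_surjective_of_finrank_eq_finrank
    (Subspace.dual_finrank_eq (K := ℝ) (V := V)).symm).1 hB.injective

lemma IsNormalizedInner.coreflection_apply (hB : IsNormalizedInner P B) (i : ι) (v : V) :
    P.coreflection i v = v - B (P.coroot i) v • P.coroot i := by
  rw [P.coreflection_apply, hB.root_eq]

lemma coreflection_mem (P : RootPairing ι ℝ V₀ V) (i : ι) : P.coreflection i ∈ reflGroup P :=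
  Subgroup.subset_closure ⟨i, rfl⟩

lemma exists_apply_coroot_eq {g : V ≃ₗ[ℝ] V} (hg : g ∈ reflGroup P) (i : ι) :
    ∃ j, g (P.coroot i) = P.coroot j := by
  induction hg using Subgroup.closure_induction'' generalizing i with
  | mem g hg =>
    obtain ⟨j, rfl⟩ := hg
    exact ⟨_, (P.coroot_reflectionPerm j i).symm⟩
  | inv_mem g hg =>
    obtain ⟨j, rfl⟩ := hg
    exact ⟨_, (P.coroot_reflectionPerm j i).symm⟩
  | one => exact ⟨i, rfl⟩
  | mul x y _ _ hx hy =>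
    obtain ⟨j, hj⟩ := hy i
    obtain ⟨k, hk⟩ := hx j
    exact ⟨k, by rw [LinearEquiv.mul_apply, hj, hk]⟩

lemma IsNormalizedInner.mul_coreflection (hB : IsNormalizedInner P B) {g : V ≃ₗ[ℝ] V}
    (hg : g ∈ reflGroup P) {i j : ι}
    (h : g (P.coroot i) = P.coroot j ∨ g (P.coroot i) = -P.coroot j) :
    g * P.coreflection i = P.coreflection j * g := by
  apply LinearEquiv.ext
  intro v
  rw [LinearEquiv.mul_apply, LinearEquiv.mul_apply, hB.coreflection_apply, hB.coreflection_apply,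
    map_sub, map_smul, ← hB.invariant g hg (P.coroot i) v]
  rcases h with h | h <;> simp [h]

/-- The reflection group acts faithfully on the finite set of coroots. -/
lemma finite_reflGroup [Finite ι] [P.IsRootSystem] : Finite (reflGroup P) := by
  let F : reflGroup P → ι → ι := fun g i => (exists_apply_coroot_eq g.2 i).choose
  have hF : ∀ (g : reflGroup P) i, (g : V ≃ₗ[ℝ] V) (P.coroot i) = P.coroot (F g i) := fun g i =>
    (exists_apply_coroot_eq g.2 i).choose_spec
  refine Finite.of_injective F fun g h hgh => ?_
  apply Subtype.ext
  apply LinearEquiv.toLinearMap_injective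
  refine LinearMap.ext_on_range (RootPairing.IsRootSystem.span_coroot_eq_top (P := P)) fun i => ?_
  change (g : V ≃ₗ[ℝ] V) (P.coroot i) = (h : V ≃ₗ[ℝ] V) (P.coroot i)
  rw [hF, hF, hgh]

variable {r : ℕ} {b : Fin r → ι}

/-- The inner product identifies roots with coroots, so that simple roots give simple coroots. -/
lemma IsNormalizedInner.isSimpleSystem_flip (hB : IsNormalizedInner P B)
    (hb : IsSimpleSystem P b) : IsSimpleSystem P.flip b := by
  have h0 : ∀ i, P.toLinearMap (P.root i) = B (P.coroot i) := fun i =>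
    LinearMap.ext fun v => hB.root_eq i v
  constructor
  · have h1 : LinearIndependent ℝ (fun k => P.toLinearMap (P.root (b k))) :=
      hb.1.map' P.toLinearMap (LinearMap.ker_eq_bot.2 P.toPerfPair.injective)
    simp only [h0] at h1
    exact LinearIndependent.of_comp B h1
  · intro i
    obtain ⟨c, hc, hs⟩ := hb.2 i
    refine ⟨c, hB.injective ?_, hs⟩
    change B (P.coroot i) = B (∑ k, c k • P.coroot (b k))
    rw [← h0, hc, map_sum, map_sum]
    exact Finset.sum_congr rfl fun k _ => by rw [map_smul, map_smul, h0]

/-- The basis of simple coroots. -/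
def corootBasis [P.IsRootSystem] (hb : IsSimpleSystem P.flip b) : Module.Basis (Fin r) ℝ V :=
  Module.Basis.mk (v := fun k => P.coroot (b k)) hb.1 <| by
    rw [← RootPairing.IsRootSystem.span_coroot_eq_top (P := P), Submodule.span_le]
    rintro - ⟨i, rfl⟩
    obtain ⟨c, hc, -⟩ := hb.2 i
    change P.coroot i = ∑ k, c k • P.coroot (b k) at hc
    rw [hc]
    exact Submodule.sum_mem _ fun k _ =>
      Submodule.smul_mem _ _ (Submodule.subset_span ⟨k, rfl⟩)

lemma corootBasis_apply [P.IsRootSystem] (hb : IsSimpleSystem P.flip b) (k : Fin r) :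
    corootBasis hb k = P.coroot (b k) :=
  Module.Basis.mk_apply _ _ k

/-- There is a vector `ρ` with inner product one with all simple coroots; the inner product with
`ρ` is the height of a coroot. -/
lemma IsNormalizedInner.exists_height [FiniteDimensional ℝ V] [P.IsRootSystem]
    (hB : IsNormalizedInner P B) (hb : IsSimpleSystem P.flip b) :
    ∃ ρ, ∀ k, B ρ (P.coroot (b k)) = 1 := by
  obtain ⟨ρ, hρ⟩ := hB.surjective ((corootBasis hb).constr ℝ fun _ => (1 : ℝ))
  refine ⟨ρ, fun k => ?_⟩
  rw [hρ, ← corootBasis_apply hb, Module.Basis.constr_basis]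

lemma IsNormalizedInner.height_ne_zero (hB : IsNormalizedInner P B)
    (hb : IsSimpleSystem P.flip b) {ρ : V} (hρ : ∀ k, B ρ (P.coroot (b k)) = 1) (i : ι) :
    B ρ (P.coroot i) ≠ 0 := by
  intro h
  obtain ⟨c, hc, hs⟩ := hb.2 i
  change P.coroot i = ∑ k, c k • P.coroot (b k) at hc
  rw [hc] at h
  simp only [map_sum, map_smul, hρ, smul_eq_mul, mul_one] at h
  have h0 : ∀ k, c k = 0 := by
    rcases hs with hs | hs
    · exact fun k => (Finset.sum_eq_zero_iff_of_nonneg fun k _ => hs k).1 h k (Finset.mem_univ k)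
    · exact fun k => (Finset.sum_eq_zero_iff_of_nonpos fun k _ => hs k).1 h k (Finset.mem_univ k)
  have h2 := hB.norm_coroot i
  rw [hc] at h2
  simp [h0] at h2

lemma exists_nonneg_coeffs (hb : IsSimpleSystem P.flip b) {ρ : V}
    (hρ : ∀ k, B ρ (P.coroot (b k)) = 1) {i : ι} (hi : 0 < B ρ (P.coroot i)) :
    ∃ c : Fin r → ℝ, P.coroot i = ∑ k, c k • P.coroot (b k) ∧ ∀ k, 0 ≤ c k := by
  obtain ⟨c, hc, hs⟩ := hb.2 i
  change P.coroot i = ∑ k, c k • P.coroot (b k) at hc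
  refine ⟨c, hc, hs.resolve_right fun hs => ?_⟩
  rw [hc] at hi
  simp only [map_sum, map_smul, hρ, smul_eq_mul, mul_one] at hi
  exact absurd hi (not_lt.2 (Finset.sum_nonpos fun k _ => hs k))

/-- A simple reflection permutes the positive coroots other than its own. -/
lemma IsNormalizedInner.height_coreflection_pos (hB : IsNormalizedInner P B)
    (hb : IsSimpleSystem P.flip b) {ρ : V} (hρ : ∀ k, B ρ (P.coroot (b k)) = 1) {i : ι} (k : Fin r)
    (hi : 0 < B ρ (P.coroot i)) (hne : P.coroot i ≠ P.coroot (b k)) :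
    0 < B ρ (P.coreflection (b k) (P.coroot i)) := by
  obtain ⟨c, hc, hs⟩ := exists_nonneg_coeffs hb hρ hi
  by_contra hcon
  rw [← P.coroot_reflectionPerm] at hcon
  obtain ⟨c', hc', hs'⟩ := hb.2 (P.reflectionPerm (b k) i)
  change P.coroot _ = ∑ k, c' k • P.coroot (b k) at hc'
  have hs'' : ∀ l, c' l ≤ 0 := by
    refine hs'.resolve_left fun hs' => hB.height_ne_zero hb hρ (P.reflectionPerm (b k) i) ?_
    refine le_antisymm (not_lt.1 hcon) ?_
    rw [hc']
    simp only [map_sum, map_smul, hρ, smul_eq_mul, mul_one]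
    exact Finset.sum_nonneg fun l _ => hs' l
  have hcl : ∀ l, l ≠ k → c' l = c l := by
    have h1 : ∑ l, (c' l - c l + if l = k then B (P.coroot (b k)) (P.coroot i) else 0) •
        P.coroot (b l) = 0 := by
      simp only [add_smul, sub_smul, Finset.sum_add_distrib, Finset.sum_sub_distrib, ite_smul,
        zero_smul, Finset.sum_ite_eq', Finset.mem_univ, if_true]
      rw [← hc', ← hc, P.coroot_reflectionPerm, hB.coreflection_apply]
      abel
    intro l hl
    have h2 := Fintype.linearIndependent_iff.1 hb.1 _ h1 l
    rw [if_neg hl, add_zero] at h2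
    linarith
  have hc0 : ∀ l, l ≠ k → c l = 0 := fun l hl =>
    le_antisymm (hcl l hl ▸ hs'' l) (hs l)
  rw [Finset.sum_eq_single k (fun l _ hl => by rw [hc0 l hl, zero_smul]) (by simp)] at hc
  have h2 := hB.norm_coroot i
  rw [hc] at h2
  simp only [map_smul, LinearMap.smul_apply, hB.norm_coroot, smul_eq_mul] at h2
  have h3 : c k = 1 := by nlinarith [hs k]
  rw [h3, one_smul] at hc
  exact hne hc

/-- The exchange condition: if `w = s_{ω₁} ⋯ s_{ω_n}` sends the simple coroot `α_k` to a negative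
one, then `w s_k` is obtained by deleting one of the letters. -/
lemma IsNormalizedInner.exchange (hB : IsNormalizedInner P B)
    (hb : IsSimpleSystem P.flip b) {ρ : V} (hρ : ∀ k, B ρ (P.coroot (b k)) = 1)
    (ω : List (Fin r)) (k : Fin r)
    (h : B ρ ((ω.map fun l => P.coreflection (b l)).prod (P.coroot (b k))) < 0) :
    ∃ ω' : List (Fin r), ω'.length + 1 = ω.length ∧
      (ω.map fun l => P.coreflection (b l)).prod * P.coreflection (b k) =
        (ω'.map fun l => P.coreflection (b l)).prod := by
  have hmem : ∀ ω : List (Fin r), (ω.map fun l => P.coreflection (b l)).prod ∈ reflGroup P :=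
    fun ω => Subgroup.list_prod_mem _ fun x hx => by
      obtain ⟨l, -, rfl⟩ := List.mem_map.1 hx
      exact coreflection_mem P _
  induction ω with
  | nil =>
    rw [List.map_nil, List.prod_nil, LinearEquiv.coe_one, id, hρ] at h
    linarith
  | cons l ω ih =>
    rw [List.map_cons, List.prod_cons, LinearEquiv.mul_apply] at h
    obtain ⟨j, hj⟩ := exists_apply_coroot_eq (hmem ω) (b k)
    rw [hj] at h
    rcases lt_or_gt_of_ne (hB.height_ne_zero hb hρ j) with hlt | hgt
    · obtain ⟨ω', h1, h2⟩ := ih (by rw [hj]; exact hlt)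
      exact ⟨l :: ω', by simp [h1], by
        rw [List.map_cons, List.prod_cons, List.map_cons, List.prod_cons, mul_assoc, h2]⟩
    · have hjl : P.coroot j = P.coroot (b l) := by
        by_contra hne
        exact absurd h (not_lt.2 (hB.height_coreflection_pos hb hρ l hgt hne).le)
      refine ⟨ω, by simp, ?_⟩
      rw [List.map_cons, List.prod_cons, mul_assoc,
        hB.mul_coreflection (hmem ω) (Or.inl (hj.trans hjl)), ← mul_assoc]
      have h3 : P.coreflection (b l) * P.coreflection (b l) = 1 := by
        rw [← pow_two, P.coreflection_sq]
      rw [h3, one_mul]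

/-- Every coroot is conjugate, up to sign, to a simple one under the simple reflections: a conjugate
of least positive height is simple. -/
lemma IsNormalizedInner.exists_simple_conj [Finite ι] (hB : IsNormalizedInner P B)
    (hb : IsSimpleSystem P.flip b) {ρ : V} (hρ : ∀ k, B ρ (P.coroot (b k)) = 1) (i : ι) :
    ∃ w ∈ Subgroup.closure (Set.range fun k => P.coreflection (b k)), ∃ k,
      w (P.coroot i) = P.coroot (b k) ∨ w (P.coroot i) = -P.coroot (b k) := by
  let G := Subgroup.closure (Set.range fun k => P.coreflection (b k))
  let T : Set ι := {j | 0 < B ρ (P.coroot j) ∧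
    ∃ w ∈ G, w (P.coroot i) = P.coroot j ∨ w (P.coroot i) = -P.coroot j}
  have hT : T.Nonempty := by
    rcases lt_or_gt_of_ne (hB.height_ne_zero hb hρ i) with h | h
    · refine ⟨P.reflectionPerm i i, ?_, 1, G.one_mem, Or.inr ?_⟩
      · rw [P.coroot_reflectionPerm, P.coreflection_apply_self, map_neg]
        linarith
      · rw [P.coroot_reflectionPerm, P.coreflection_apply_self, neg_neg]
        rfl
    · exact ⟨i, h, 1, G.one_mem, Or.inl rfl⟩
  obtain ⟨j, ⟨hj, w, hw, hwj⟩, hmin⟩ := Set.exists_min_image T (fun j => B ρ (P.coroot j))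
    (Set.toFinite T) hT
  obtain ⟨c, hc, hs⟩ := exists_nonneg_coeffs hb hρ hj
  obtain ⟨k, hk⟩ : ∃ k, 0 < B (P.coroot (b k)) (P.coroot j) := by
    by_contra! hcon
    have h1 := hB.norm_coroot j
    nth_rewrite 1 [hc] at h1
    simp only [map_sum, map_smul, LinearMap.sum_apply, LinearMap.smul_apply, smul_eq_mul] at h1
    have h2 : ∑ k, c k * B (P.coroot (b k)) (P.coroot j) ≤ 0 :=
      Finset.sum_nonpos fun k _ => mul_nonpos_of_nonneg_of_nonpos (hs k) (hcon k)
    linarith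
  by_cases hjk : P.coroot j = P.coroot (b k)
  · exact ⟨w, hw, k, by rwa [← hjk]⟩
  · exfalso
    have h1 := hB.height_coreflection_pos hb hρ k hj hjk
    have h2 := hmin (P.reflectionPerm (b k) j) ⟨by rwa [P.coroot_reflectionPerm],
      P.coreflection (b k) * w, G.mul_mem (Subgroup.subset_closure ⟨k, rfl⟩) hw, by
        rw [LinearEquiv.mul_apply, P.coroot_reflectionPerm]
        rcases hwj with h | h
        · exact Or.inl (by rw [h])
        · exact Or.inr (by rw [h, map_neg])⟩
    rw [P.coroot_reflectionPerm, hB.coreflection_apply, map_sub, map_smul, hρ, smul_eq_mul,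
      mul_one] at h2
    linarith

/-- The reflection group is generated by the simple reflections. -/
lemma IsNormalizedInner.exists_word [Finite ι] [P.IsRootSystem] [FiniteDimensional ℝ V]
    (hB : IsNormalizedInner P B)
    (hb : IsSimpleSystem P.flip b) {g : V ≃ₗ[ℝ] V} (hg : g ∈ reflGroup P) :
    ∃ ω : List (Fin r), g = (ω.map fun l => P.coreflection (b l)).prod := by
  obtain ⟨ρ, hρ⟩ := hB.exists_height hb
  have h1 : reflGroup P ≤ Subgroup.closure (Set.range fun k => P.coreflection (b k)) := by
    refine (Subgroup.closure_le _).2 ?_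
    rintro - ⟨i, rfl⟩
    obtain ⟨w, hw, k, hwk⟩ := hB.exists_simple_conj hb hρ i
    have hwP : w ∈ reflGroup P :=
      (Subgroup.closure_mono (by rintro - ⟨k, rfl⟩; exact ⟨b k, rfl⟩)) hw
    have h2 : P.coreflection i = w⁻¹ * (P.coreflection (b k) * w) := by
      rw [← hB.mul_coreflection hwP hwk, inv_mul_cancel_left]
    rw [h2]
    exact Subgroup.mul_mem _ (Subgroup.inv_mem _ hw)
      (Subgroup.mul_mem _ (Subgroup.subset_closure ⟨k, rfl⟩) hw)
  replace hg := h1 hg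
  induction hg using Subgroup.closure_induction'' with
  | mem x hx => obtain ⟨k, rfl⟩ := hx; exact ⟨[k], by simp⟩
  | inv_mem x hx => obtain ⟨k, rfl⟩ := hx; exact ⟨[k], by simp⟩
  | one => exact ⟨[], rfl⟩
  | mul x y _ _ hx hy =>
    obtain ⟨ω₁, rfl⟩ := hx
    obtain ⟨ω₂, rfl⟩ := hy
    exact ⟨ω₁ ++ ω₂, by simp⟩

/-- The stabilizer in the reflection group of a dominant vector is generated by simple
reflections. -/
lemma IsNormalizedInner.mem_closure_of_fixed_dominant [Finite ι] [P.IsRootSystem]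
    [FiniteDimensional ℝ V] (hB : IsNormalizedInner P B) (hb : IsSimpleSystem P.flip b)
    {g : V ≃ₗ[ℝ] V}
    (hg : g ∈ reflGroup P) {v : V} (hv : ∀ k, 0 ≤ B v (P.coroot (b k))) (hgv : g v = v) :
    g ∈ Subgroup.closure
      ((fun k => P.coreflection (b k)) '' {k | B v (P.coroot (b k)) = 0}) := by
  obtain ⟨ρ, hρ⟩ := hB.exists_height hb
  -- Induction along a shortest word `ω k` for an element fixing `v`. By the exchange condition `ω`
  -- sends `α_k` to a positive coroot, so `⟨v, α_k⟩` is both nonnegative and nonpositive.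
  have key : ∀ ω : List (Fin r), (∀ ω' : List (Fin r),
      (ω'.map fun l => P.coreflection (b l)).prod = (ω.map fun l => P.coreflection (b l)).prod →
        ω.length ≤ ω'.length) → (ω.map fun l => P.coreflection (b l)).prod v = v →
      (ω.map fun l => P.coreflection (b l)).prod ∈ Subgroup.closure
        ((fun k => P.coreflection (b k)) '' {k | B v (P.coroot (b k)) = 0}) := by
    intro ω
    induction ω using List.reverseRecOn with
    | nil => intro _ _; exact Subgroup.one_mem _
    | append_singleton ω k ih =>
      intro hmin hfix
      have hmem : (ω.map fun l => P.coreflection (b l)).prod ∈ reflGroup P :=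
        Subgroup.list_prod_mem _ fun x hx => by
          obtain ⟨l, -, rfl⟩ := List.mem_map.1 hx
          exact coreflection_mem P _
      simp only [List.map_append, List.map_cons, List.map_nil, List.prod_append, List.prod_cons,
        List.prod_nil, mul_one, List.length_append, List.length_cons, List.length_nil]
        at hmin hfix ⊢
      obtain ⟨j, hj⟩ := exists_apply_coroot_eq hmem (b k)
      have hpos : 0 < B ρ (P.coroot j) := by
        refine lt_of_le_of_ne (not_lt.1 fun hlt => ?_) (hB.height_ne_zero hb hρ j).symm
        obtain ⟨ω', h1, h2⟩ := hB.exchange hb hρ ω k (by rw [hj]; exact hlt)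
        have := hmin ω' h2.symm
        omega
      obtain ⟨c, hc, hs⟩ := exists_nonneg_coeffs hb hρ hpos
      have h0 : B v (P.coroot (b k)) = 0 := by
        refine le_antisymm ?_ (hv k)
        have h1 := hB.invariant _ (Subgroup.mul_mem _ hmem (coreflection_mem P (b k))) v
          (P.coroot (b k))
        rw [hfix, LinearEquiv.mul_apply, P.coreflection_apply_self, map_neg, hj, hc, map_neg] at h1
        rw [← h1, neg_nonpos, map_sum]
        exact Finset.sum_nonneg fun l _ => by
          rw [map_smul, smul_eq_mul]; exact mul_nonneg (hs l) (hv l)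
      have hkv : P.coreflection (b k) v = v := by
        rw [hB.coreflection_apply, hB.symm, h0, zero_smul, sub_zero]
      refine Subgroup.mul_mem _ (ih (fun ω' hω' => ?_) ?_) (Subgroup.subset_closure ⟨k, h0, rfl⟩)
      · have := hmin (ω' ++ [k]) (by simp [hω'])
        simpa using this
      · rwa [LinearEquiv.mul_apply, hkv] at hfix
  obtain ⟨ω₀, hω₀⟩ := hB.exists_word hb hg
  let S : Set (List (Fin r)) := {ω | (ω.map fun l => P.coreflection (b l)).prod = g}
  obtain ⟨ω, hω, hmin⟩ : ∃ ω ∈ S, ∀ ω' ∈ S, ω.length ≤ ω'.length := by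
    have hS : S.Nonempty := ⟨ω₀, hω₀.symm⟩
    refine ⟨Function.argminOn List.length S hS, Function.argminOn_mem _ _ _,
      fun ω' hω' => Function.argminOn_le _ _ hω'⟩
  have hω' : (ω.map fun l => P.coreflection (b l)).prod = g := hω
  rw [← hω']
  exact key ω (fun ω' h => hmin ω' (h.trans hω')) (by rw [hω', hgv])

/-- Every vector is conjugate under the reflection group to a dominant one. -/
lemma IsNormalizedInner.exists_dominant [Finite ι] [P.IsRootSystem] [FiniteDimensional ℝ V]
    (hB : IsNormalizedInner P B) (hb : IsSimpleSystem P.flip b) (v : V) :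
    ∃ w ∈ reflGroup P, ∀ k, 0 ≤ B (w v) (P.coroot (b k)) := by
  obtain ⟨ρ, hρ⟩ := hB.exists_height hb
  have := finite_reflGroup (P := P)
  -- The conjugate of `v` with the largest inner product with `ρ` is dominant.
  obtain ⟨w, hw⟩ := Finite.exists_max fun w : reflGroup P => B ρ ((w : V ≃ₗ[ℝ] V) v)
  refine ⟨w, w.2, fun k => ?_⟩
  have h1 := hw (⟨_, coreflection_mem P (b k)⟩ * w)
  change B ρ (P.coreflection (b k) ((w : V ≃ₗ[ℝ] V) v)) ≤ _ at h1
  rw [hB.coreflection_apply, map_sub, map_smul, hρ, smul_eq_mul, mul_one] at h1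
  rw [hB.symm]
  linarith

end ReflectionGroups

/-! ### Fixed spaces of elements of the reflection group -/

section FixedSpace

variable {V : Type*} [AddCommGroup V] [Module ℝ V] [FiniteDimensional ℝ V]
  {B : LinearMap.BilinForm ℝ V}

/-- An isometry `h` with `det (-h) = -1` has a fixed vector: `det (1 - h)` is its own negative,
since `1 - h = h (h⁻¹ - 1)` and `h⁻¹` is the adjoint of `h`. -/
lemma exists_fixed_of_det (hpos : ∀ v, v ≠ 0 → 0 < B v v)
    (h : V →ₗ[ℝ] V) (hiso : ∀ v w, B (h v) (h w) = B v w)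
    (hdet : LinearMap.det h = -(-1) ^ Module.finrank ℝ V) : ∃ v, v ≠ 0 ∧ h v = v := by
  have hinj : Function.Injective B := by
    rw [injective_iff_map_eq_zero]
    intro v hv
    by_contra h
    have := hpos v h
    rw [hv] at this
    simp at this
  have hsurj : Function.Surjective B :=
    (LinearMap.injective_iff_surjective_of_finrank_eq_finrank
      (Subspace.dual_finrank_eq (K := ℝ) (V := V)).symm).1 hinj
  let e : V ≃ₗ[ℝ] Module.Dual ℝ V := LinearEquiv.ofBijective B ⟨hinj, hsurj⟩
  obtain ⟨f, hf⟩ : ∃ f : V →ₗ[ℝ] V, f = LinearMap.id - h := ⟨_, rfl⟩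
  have h2 : ((e.symm : Module.Dual ℝ V →ₗ[ℝ] V) ∘ₗ f.dualMap ∘ₗ (e : V →ₗ[ℝ] _)) ∘ₗ h = -f := by
    refine LinearMap.ext fun v => e.injective ?_
    simp only [LinearMap.comp_apply, LinearEquiv.coe_coe, LinearEquiv.apply_symm_apply]
    refine LinearMap.ext fun w => ?_
    change B (h v) (f w) = B (-f v) w
    rw [hf, LinearMap.sub_apply, LinearMap.sub_apply, map_sub, map_neg, map_sub]
    simp only [LinearMap.id_apply, LinearMap.neg_apply, LinearMap.sub_apply, hiso]
    ring
  have h3 : LinearMap.det ((e.symm : Module.Dual ℝ V →ₗ[ℝ] V) ∘ₗ f.dualMap ∘ₗ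
      (e : V →ₗ[ℝ] _)) = LinearMap.det f := by
    rw [← LinearMap.det_dualMap f]
    exact LinearMap.det_conj f.dualMap e.symm
  have h4 := congrArg LinearMap.det h2
  rw [LinearMap.det_comp, h3, hdet, ← neg_one_smul ℝ f, LinearMap.det_smul] at h4
  have h5 : LinearMap.det f = 0 := by
    have h6 : (-1 : ℝ) ^ Module.finrank ℝ V ≠ 0 := pow_ne_zero _ (by norm_num)
    have h7 : (-1 : ℝ) ^ Module.finrank ℝ V * LinearMap.det f = 0 := by linarith
    exact (mul_eq_zero.1 h7).resolve_left h6
  obtain ⟨v, hv, hv0⟩ := (Submodule.ne_bot_iff _).1 (LinearMap.det_eq_zero_iff_ker_ne_bot.1 h5)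
  refine ⟨v, hv0, ?_⟩
  rw [LinearMap.mem_ker, hf, LinearMap.sub_apply] at hv
  exact (sub_eq_zero.1 hv).symm

/-- An isometry `g` with `det (-g) = 1` and a fixed vector `v` has a second fixed vector, orthogonal
to `v`: compose `g` with the reflection in `v`. -/
lemma two_le_finrank_fixed (hB : ∀ v w, B v w = B w v) (hpos : ∀ v, v ≠ 0 → 0 < B v v)
    (g : V →ₗ[ℝ] V) (hiso : ∀ v w, B (g v) (g w) = B v w)
    (hdet : LinearMap.det g = (-1) ^ Module.finrank ℝ V) {v : V} (hv : v ≠ 0) (hgv : g v = v) :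
    2 ≤ Module.finrank ℝ (LinearMap.ker (g - LinearMap.id)) := by
  have hvv := hpos v hv
  let s : V →ₗ[ℝ] V := LinearMap.transvection ((-(2 / B v v)) • B v) v
  have hs : ∀ w, s w = w + (-(2 / B v v) * B v w) • v := fun w => rfl
  have hsdet : LinearMap.det s = -1 := by
    rw [LinearMap.transvection.det, LinearMap.smul_apply, smul_eq_mul]
    field_simp
    norm_num
  obtain ⟨w, hw, hsw⟩ := exists_fixed_of_det hpos (g ∘ₗ s) (fun x y => by
      rw [LinearMap.comp_apply, LinearMap.comp_apply, hiso, hs, hs]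
      simp only [map_add, map_smul, LinearMap.add_apply, LinearMap.smul_apply, smul_eq_mul, hB x v]
      field_simp
      ring) (by
      rw [LinearMap.det_comp, hdet, hsdet]
      ring)
  rw [LinearMap.comp_apply, hs, map_add, map_smul, hgv] at hsw
  have h1 : B v w = 0 := by
    have h2 := congrArg (B v) hsw
    have h3 := hiso v w
    rw [hgv] at h3
    rw [map_add, map_smul, h3, smul_eq_mul] at h2
    field_simp at h2
    linarith
  rw [h1, mul_zero, zero_smul, add_zero] at hsw
  have hli : LinearIndependent ℝ ![v, w] := by
    rw [LinearIndependent.pair_iff]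
    intro x y hxy
    have h2 := congrArg (B v) hxy
    have h3 := congrArg (B w) hxy
    simp only [map_add, map_smul, h1, hB w v, smul_eq_mul, mul_zero, add_zero, zero_add,
      map_zero] at h2 h3
    exact ⟨(mul_eq_zero.1 h2).resolve_right hvv.ne', (mul_eq_zero.1 h3).resolve_right
      (hpos w hw).ne'⟩
  let F := LinearMap.ker (g - LinearMap.id)
  have hvF : v ∈ F := by simp [F, hgv]
  have hwF : w ∈ F := by simp [F, hsw]
  have hli' : LinearIndependent ℝ (![⟨v, hvF⟩, ⟨w, hwF⟩] : Fin 2 → F) := by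
    refine LinearIndependent.of_comp F.subtype ?_
    convert hli using 1
    funext i
    fin_cases i <;> rfl
  simpa using hli'.fintype_card_le_finrank

end FixedSpace

section FixedCoroot

variable {ι V₀ V : Type*} [Finite ι] [AddCommGroup V₀] [Module ℝ V₀] [AddCommGroup V] [Module ℝ V]
  {P : RootPairing ι ℝ V₀ V} {B : LinearMap.BilinForm ℝ V}
  {r : ℕ} {b : Fin r → ι}

/-- A generic vector of `F` is orthogonal only to those coroots that are orthogonal to `F`. -/
lemma exists_generic (P : RootPairing ι ℝ V₀ V) (B : LinearMap.BilinForm ℝ V) (F : Submodule ℝ V) :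
    ∃ v ∈ F, ∀ i, B (P.coroot i) v = 0 → ∀ x ∈ F, B (P.coroot i) x = 0 := by
  let p : {i // ¬∀ x ∈ F, B (P.coroot i) x = 0} → Subspace ℝ F :=
    fun i => LinearMap.ker (B (P.coroot i) ∘ₗ F.subtype)
  have h1 : (⋃ i, (p i : Set F)) ≠ Set.univ := by
    intro h
    obtain ⟨i, hi⟩ := Subspace.exists_eq_top_of_iUnion_eq_univ h
    refine i.2 fun x hx => ?_
    have : (⟨x, hx⟩ : F) ∈ p i := hi ▸ Submodule.mem_top
    exact this
  obtain ⟨v, hv⟩ := (Set.ne_univ_iff_exists_notMem _).1 h1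
  refine ⟨v, v.2, fun i hi => ?_⟩
  by_contra hcon
  exact hv (Set.mem_iUnion.2 ⟨⟨i, hcon⟩, hi⟩)

/-- Suppose every set of at most `r - 2` simple coroots has a common orthogonal coroot. Then an
element of the reflection group with a nonzero fixed vector and `det (-g) = 1` fixes a coroot. Its
fixed space has dimension at least two; conjugating a generic fixed vector to a dominant one brings
`g` into the parabolic subgroup of at most `r - 2` simple reflections. -/
lemma IsNormalizedInner.exists_fixed_coroot [FiniteDimensional ℝ V] [P.IsRootSystem]
    (hB : IsNormalizedInner P B)
    (hb : IsSimpleSystem P.flip b)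
    (hJ : ∀ J : Finset (Fin r), J.card + 2 ≤ r →
      ∃ i, ∀ k ∈ J, B (P.coroot i) (P.coroot (b k)) = 0)
    {g : V ≃ₗ[ℝ] V} (hg : g ∈ reflGroup P)
    (hdet : LinearMap.det (g : V →ₗ[ℝ] V) = (-1) ^ Module.finrank ℝ V)
    {v₀ : V} (hv₀ : v₀ ≠ 0) (hgv₀ : g v₀ = v₀) : ∃ i, g (P.coroot i) = P.coroot i := by
  classical
  let F := LinearMap.ker ((g : V →ₗ[ℝ] V) - LinearMap.id)
  have hF : 2 ≤ Module.finrank ℝ F := two_le_finrank_fixed hB.symm hB.pos (g : V →ₗ[ℝ] V)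
    (hB.invariant g hg) hdet hv₀ hgv₀
  obtain ⟨v, hvF, hv⟩ := exists_generic P B F
  have hgv : g v = v := by
    have := LinearMap.mem_ker.1 hvF
    exact sub_eq_zero.1 this
  obtain ⟨w, hw, hdom⟩ := hB.exists_dominant hb v
  have hwg : w * g * w⁻¹ ∈ reflGroup P :=
    Subgroup.mul_mem _ (Subgroup.mul_mem _ hw hg) (Subgroup.inv_mem _ hw)
  have hwinv : ∀ x, w⁻¹ (w x) = x := fun x => w.symm_apply_apply x
  have hclos := hB.mem_closure_of_fixed_dominant hb hwg hdom (by
    rw [LinearEquiv.mul_apply, LinearEquiv.mul_apply, hwinv, hgv])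
  let J : Finset (Fin r) := Finset.univ.filter fun k => B (w v) (P.coroot (b k)) = 0
  have hcard : J.card + 2 ≤ r := by
    have hr : Module.finrank ℝ V = r := by
      rw [Module.finrank_eq_card_basis (corootBasis hb), Fintype.card_fin]
    have hmem : ∀ k : J, w⁻¹ (P.coroot (b k)) ∈ LinearMap.BilinForm.orthogonal B F := by
      intro k x hx
      have hk : B (w v) (P.coroot (b k)) = 0 := (Finset.mem_filter.1 k.2).2
      obtain ⟨j, hj⟩ := exists_apply_coroot_eq (Subgroup.inv_mem _ hw) (b k)
      have h1 := hB.invariant w⁻¹ (Subgroup.inv_mem _ hw) (w v) (P.coroot (b k))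
      rw [hwinv, hj, hk, hB.symm] at h1
      change B x (w⁻¹ (P.coroot (b k))) = 0
      rw [hj, hB.symm]
      exact hv j h1 x hx
    have hli : LinearIndependent ℝ
        (fun k : J => (⟨_, hmem k⟩ : LinearMap.BilinForm.orthogonal B F)) := by
      refine LinearIndependent.of_comp (Submodule.subtype _) ?_
      have h1 : LinearIndependent ℝ (fun k : J => P.coroot (b k)) :=
        hb.1.comp (fun k : J => (k : Fin r)) Subtype.val_injective
      exact h1.map' ((w⁻¹ : V ≃ₗ[ℝ] V) : V →ₗ[ℝ] V) (LinearEquiv.ker _)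
    have h2 := hli.fintype_card_le_finrank
    have hnd : B.Nondegenerate := by
      constructor <;> intro x hx <;> by_contra hx0 <;> exact (hB.pos x hx0).ne' (hx x)
    rw [LinearMap.BilinForm.finrank_orthogonal hnd, hr, Fintype.card_coe] at h2
    have h3 : Module.finrank ℝ F ≤ r := hr ▸ Submodule.finrank_le F
    omega
  obtain ⟨i, hi⟩ := hJ J hcard
  have hk : ∀ k, B (w v) (P.coroot (b k)) = 0 →
      P.coreflection (b k) (P.coroot i) = P.coroot i := fun k hk => by
    rw [hB.coreflection_apply, hB.symm, hi k (Finset.mem_filter.2 ⟨Finset.mem_univ _, hk⟩),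
      zero_smul, sub_zero]
  have hfix : ∀ x ∈ Subgroup.closure
      ((fun k => P.coreflection (b k)) '' {k | B (w v) (P.coroot (b k)) = 0}),
      x (P.coroot i) = P.coroot i := by
    intro x hx
    induction hx using Subgroup.closure_induction'' with
    | mem x hx => obtain ⟨k, hk', rfl⟩ := hx; exact hk k hk'
    | inv_mem x hx => obtain ⟨k, hk', rfl⟩ := hx; exact hk k hk'
    | one => rfl
    | mul x y _ _ hx hy => rw [LinearEquiv.mul_apply, hy, hx]
  replace hfix := hfix _ hclos
  obtain ⟨j, hj⟩ := exists_apply_coroot_eq (Subgroup.inv_mem _ hw) i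
  refine ⟨j, ?_⟩
  rw [LinearEquiv.mul_apply, LinearEquiv.mul_apply, hj] at hfix
  have h1 := congrArg (w⁻¹ : V ≃ₗ[ℝ] V) hfix
  rwa [hwinv, hj] at h1

end FixedCoroot

/-! ### Orthogonal coroots in types `I₂(n)`, `H₃` and `H₄` -/

section OrthogonalCoroots

variable {ι V₀ V : Type*} [AddCommGroup V₀] [Module ℝ V₀] [AddCommGroup V] [Module ℝ V]
  {P : RootPairing ι ℝ V₀ V} {B : LinearMap.BilinForm ℝ V}

/-- The order `m` of the product of two reflections restricts the inner product `t` of the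
coroots: with `x` and `y` the roots and `A` the product of the reflections, compare the
coefficients of `A ^ k y` and `A⁻¹ ^ (m - k) y` for `k` about half of `m`. -/
lemma IsNormalizedInner.gram_of_orderOf (hB : IsNormalizedInner P B) {i j : ι}
    (hli : LinearIndependent ℝ ![P.root i, P.root j]) {m : ℕ}
    (hm : orderOf (P.reflection i * P.reflection j) = m) :
    (m = 2 → B (P.coroot i) (P.coroot j) = 0) ∧
    (m = 3 → B (P.coroot i) (P.coroot j) ^ 2 = 1) ∧
    (m = 5 → (B (P.coroot i) (P.coroot j) ^ 2 - 1) ^ 2 = B (P.coroot i) (P.coroot j) ^ 2) := by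
  obtain ⟨t, ht⟩ : ∃ t, t = B (P.coroot i) (P.coroot j) := ⟨_, rfl⟩
  obtain ⟨x, hx⟩ : ∃ x, x = P.root i := ⟨_, rfl⟩
  obtain ⟨y, hy⟩ : ∃ y, y = P.root j := ⟨_, rfl⟩
  obtain ⟨A, hA⟩ : ∃ A, A = P.reflection i * P.reflection j := ⟨_, rfl⟩
  rw [← hx, ← hy, LinearIndependent.pair_iff] at hli
  rw [← hA] at hm
  rw [← ht]
  have hpij : P.pairing i j = t := by
    rw [← P.root'_coroot_eq_pairing, hB.root_eq, ht]
  have hpji : P.pairing j i = t := by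
    rw [← P.root'_coroot_eq_pairing, hB.root_eq, hB.symm, ht]
  have hix : P.reflection i x = -x := by rw [hx, P.reflection_apply_self]
  have hjy : P.reflection j y = -y := by rw [hy, P.reflection_apply_self]
  have hiy : P.reflection i y = y - t • x := by rw [hx, hy, P.reflection_apply_root, hpji]
  have hjx : P.reflection j x = x - t • y := by rw [hx, hy, P.reflection_apply_root, hpij]
  have hAinv : A⁻¹ = P.reflection j * P.reflection i := by
    rw [hA, mul_inv_rev, P.reflection_inv, P.reflection_inv]
  have hAx : A x = (t ^ 2 - 1) • x - t • y := by
    rw [hA, LinearEquiv.mul_apply, hjx, map_sub, map_smul, hix, hiy]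
    module
  have hAy : A y = t • x - y := by
    rw [hA, LinearEquiv.mul_apply, hjy, map_neg, hiy]
    abel
  have hA'x : A⁻¹ x = t • y - x := by
    rw [hAinv, LinearEquiv.mul_apply, hix, map_neg, hjx]
    abel
  have hA'y : A⁻¹ y = (t ^ 2 - 1) • y - t • x := by
    rw [hAinv, LinearEquiv.mul_apply, hiy, map_sub, map_smul, hjy, hjx]
    module
  have hpow : A ^ m = 1 := hm ▸ pow_orderOf_eq_one A
  refine ⟨?_, ?_, ?_⟩ <;> rintro rfl
  · have h1 : A = A⁻¹ := eq_inv_of_mul_eq_one_left (by rw [← pow_two, hpow])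
    have h2 : A y = A⁻¹ y := by rw [← h1]
    rw [hAy, hA'y] at h2
    have h3 : (2 * t) • x + (-t ^ 2) • y = 0 := by
      rw [← sub_eq_zero] at h2
      rw [← h2]
      module
    linarith [(hli _ _ h3).1]
  · have h1 : A ^ 2 = A⁻¹ := eq_inv_of_mul_eq_one_left (by rw [← pow_succ, hpow])
    have h2 : (A ^ 2) y = A⁻¹ y := by rw [← h1]
    rw [pow_two, LinearEquiv.mul_apply, hAy, map_sub, map_smul, hAy, hAx, hA'y] at h2
    have h3 : (t ^ 3 - t) • x + (2 - 2 * t ^ 2) • y = 0 := by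
      rw [← sub_eq_zero] at h2
      rw [← h2]
      module
    linarith [(hli _ _ h3).2]
  · have h1 : A ^ 3 = A⁻¹ ^ 2 := by
      rw [inv_pow]
      exact eq_inv_of_mul_eq_one_left (by rw [← pow_add, hpow])
    have h2 : (A ^ 3) y = (A⁻¹ ^ 2) y := by rw [← h1]
    rw [pow_succ, pow_two, pow_two, LinearEquiv.mul_apply, LinearEquiv.mul_apply, hAy, map_sub,
      map_smul, hAx, hAy, LinearEquiv.mul_apply, hA'y] at h2
    simp only [map_sub, map_smul, hAx, hAy, hA'x, hA'y] at h2
    have h3 : (t * (t ^ 4 - 3 * t ^ 2 + 1)) • x + (-2 * (t ^ 4 - 3 * t ^ 2 + 1)) • y = 0 := by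
      rw [← sub_eq_zero] at h2
      rw [← h2]
      module
    linarith [(hli _ _ h3).2]

lemma exists_sign_of_sq_eq_one {t : ℝ} (h : t ^ 2 = 1) : ∃ ε : ℝ, ε ^ 2 = 1 ∧ ε * t = -1 :=
  ⟨-t, by rw [neg_sq, h], by linarith⟩

/-- Up to sign, the off-diagonal Gram entry of an edge labelled `5` is minus the golden ratio or its
conjugate. -/
lemma exists_sign_of_golden {t : ℝ} (h : (t ^ 2 - 1) ^ 2 = t ^ 2) :
    ∃ ε c : ℝ, ε ^ 2 = 1 ∧ c ^ 2 = c + 1 ∧ ε * t = -c := by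
  have h1 : (t ^ 2 - 1 - t) * (t ^ 2 - 1 + t) = 0 := by linear_combination h
  rcases mul_eq_zero.1 h1 with h2 | h2
  · exact ⟨-1, t, by norm_num, by linarith, by ring⟩
  · exact ⟨1, -t, by norm_num, by linarith, by ring⟩

/-- In type `H₃`, the middle simple coroot is orthogonal to a coroot. -/
lemma exists_orthogonal_H₃ {c : ℝ} (hB : ∀ v w, B v w = B w v) (S : Set V)
    (hS : ∀ u ∈ S, ∀ v ∈ S, v - B u v • u ∈ S) {e₀ e₁ e₂ : V} (h₀ : e₀ ∈ S) (h₁ : e₁ ∈ S)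
    (h₂ : e₂ ∈ S) (h11 : B e₁ e₁ = 2) (h01 : B e₀ e₁ = -1)
    (h02 : B e₀ e₂ = 0) (h12 : B e₁ e₂ = -c) :
    ∃ β ∈ S, B e₁ β = 0 := by
  have h3 : e₂ + c • e₁ ∈ S := by
    have := hS e₁ h₁ e₂ h₂
    rw [h12] at this
    convert this using 1
    module
  have h4 : e₂ + c • e₁ + c • e₀ ∈ S := by
    have := hS e₀ h₀ _ h3
    rw [map_add, map_smul, h01, h02] at this
    convert this using 1
    simp
  refine ⟨_, h4, ?_⟩
  rw [map_add, map_add, map_smul, map_smul, h12, h11, hB e₁ e₀, h01, smul_eq_mul, smul_eq_mul]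
  ring

/-- In type `H₄`, with `c` the golden ratio or its conjugate, any two simple coroots have a common
orthogonal coroot. -/
lemma exists_orthogonal_H₄ {c : ℝ} (hc : c ^ 2 = c + 1) (hB : ∀ v w, B v w = B w v) (S : Set V)
    (hS : ∀ u ∈ S, ∀ v ∈ S, v - B u v • u ∈ S) {e₀ e₁ e₂ e₃ : V} (h₀ : e₀ ∈ S) (h₁ : e₁ ∈ S)
    (h₂ : e₂ ∈ S) (h₃ : e₃ ∈ S) (h00 : B e₀ e₀ = 2) (h11 : B e₁ e₁ = 2) (h22 : B e₂ e₂ = 2)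
    (h33 : B e₃ e₃ = 2) (h01 : B e₀ e₁ = -1) (h02 : B e₀ e₂ = 0) (h03 : B e₀ e₃ = 0)
    (h12 : B e₁ e₂ = -1) (h13 : B e₁ e₃ = 0) (h23 : B e₂ e₃ = -c) :
    (∃ β ∈ S, B e₀ β = 0 ∧ B e₁ β = 0) ∧ (∃ β ∈ S, B e₀ β = 0 ∧ B e₂ β = 0) ∧
    (∃ β ∈ S, B e₀ β = 0 ∧ B e₃ β = 0) ∧ (∃ β ∈ S, B e₁ β = 0 ∧ B e₂ β = 0) ∧
    (∃ β ∈ S, B e₁ β = 0 ∧ B e₃ β = 0) ∧ (∃ β ∈ S, B e₂ β = 0 ∧ B e₃ β = 0) := by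
  -- Each witness is reached from a simple coroot by a chain of simple reflections, in coordinates
  -- with respect to the simple coroots; `sᵢ` changes the coordinate `xᵢ` only.
  let v : ℝ → ℝ → ℝ → ℝ → V := fun x₀ x₁ x₂ x₃ => x₀ • e₀ + x₁ • e₁ + x₂ • e₂ + x₃ • e₃
  have b0 : ∀ x₀ x₁ x₂ x₃, B e₀ (v x₀ x₁ x₂ x₃) = 2 * x₀ - x₁ := fun x₀ x₁ x₂ x₃ => by
    simp only [v, map_add, map_smul, smul_eq_mul, h00, h01, h02, h03]; ring
  have b1 : ∀ x₀ x₁ x₂ x₃, B e₁ (v x₀ x₁ x₂ x₃) = 2 * x₁ - x₀ - x₂ := fun x₀ x₁ x₂ x₃ => by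
    simp only [v, map_add, map_smul, smul_eq_mul, hB e₁ e₀, h01, h11, h12, h13]; ring
  have b2 : ∀ x₀ x₁ x₂ x₃, B e₂ (v x₀ x₁ x₂ x₃) = 2 * x₂ - x₁ - c * x₃ := fun x₀ x₁ x₂ x₃ => by
    simp only [v, map_add, map_smul, smul_eq_mul, hB e₂ e₀, hB e₂ e₁, h02, h12, h22, h23]; ring
  have b3 : ∀ x₀ x₁ x₂ x₃, B e₃ (v x₀ x₁ x₂ x₃) = 2 * x₃ - c * x₂ := fun x₀ x₁ x₂ x₃ => by
    simp only [v, map_add, map_smul, smul_eq_mul, hB e₃ e₀, hB e₃ e₁, hB e₃ e₂, h03, h13, h23, h33]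
    ring
  have s0 : ∀ {x₀ x₁ x₂ x₃}, v x₀ x₁ x₂ x₃ ∈ S → ∀ y, y = x₁ - x₀ → v y x₁ x₂ x₃ ∈ S := by
    rintro x₀ x₁ x₂ x₃ h _ rfl
    convert hS e₀ h₀ _ h using 1
    rw [b0]; simp only [v]; module
  have s1 : ∀ {x₀ x₁ x₂ x₃}, v x₀ x₁ x₂ x₃ ∈ S → ∀ y, y = x₀ + x₂ - x₁ → v x₀ y x₂ x₃ ∈ S := by
    rintro x₀ x₁ x₂ x₃ h _ rfl
    convert hS e₁ h₁ _ h using 1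
    rw [b1]; simp only [v]; module
  have s2 : ∀ {x₀ x₁ x₂ x₃}, v x₀ x₁ x₂ x₃ ∈ S → ∀ y, y = x₁ + c * x₃ - x₂ →
      v x₀ x₁ y x₃ ∈ S := by
    rintro x₀ x₁ x₂ x₃ h _ rfl
    convert hS e₂ h₂ _ h using 1
    rw [b2]; simp only [v]; module
  have s3 : ∀ {x₀ x₁ x₂ x₃}, v x₀ x₁ x₂ x₃ ∈ S → ∀ y, y = c * x₂ - x₃ → v x₀ x₁ x₂ y ∈ S := by
    rintro x₀ x₁ x₂ x₃ h _ rfl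
    convert hS e₃ h₃ _ h using 1
    rw [b3]; simp only [v]; module
  have r0 : v 1 0 0 0 ∈ S := by simpa [v] using h₀
  have r1 : v 0 1 0 0 ∈ S := by simpa [v] using h₁
  have r3 : v 0 0 0 1 ∈ S := by simpa [v] using h₃
  refine ⟨⟨_, r3, ?_, ?_⟩, ?_, ?_, ?_, ?_, ⟨_, r0, ?_, ?_⟩⟩
  · rw [b0]; ring
  · rw [b1]; ring
  · have q0 := r0
    have q1 := s1 q0 (1) (by ring)
    have q2 := s2 q1 (1) (by ring)
    have q3 := s3 q2 (c) (by ring)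
    have q4 := s2 q3 (1 + c) (by linear_combination -hc)
    have q5 := s1 q4 (1 + c) (by ring)
    have q6 := s0 q5 (c) (by ring)
    have q7 := s3 q6 (1 + c) (by linear_combination -hc)
    have q8 := s2 q7 (1 + 2 * c) (by linear_combination -hc)
    have q9 := s1 q8 (2 * c) (by ring)
    have q10 := s3 q9 (1 + 2 * c) (by linear_combination -2 * hc)
    have q11 := s2 q10 (1 + 3 * c) (by linear_combination -2 * hc)
    have q12 := s3 q11 (2 + 2 * c) (by linear_combination -3 * hc)
    refine ⟨_, q12, ?_, ?_⟩
    · rw [b0]; ring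
    · rw [b2]; linear_combination -2 * hc
  · have q0 := r1
    have q1 := s2 q0 (1) (by ring)
    have q2 := s3 q1 (c) (by ring)
    have q3 := s2 q2 (1 + c) (by linear_combination -hc)
    have q4 := s1 q3 (c) (by ring)
    have q5 := s0 q4 (c) (by ring)
    have q6 := s3 q5 (1 + c) (by linear_combination -hc)
    have q7 := s2 q6 (2 * c) (by linear_combination -hc)
    have q8 := s1 q7 (2 * c) (by ring)
    refine ⟨_, q8, ?_, ?_⟩
    · rw [b0]; ring
    · rw [b3]; linear_combination -2 * hc
  · have q0 := r3
    have q1 := s2 q0 (c) (by ring)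
    have q2 := s1 q1 (c) (by ring)
    have q3 := s0 q2 (c) (by ring)
    refine ⟨_, q3, ?_, ?_⟩
    · rw [b1]; ring
    · rw [b2]; ring
  · have q0 := r1
    have q1 := s2 q0 (1) (by ring)
    have q2 := s3 q1 (c) (by ring)
    have q3 := s2 q2 (1 + c) (by linear_combination -hc)
    have q4 := s1 q3 (c) (by ring)
    have q5 := s3 q4 (1 + c) (by linear_combination -hc)
    have q6 := s2 q5 (2 * c) (by linear_combination -hc)
    refine ⟨_, q6, ?_, ?_⟩
    · rw [b1]; ring
    · rw [b3]; linear_combination -2 * hc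
  · rw [b2]; ring
  · rw [b3]; ring

lemma IsSimpleSystem.pair {r : ℕ} {b : Fin r → ι} (hb : IsSimpleSystem P b) {k l : Fin r}
    (hkl : k ≠ l) : LinearIndependent ℝ ![P.root (b k), P.root (b l)] := by
  have h1 : Function.Injective ![k, l] := by
    intro x y hxy
    fin_cases x <;> fin_cases y <;> simp_all
  have h2 := hb.1.comp _ h1
  convert h2 using 1
  funext x
  fin_cases x <;> rfl

/-- In types `I₂(n)`, `H₃` and `H₄`, any `r - 2` simple coroots have a common orthogonal coroot,
where `r` is the rank. -/
lemma IsDihedralOrH.exists_orthogonal (hP : IsDihedralOrH P) (hB : IsNormalizedInner P B) :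
    ∃ (r : ℕ) (b : Fin r → ι), IsSimpleSystem P.flip b ∧
      ∀ J : Finset (Fin r), J.card + 2 ≤ r →
        ∃ i, ∀ k ∈ J, B (P.coroot i) (P.coroot (b k)) = 0 := by
  let S : Set V := Set.range P.coroot
  have hS : ∀ u ∈ S, ∀ v ∈ S, v - B u v • u ∈ S := by
    rintro - ⟨i, rfl⟩ - ⟨j, rfl⟩
    exact ⟨P.reflectionPerm i j, by rw [P.coroot_reflectionPerm, hB.coreflection_apply]⟩
  have hSε : ∀ ε : ℝ, ε ^ 2 = 1 → ∀ i, ε • P.coroot i ∈ S := by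
    intro ε hε i
    rcases mul_self_eq_one_iff.1 ((pow_two ε).symm.trans hε) with rfl | rfl
    · exact ⟨i, (one_smul _ _).symm⟩
    · exact ⟨P.reflectionPerm i i, by
        rw [P.coroot_reflectionPerm, P.coreflection_apply_self, neg_one_smul]⟩
  have hBε : ∀ ε : ℝ, ε ^ 2 = 1 → ∀ i, B (ε • P.coroot i) (ε • P.coroot i) = 2 := by
    intro ε hε i
    simp only [map_smul, LinearMap.smul_apply, smul_eq_mul, hB.norm_coroot]
    linear_combination 2 * hε
  have hβ : ∀ ε : ℝ, ε ^ 2 = 1 → ∀ i β, B (ε • P.coroot i) β = 0 → B β (P.coroot i) = 0 := by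
    intro ε hε i β h
    rw [map_smul, LinearMap.smul_apply, smul_eq_mul] at h
    rw [hB.symm]
    refine (mul_eq_zero.1 h).resolve_left fun h0 => ?_
    rw [h0] at hε
    norm_num at hε
  rcases hP with ⟨n, hn, b, hb, hM⟩ | ⟨b, hb, hM⟩ | ⟨b, hb, hM⟩
  · refine ⟨2, b, hB.isSimpleSystem_flip hb, fun J hJ => ⟨b 0, fun k hk => ?_⟩⟩
    have : 0 < J.card := Finset.card_pos.2 ⟨k, hk⟩
    omega
  · refine ⟨3, b, hB.isSimpleSystem_flip hb, fun J hJ => ?_⟩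
    have t01 := (hB.gram_of_orderOf (hb.pair (show (0 : Fin 3) ≠ 1 by decide)) (hM 0 1)).2.1 rfl
    have t02 := (hB.gram_of_orderOf (hb.pair (show (0 : Fin 3) ≠ 2 by decide)) (hM 0 2)).1 rfl
    have t12 := (hB.gram_of_orderOf (hb.pair (show (1 : Fin 3) ≠ 2 by decide)) (hM 1 2)).2.2 rfl
    obtain ⟨ε₀, hε₀, h01⟩ := exists_sign_of_sq_eq_one t01
    obtain ⟨ε₂, c, hε₂, -, h12⟩ := exists_sign_of_golden t12
    have h1 : (1 : ℝ) ^ 2 = 1 := one_pow 2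
    obtain ⟨-, ⟨i, rfl⟩, hi⟩ := exists_orthogonal_H₃ (c := c) hB.symm S hS (hSε ε₀ hε₀ (b 0))
      (hSε 1 h1 (b 1)) (hSε ε₂ hε₂ (b 2)) (hBε 1 h1 (b 1)) (by simpa using h01) (by simp [t02])
      (by simpa using h12)
    have hJ' : J ⊆ {0} ∨ J ⊆ {1} ∨ J ⊆ {2} := by
      revert J; decide
    rcases hJ' with h | h | h
    · refine ⟨b 2, fun k hk => ?_⟩
      rw [Finset.mem_singleton.1 (h hk), hB.symm, t02]
    · refine ⟨i, fun k hk => ?_⟩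
      rw [Finset.mem_singleton.1 (h hk)]
      exact hβ 1 h1 _ _ hi
    · refine ⟨b 0, fun k hk => ?_⟩
      rw [Finset.mem_singleton.1 (h hk), t02]
  · refine ⟨4, b, hB.isSimpleSystem_flip hb, fun J hJ => ?_⟩
    have t01 := (hB.gram_of_orderOf (hb.pair (show (0 : Fin 4) ≠ 1 by decide)) (hM 0 1)).2.1 rfl
    have t02 := (hB.gram_of_orderOf (hb.pair (show (0 : Fin 4) ≠ 2 by decide)) (hM 0 2)).1 rfl
    have t03 := (hB.gram_of_orderOf (hb.pair (show (0 : Fin 4) ≠ 3 by decide)) (hM 0 3)).1 rfl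
    have t12 := (hB.gram_of_orderOf (hb.pair (show (1 : Fin 4) ≠ 2 by decide)) (hM 1 2)).2.1 rfl
    have t13 := (hB.gram_of_orderOf (hb.pair (show (1 : Fin 4) ≠ 3 by decide)) (hM 1 3)).1 rfl
    have t23 := (hB.gram_of_orderOf (hb.pair (show (2 : Fin 4) ≠ 3 by decide)) (hM 2 3)).2.2 rfl
    -- Signs are chosen along the diagram, starting from the third node.
    have h2 : (1 : ℝ) ^ 2 = 1 := one_pow 2
    obtain ⟨ε₁, hε₁, h12⟩ := exists_sign_of_sq_eq_one t12
    obtain ⟨δ, hδ, h01⟩ := exists_sign_of_sq_eq_one t01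
    obtain ⟨ε₃, c, hε₃, hc, h23⟩ := exists_sign_of_golden t23
    have hε₀ : (δ * ε₁) ^ 2 = 1 := by rw [mul_pow, hδ, hε₁, one_mul]
    have key := exists_orthogonal_H₄ hc hB.symm S hS (hSε _ hε₀ (b 0)) (hSε ε₁ hε₁ (b 1))
      (hSε 1 h2 (b 2)) (hSε ε₃ hε₃ (b 3)) (hBε _ hε₀ (b 0)) (hBε ε₁ hε₁ (b 1)) (hBε 1 h2 (b 2))
      (hBε ε₃ hε₃ (b 3))
      (by
        simp only [map_smul, LinearMap.smul_apply, smul_eq_mul]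
        linear_combination ε₁ ^ 2 * h01 - hε₁)
      (by simp [t02]) (by simp [t03]) (by simpa using h12) (by simp [t13]) (by simpa using h23)
    have hsub : ∀ k l : Fin 4, J ⊆ {k, l} →
        (∃ β ∈ S, B β (P.coroot (b k)) = 0 ∧ B β (P.coroot (b l)) = 0) →
        ∃ i, ∀ k ∈ J, B (P.coroot i) (P.coroot (b k)) = 0 := by
      rintro k l hkl ⟨-, ⟨i, rfl⟩, hk, hl⟩
      refine ⟨i, fun m hm => ?_⟩
      rcases Finset.mem_insert.1 (hkl hm) with rfl | hm
      · exact hk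
      · rw [Finset.mem_singleton.1 hm]; exact hl
    have hJ' : J ⊆ {0, 1} ∨ J ⊆ {0, 2} ∨ J ⊆ {0, 3} ∨ J ⊆ {1, 2} ∨ J ⊆ {1, 3} ∨ J ⊆ {2, 3} := by
      clear hsub
      revert J; decide
    obtain ⟨⟨β₁, k₁, l₁, m₁⟩, ⟨β₂, k₂, l₂, m₂⟩, ⟨β₃, k₃, l₃, m₃⟩, ⟨β₄, k₄, l₄, m₄⟩,
      ⟨β₅, k₅, l₅, m₅⟩, ⟨β₆, k₆, l₆, m₆⟩⟩ := key
    rcases hJ' with h | h | h | h | h | h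
    · exact hsub _ _ h ⟨β₁, k₁, hβ _ hε₀ _ _ l₁, hβ _ hε₁ _ _ m₁⟩
    · exact hsub _ _ h ⟨β₂, k₂, hβ _ hε₀ _ _ l₂, hβ _ h2 _ _ m₂⟩
    · exact hsub _ _ h ⟨β₃, k₃, hβ _ hε₀ _ _ l₃, hβ _ hε₃ _ _ m₃⟩
    · exact hsub _ _ h ⟨β₄, k₄, hβ _ hε₁ _ _ l₄, hβ _ h2 _ _ m₄⟩
    · exact hsub _ _ h ⟨β₅, k₅, hβ _ hε₁ _ _ l₅, hβ _ hε₃ _ _ m₅⟩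
    · exact hsub _ _ h ⟨β₆, k₆, hβ _ h2 _ _ l₆, hβ _ hε₃ _ _ m₆⟩

end OrthogonalCoroots

/-! ### The covering of the reflection group -/

section Covering

open CliffordAlgebra

variable {ι V₀ V : Type*} [AddCommGroup V₀] [Module ℝ V₀] [AddCommGroup V] [Module ℝ V]
  {P : RootPairing ι ℝ V₀ V} {B : LinearMap.BilinForm ℝ V}

/-- The twisted centralizer of `V` in the Clifford algebra consists of the scalars. -/
lemma eq_algebraMap_of_twisted_central [FiniteDimensional ℝ V] (hB : ∀ v w, B v w = B w v)
    (hpos : ∀ v, v ≠ 0 → 0 < B v v) (x : CliffordAlgebra (negForm B))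
    (hx : ∀ v, involute x * CliffordAlgebra.ι _ v = CliffordAlgebra.ι _ v * x) :
    ∃ r : ℝ, x = algebraMap ℝ _ r := by
  have hinj : Function.Injective B := by
    rw [injective_iff_map_eq_zero]
    intro v hv
    by_contra h
    have := hpos v h
    rw [hv] at this
    simp at this
  have hsurj : Function.Surjective B :=
    (LinearMap.injective_iff_surjective_of_finrank_eq_finrank
      (Subspace.dual_finrank_eq (K := ℝ) (V := V)).symm).1 hinj
  have h1 : ∀ d, contractLeft d x = 0 := by
    intro d
    obtain ⟨v, rfl⟩ := hsurj d
    have h2 := ι_mul_sub_involute_mul_ι hB v x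
    rw [hx, sub_self, map_smul, LinearMap.smul_apply, smul_eq_zero] at h2
    exact h2.resolve_left (by norm_num)
  obtain ⟨r, hr⟩ := exterior_eq_algebraMap_of_contractLeft_eq_zero (equivExterior (negForm B) x)
    (fun d => by
      have := changeForm_contractLeft (changeForm.associated_neg_proof (Q := negForm B)) d x
      change contractLeft d (changeForm changeForm.associated_neg_proof x) = 0
      rw [← this, h1, map_zero])
  refine ⟨r, (equivExterior (negForm B)).injective ?_⟩
  rw [hr]
  exact (changeForm_algebraMap (changeForm.associated_neg_proof (Q := negForm B)) r).symm

/-- The kernel of the covering is `{1, -1}`. -/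
lemma eq_or_eq_negOne_mul [FiniteDimensional ℝ V] (hB : ∀ v w, B v w = B w v)
    (hpos : ∀ v, v ≠ 0 → 0 < B v v) {H : Subgroup (V ≃ₗ[ℝ] V)} {a b : pinPreimage (negForm B) H}
    (h : pinProj (negForm B) H a = pinProj (negForm B) H b) :
    a = b ∨ a = negOne (negForm B) H * b := by
  obtain ⟨c, hc⟩ : ∃ c, c = a * b⁻¹ := ⟨_, rfl⟩
  have hpc : pinProj (negForm B) H c = 1 := by rw [hc, map_mul, map_inv, h, mul_inv_cancel]
  obtain ⟨r, hr⟩ := eq_algebraMap_of_twisted_central hB hpos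
    ((c : (CliffordAlgebra (negForm B))ˣ) : CliffordAlgebra (negForm B)) fun v => by
      have h1 := ι_pinProj c v
      rw [hpc] at h1
      exact ((Units.eq_mul_inv_iff_mul_eq _).1 h1).symm
  have h2 : star ((c : (CliffordAlgebra (negForm B))ˣ) : CliffordAlgebra (negForm B)) *
      ((c : (CliffordAlgebra (negForm B))ˣ) : CliffordAlgebra (negForm B)) = 1 := by
    rw [c.2.1, Units.inv_mul]
  rw [hr, star_algebraMap, ← map_mul, ← map_one (algebraMap ℝ (CliffordAlgebra (negForm B)))] at h2
  have h3 : r * r = 1 := FaithfulSMul.algebraMap_injective ℝ (CliffordAlgebra (negForm B)) h2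
  have hab : a = c * b := by rw [hc, inv_mul_cancel_right]
  rcases mul_self_eq_one_iff.1 h3 with rfl | rfl
  · left
    have : c = 1 := by
      apply Subtype.ext
      apply Units.ext
      rw [hr, map_one]
      rfl
    rw [hab, this, one_mul]
  · right
    have : c = negOne (negForm B) H := by
      apply Subtype.ext
      apply Units.ext
      rw [hr, map_neg, map_one]
      rfl
    rw [hab, this]

lemma det_mul_equiv (x y : V ≃ₗ[ℝ] V) :
    LinearMap.det ((x * y : V ≃ₗ[ℝ] V) : V →ₗ[ℝ] V) =
      LinearMap.det (x : V →ₗ[ℝ] V) * LinearMap.det (y : V →ₗ[ℝ] V) := by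
  rw [← map_mul]
  rfl

/-- The lift `α / √2` of the reflection in a coroot `α`. -/
lemma IsNormalizedInner.exists_root_lift (hB : IsNormalizedInner P B) (i : ι) :
    ∃ x : pinPreimage (negForm B) (reflGroup P),
      ((x : (CliffordAlgebra (negForm B))ˣ) : CliffordAlgebra (negForm B)) =
        CliffordAlgebra.ι _ ((√2)⁻¹ • P.coroot i) ∧
      (pinProj (negForm B) (reflGroup P) x : V ≃ₗ[ℝ] V) = P.coreflection i := by
  obtain ⟨v, hv⟩ : ∃ v, v = (√2)⁻¹ • P.coroot i := ⟨_, rfl⟩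
  have h2 : (√2)⁻¹ * (√2)⁻¹ = (1 / 2 : ℝ) := by
    rw [← mul_inv, Real.mul_self_sqrt (by norm_num)]
    norm_num
  have hvv : B v v = 1 := by
    rw [hv]
    simp only [map_smul, LinearMap.smul_apply, smul_eq_mul, hB.norm_coroot]
    linear_combination 2 * h2
  have hsq : CliffordAlgebra.ι (negForm B) v * CliffordAlgebra.ι _ v = -1 := by
    rw [ι_sq_scalar, negForm_apply, hvv, map_neg, map_one]
  let u : (CliffordAlgebra (negForm B))ˣ :=
    ⟨CliffordAlgebra.ι _ v, -CliffordAlgebra.ι _ v, by rw [mul_neg, hsq, neg_neg],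
      by rw [neg_mul, hsq, neg_neg]⟩
  have hu : ∀ w, involute (u : CliffordAlgebra (negForm B)) * CliffordAlgebra.ι _ w *
      ((u⁻¹ : (CliffordAlgebra (negForm B))ˣ) : CliffordAlgebra (negForm B)) =
      CliffordAlgebra.ι _ (P.coreflection i w) := by
    intro w
    change involute (CliffordAlgebra.ι _ v) * CliffordAlgebra.ι _ w * -CliffordAlgebra.ι _ v = _
    have hadd : CliffordAlgebra.ι (negForm B) v * CliffordAlgebra.ι _ w =
        algebraMap ℝ _ (-2 * B v w) - CliffordAlgebra.ι _ w * CliffordAlgebra.ι _ v := by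
      rw [eq_sub_iff_add_eq, ι_mul_ι_add_swap]
      congr 1
      simp only [QuadraticMap.polar, negForm_apply, map_add, LinearMap.add_apply, hB.symm w v]
      ring
    have hrefl : P.coreflection i w = w - (2 * B v w) • v := by
      rw [hB.coreflection_apply, hv]
      simp only [map_smul, LinearMap.smul_apply, smul_eq_mul, smul_smul]
      congr 2
      linear_combination -2 * B (P.coroot i) w * h2
    rw [involute_ι, neg_mul, neg_mul_neg, hadd, sub_mul, mul_assoc, hsq, hrefl, map_sub, map_smul,
      ← Algebra.smul_def, neg_mul, neg_smul, mul_neg, mul_one]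
    abel
  let x : pinPreimage (negForm B) (reflGroup P) :=
    ⟨u, by change star (CliffordAlgebra.ι _ v) = -CliffordAlgebra.ι _ v; rw [star_ι],
      P.coreflection i, coreflection_mem P i, hu⟩
  refine ⟨x, by rw [← hv], ?_⟩
  apply LinearEquiv.ext
  intro w
  apply ι_injective (negForm B)
  rw [ι_pinProj, ← hu]

/-- The covering is surjective, and elements over transformations of determinant `±1` have
parity `±1`. -/
lemma IsNormalizedInner.exists_pin_lift [FiniteDimensional ℝ V] (hB : IsNormalizedInner P B)
    {g : V ≃ₗ[ℝ] V} (hg : g ∈ reflGroup P) :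
    ∃ x : pinPreimage (negForm B) (reflGroup P),
      (pinProj (negForm B) (reflGroup P) x : V ≃ₗ[ℝ] V) = g ∧
      involute ((x : (CliffordAlgebra (negForm B))ˣ) : CliffordAlgebra (negForm B)) =
        LinearMap.det (g : V →ₗ[ℝ] V) •
          ((x : (CliffordAlgebra (negForm B))ˣ) : CliffordAlgebra (negForm B)) ∧
      (LinearMap.det (g : V →ₗ[ℝ] V) = 1 ∨ LinearMap.det (g : V →ₗ[ℝ] V) = -1) := by
  have hroot : ∀ i, ∃ x : pinPreimage (negForm B) (reflGroup P),
      (pinProj (negForm B) (reflGroup P) x : V ≃ₗ[ℝ] V) = P.coreflection i ∧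
      involute ((x : (CliffordAlgebra (negForm B))ˣ) : CliffordAlgebra (negForm B)) =
        LinearMap.det (P.coreflection i : V →ₗ[ℝ] V) •
          ((x : (CliffordAlgebra (negForm B))ˣ) : CliffordAlgebra (negForm B)) ∧
      (LinearMap.det (P.coreflection i : V →ₗ[ℝ] V) = 1 ∨
        LinearMap.det (P.coreflection i : V →ₗ[ℝ] V) = -1) := by
    intro i
    obtain ⟨x, hx, hxp⟩ := hB.exists_root_lift i
    exact ⟨x, hxp, by rw [hx, involute_ι, det_coreflection, neg_one_smul],
      Or.inr (det_coreflection P i)⟩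
  induction hg using Subgroup.closure_induction'' with
  | mem g hg => obtain ⟨i, rfl⟩ := hg; exact hroot i
  | inv_mem g hg => obtain ⟨i, rfl⟩ := hg; rw [P.coreflection_inv]; exact hroot i
  | one =>
    have h1 : LinearMap.det ((1 : V ≃ₗ[ℝ] V) : V →ₗ[ℝ] V) = 1 := LinearMap.det_id
    exact ⟨1, by simp, by simp, Or.inl h1⟩
  | mul g h _ _ ihg ihh =>
    obtain ⟨x, hx, hxi, hxd⟩ := ihg
    obtain ⟨y, hy, hyi, hyd⟩ := ihh
    refine ⟨x * y, by rw [map_mul, Subgroup.coe_mul, hx, hy], ?_, ?_⟩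
    · rw [Subgroup.coe_mul, Units.val_mul, map_mul, hxi, hyi, smul_mul_smul_comm, det_mul_equiv]
    · rw [det_mul_equiv]
      rcases hxd with h1 | h1 <;> rcases hyd with h2 | h2 <;> simp [h1, h2]

/-- Elements of the covering have the parity of the determinant of their image. -/
lemma IsNormalizedInner.involute_eq_det_smul [FiniteDimensional ℝ V] (hB : IsNormalizedInner P B)
    (a : pinPreimage (negForm B) (reflGroup P)) :
    involute ((a : (CliffordAlgebra (negForm B))ˣ) : CliffordAlgebra (negForm B)) =
      LinearMap.det ((pinProj (negForm B) (reflGroup P) a : V ≃ₗ[ℝ] V) : V →ₗ[ℝ] V) •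
        ((a : (CliffordAlgebra (negForm B))ˣ) : CliffordAlgebra (negForm B)) := by
  obtain ⟨x, hx, hxi, -⟩ := hB.exists_pin_lift (pinProj (negForm B) (reflGroup P) a).2
  rcases eq_or_eq_negOne_mul hB.symm hB.pos (Subtype.ext hx.symm) with h | h
  · have h1 : ((a : (CliffordAlgebra (negForm B))ˣ) : CliffordAlgebra (negForm B)) =
        ((x : (CliffordAlgebra (negForm B))ˣ) : CliffordAlgebra (negForm B)) := by rw [h]
    rw [h1, hxi]
  · have h1 : ((a : (CliffordAlgebra (negForm B))ˣ) : CliffordAlgebra (negForm B)) =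
        -((x : (CliffordAlgebra (negForm B))ˣ) : CliffordAlgebra (negForm B)) := by
      rw [h, Subgroup.coe_mul, Units.val_mul]
      change -1 * _ = _
      rw [neg_one_mul]
    rw [h1, map_neg, hxi, smul_neg]

lemma IsNormalizedInner.det_eq [FiniteDimensional ℝ V] (hB : IsNormalizedInner P B)
    {g : V ≃ₗ[ℝ] V} (hg : g ∈ reflGroup P) :
    LinearMap.det (g : V →ₗ[ℝ] V) = 1 ∨ LinearMap.det (g : V →ₗ[ℝ] V) = -1 :=
  (hB.exists_pin_lift hg).choose_spec.2.2

lemma sgn_apply (H : Subgroup (V ≃ₗ[ℝ] V)) (g : H) :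
    sgn H g = ((LinearMap.det ((g : V ≃ₗ[ℝ] V) : V →ₗ[ℝ] V) : ℝ) : ℂ) := by
  rw [← LinearEquiv.coe_det]
  rfl

/-- If the image of `a` in the orthogonal group fixes a coroot, then `a` commutes with the lift of
the reflection up to the parity of `a`. -/
lemma root_lift_mul {H : Subgroup (V ≃ₗ[ℝ] V)}
    (a : pinPreimage (negForm B) H) {i : ι}
    (h : (pinProj (negForm B) H a : V ≃ₗ[ℝ] V) (P.coroot i) = P.coroot i) :
    CliffordAlgebra.ι _ ((√2)⁻¹ • P.coroot i) *
      ((a : (CliffordAlgebra (negForm B))ˣ) : CliffordAlgebra (negForm B)) =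
    involute ((a : (CliffordAlgebra (negForm B))ˣ) : CliffordAlgebra (negForm B)) *
      CliffordAlgebra.ι _ ((√2)⁻¹ • P.coroot i) := by
  have h1 := ι_pinProj a ((√2)⁻¹ • P.coroot i)
  rw [map_smul, h] at h1
  exact (Units.eq_mul_inv_iff_mul_eq _).1 h1

end Covering

/-! ### The image of the spin induction map -/

section Image

open CliffordAlgebra

/-- A function `h` on a covering `π` of a group `K` is the product of a function `θ` with a class
function on `K` if it vanishes where `θ` does and the quotient of `h` by `θ` is constant on fibres
and invariant under conjugation. -/
lemma exists_classFunction {Γ K : Type*} [Group K] (π : Γ → K) (h θ : Γ → ℂ)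
    (hfib : ∀ a b, π a = π b → h a * θ b = h b * θ a)
    (hconj : ∀ (y : K) a, ∃ a', π a' = y * π a * y⁻¹ ∧
      ((h a' = h a ∧ θ a' = θ a) ∨ (h a' = -h a ∧ θ a' = -θ a)))
    (hvan : ∀ a, θ a = 0 → h a = 0) :
    ∃ f : K → ℂ, (∀ x y, f (x * y) = f (y * x)) ∧ ∀ a, f (π a) * θ a = h a := by
  classical
  let f : K → ℂ := fun w => if hw : ∃ a, π a = w ∧ θ a ≠ 0 then h hw.choose / θ hw.choose else 0
  have hf : ∀ a, θ a ≠ 0 → f (π a) = h a / θ a := by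
    intro a ha
    have hw : ∃ a', π a' = π a ∧ θ a' ≠ 0 := ⟨a, rfl, ha⟩
    change (if hw : ∃ a', π a' = π a ∧ θ a' ≠ 0 then h hw.choose / θ hw.choose else 0) = _
    rw [dif_pos hw, div_eq_div_iff hw.choose_spec.2 ha]
    exact hfib _ _ hw.choose_spec.1
  have hf0 : ∀ w, (¬∃ a, π a = w ∧ θ a ≠ 0) → f w = 0 := fun w hw => dif_neg hw
  have hinv : ∀ y w, (∃ a, π a = w ∧ θ a ≠ 0) → (∃ a, π a = y * w * y⁻¹ ∧ θ a ≠ 0) ∧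
      f (y * w * y⁻¹) = f w := by
    rintro y - ⟨a, rfl, ha⟩
    obtain ⟨a', h1, h2⟩ := hconj y a
    have ha' : θ a' ≠ 0 := by
      rcases h2 with ⟨-, h2⟩ | ⟨-, h2⟩ <;> rw [h2]
      · exact ha
      · exact neg_ne_zero.2 ha
    refine ⟨⟨a', h1, ha'⟩, ?_⟩
    rw [← h1, hf a' ha', hf a ha]
    rcases h2 with ⟨h2, h3⟩ | ⟨h2, h3⟩ <;> rw [h2, h3]
    exact neg_div_neg_eq _ _
  refine ⟨f, fun x y => ?_, fun a => ?_⟩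
  · have hxy : x * y = x * (y * x) * x⁻¹ := by group
    by_cases hw : ∃ a, π a = y * x ∧ θ a ≠ 0
    · rw [hxy, (hinv x _ hw).2]
    · rw [hf0 _ hw, hf0]
      intro hw'
      apply hw
      have := (hinv x⁻¹ _ hw').1
      rwa [show x⁻¹ * (x * y) * x⁻¹⁻¹ = y * x by group] at this
  · by_cases ha : θ a = 0
    · rw [ha, mul_zero, hvan a ha]
    · rw [hf a ha, div_mul_cancel₀ _ ha]

lemma trace_mul_conj {M : Type*} [AddCommGroup M] [Module ℂ M] [FiniteDimensional ℂ M]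
    {G X X' : Module.End ℂ M} {c : ℂ} (A : Module.End ℂ M) (hG : G * X = c • (X * G))
    (hX : X' * X = 1) :
    LinearMap.trace ℂ M (G * (X * A * X')) = c * LinearMap.trace ℂ M (G * A) := by
  rw [← mul_assoc, ← mul_assoc, hG, smul_mul_assoc, smul_mul_assoc, map_smul, smul_eq_mul,
    mul_assoc, mul_assoc, LinearMap.trace_mul_comm, mul_assoc, mul_assoc, hX, mul_one]

section Inclusion

variable {V : Type*} [AddCommGroup V] [Module ℝ V] {Q : QuadraticForm ℝ V}
  {H K : Subgroup (V ≃ₗ[ℝ] V)}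

lemma pinPreimage_mono (h : H ≤ K) : pinPreimage Q H ≤ pinPreimage Q K :=
  fun _ ⟨ha, g, hg, hag⟩ => ⟨ha, g, h hg, hag⟩

lemma pinProj_inclusion (h : H ≤ K) (a : pinPreimage Q H) :
    pinProj Q K (Subgroup.inclusion (pinPreimage_mono h) a) =
      Subgroup.inclusion h (pinProj Q H a) := by
  apply Subtype.ext
  apply LinearEquiv.ext
  intro v
  apply ι_injective Q
  rw [ι_pinProj]
  exact (ι_pinProj a v).symm

lemma inclusion_conjHom (x : pinPreimage Q K) (a : pinPreimage Q (evenPart K)) :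
    Subgroup.inclusion (pinPreimage_mono (evenPart_le K)) (conjHom x a) =
      x * Subgroup.inclusion (pinPreimage_mono (evenPart_le K)) a * x⁻¹ := rfl

lemma pinProj_conjHom (x : pinPreimage Q K) (a : pinPreimage Q (evenPart K)) :
    Subgroup.inclusion (evenPart_le K) (pinProj Q (evenPart K) (conjHom x a)) =
      pinProj Q K x * Subgroup.inclusion (evenPart_le K) (pinProj Q (evenPart K) a) *
        (pinProj Q K x)⁻¹ := by
  rw [← pinProj_inclusion, ← pinProj_inclusion, inclusion_conjHom, map_mul, map_mul, map_inv]

lemma conjHom_conjHom (x y : pinPreimage Q K) (a : pinPreimage Q (evenPart K)) :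
    conjHom x (conjHom y a) = conjHom (x * y) a := by
  apply Subtype.ext
  simp [conjHom, mul_assoc]

/-- Virtual characters of the even part of the covering are invariant under conjugation by
elements over transformations of determinant one. -/
lemma apply_conjHom_of_det_eq_one {h : pinPreimage Q (evenPart K) → ℂ}
    (hh : h ∈ genRing Q (evenPart K)) {y : pinPreimage Q K}
    (hy : LinearMap.det ((pinProj Q K y : V ≃ₗ[ℝ] V) : V →ₗ[ℝ] V) = 1)
    (a : pinPreimage Q (evenPart K)) : h (conjHom y a) = h a := by
  have hy' : LinearEquiv.det (pinProj Q K y : V ≃ₗ[ℝ] V) = 1 := by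
    apply Units.ext
    rw [LinearEquiv.coe_det, hy, Units.val_one]
  let z : pinPreimage Q (evenPart K) :=
    ⟨y, y.2.1, pinProj Q K y, ⟨(pinProj Q K y).2, hy'⟩, fun v => (ι_pinProj y v).symm⟩
  have hz : conjHom y a = z * a * z⁻¹ := rfl
  rw [hz, repRing_mul_comm (genRing_le_repRing hh), inv_mul_cancel_left]

end Inclusion

variable {ι V₀ V : Type*} [AddCommGroup V₀] [Module ℝ V₀] [AddCommGroup V] [Module ℝ V]
  {P : RootPairing ι ℝ V₀ V} {B : LinearMap.BilinForm ℝ V}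

lemma finrank_eq_finrank (P : RootPairing ι ℝ V₀ V) :
    Module.finrank ℝ V₀ = Module.finrank ℝ V := by
  rw [P.toPerfPair.finrank_eq, Subspace.dual_finrank_eq]

lemma det_pinProj_evenPart (a : pinPreimage (negForm B) (evenPart (reflGroup P))) :
    LinearMap.det ((pinProj (negForm B) (evenPart (reflGroup P)) a : V ≃ₗ[ℝ] V) : V →ₗ[ℝ] V) =
      1 := by
  have h : LinearEquiv.det (pinProj (negForm B) (evenPart (reflGroup P)) a : V ≃ₗ[ℝ] V) = 1 :=
    (pinProj (negForm B) (evenPart (reflGroup P)) a).2.2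
  rw [← LinearEquiv.coe_det, h, Units.val_one]

lemma tensorDiff_apply {Q : QuadraticForm ℝ V} {H K : Subgroup (V ≃ₗ[ℝ] V)} (hHK : H ≤ K)
    {M N : Type*} [AddCommGroup M] [Module ℂ M] [FiniteDimensional ℂ M]
    [AddCommGroup N] [Module ℂ N] [FiniteDimensional ℂ N]
    (Sp : Representation ℂ (pinPreimage Q H) M) (Sm : Representation ℂ (pinPreimage Q H) N)
    (hp : IsGenuine Sp) (hm : IsGenuine Sm) (f : repRing K) (a : pinPreimage Q H) :
    (tensorDiff hHK Sp Sm hp hm f : pinPreimage Q H → ℂ) a =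
      (f : K → ℂ) (Subgroup.inclusion hHK (pinProj Q H a)) *
        (Sp.character a - Sm.character a) := rfl

variable [FiniteDimensional ℝ V]

/-- An element of `W` of determinant `(-1)^n` with eigenvalue `1` fixes a coroot. -/
lemma IsDihedralOrH.exists_fixed_coroot [Finite ι] [P.IsRootSystem] (hP : IsDihedralOrH P)
    (hB : IsNormalizedInner P B) {g : V ≃ₗ[ℝ] V} (hg : g ∈ reflGroup P)
    (hdet : LinearMap.det (g : V →ₗ[ℝ] V) = (-1) ^ Module.finrank ℝ V)
    (hfix : ¬∀ v, g v = v → v = 0) : ∃ i, g (P.coroot i) = P.coroot i := by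
  obtain ⟨r, b, hb, hJ⟩ := hP.exists_orthogonal hB
  push Not at hfix
  obtain ⟨v, hgv, hv⟩ := hfix
  exact hB.exists_fixed_coroot hb hJ hg hdet hv hgv

/-- The virtual character `S⁺ - S⁻` in even dimension is the supertrace on the spin module. -/
lemma halfSpin_character_sub (hB : IsNormalizedInner P B) (D : EvenPolarization (B.baseChange ℂ))
    (a : pinPreimage (negForm B) (evenPart (reflGroup P))) :
    (halfSpin hB D 1).character a - (halfSpin hB D (-1)).character a =
      LinearMap.trace ℂ _ (parity D.U * D.spinHom (baseChange_symm hB.symm)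
        (toComplex B ((a : (CliffordAlgebra (negForm B))ˣ) : CliffordAlgebra (negForm B)))) := by
  rw [trace_involution_mul (parity D.U) _ (fun s => parity_parity D.U s) fun c s hs => ?_]
  · rfl
  · rw [Module.End.mem_eigenspace_iff] at *
    rw [D.parity_spinHom, ← toComplex_involute, hB.involute_eq, hs, map_smul]

/-- In even dimension, odd elements exchange the characters of `S⁺` and `S⁻` by conjugation. -/
lemma halfSpin_character_sub_conjHom (hB : IsNormalizedInner P B)
    (D : EvenPolarization (B.baseChange ℂ)) (y : pinPreimage (negForm B) (reflGroup P))
    (a : pinPreimage (negForm B) (evenPart (reflGroup P))) :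
    (halfSpin hB D 1).character (conjHom y a) - (halfSpin hB D (-1)).character (conjHom y a) =
      sgn _ (pinProj (negForm B) (reflGroup P) y) *
        ((halfSpin hB D 1).character a - (halfSpin hB D (-1)).character a) := by
  rw [halfSpin_character_sub, halfSpin_character_sub]
  obtain ⟨φ, hφ⟩ : ∃ φ, φ = D.spinHom (baseChange_symm hB.symm) := ⟨_, rfl⟩
  rw [← hφ]
  have h1 : φ (toComplex B (((conjHom y a : pinPreimage (negForm B) (evenPart (reflGroup P))) :
      (CliffordAlgebra (negForm B))ˣ) : CliffordAlgebra (negForm B))) =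
      pinRep B (reflGroup P) φ y * φ (toComplex B
        ((a : (CliffordAlgebra (negForm B))ˣ) : CliffordAlgebra (negForm B))) *
        pinRep B (reflGroup P) φ y⁻¹ := by
    change φ (toComplex B (_ * _ * _)) = φ (toComplex B _) * _ * φ (toComplex B _)
    rw [← map_mul, ← map_mul, ← map_mul, ← map_mul]
    rfl
  rw [h1]
  refine trace_mul_conj _ ?_ (by rw [← map_mul, inv_mul_cancel, map_one])
  refine LinearMap.ext fun s => ?_
  change parity D.U (φ (toComplex B _) s) =
    sgn _ (pinProj (negForm B) (reflGroup P) y) • φ (toComplex B _) (parity D.U s)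
  rw [hφ, D.parity_spinHom, ← hφ, ← toComplex_involute, hB.involute_eq_det_smul, sgn_apply]
  rcases hB.det_eq (pinProj (negForm B) (reflGroup P) y).2 with h | h <;> simp [h]

lemma sgn_eq_neg_one_of_ne_one (hB : IsNormalizedInner P B) {g : reflGroup P}
    (hg : sgn _ g ≠ 1) : sgn _ g = -1 := by
  rw [sgn_apply] at hg ⊢
  rcases hB.det_eq g.2 with h | h
  · simp [h] at hg
  · simp [h]

theorem range_iSEven [Finite ι] [P.IsRootSystem] (hP : IsDihedralOrH P)
    (hB : IsNormalizedInner P B) (hV : Even (Module.finrank ℝ V))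
    (D : EvenPolarization (B.baseChange ℂ)) (x : pinPreimage (negForm B) (reflGroup P))
    (hx : sgn (reflGroup P) (pinProj (negForm B) (reflGroup P) x) ≠ 1) :
    LinearMap.range (iSEven hB D) = LinearMap.ker (1 + conjTwist x) := by
  have hx' := sgn_eq_neg_one_of_ne_one hB hx
  have hker : ∀ h : genRing (negForm B) (evenPart (reflGroup P)),
      h ∈ LinearMap.ker (1 + conjTwist x) ↔ ∀ a, h.1 (conjHom x a) = -h.1 a := by
    intro h
    rw [LinearMap.mem_ker, ← Subtype.coe_inj, funext_iff]
    refine forall_congr' fun a => ?_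
    change h.1 a + h.1 (conjHom x a) = 0 ↔ _
    rw [add_comm, add_eq_zero_iff_eq_neg]
  apply le_antisymm
  · rintro - ⟨f, rfl⟩
    rw [hker]
    intro a
    change (tensorDiff _ _ _ _ _ f).1 _ = -(tensorDiff _ _ _ _ _ f).1 _
    rw [tensorDiff_apply, tensorDiff_apply, halfSpin_character_sub_conjHom, hx', pinProj_conjHom,
      repRing_mul_comm f.2, inv_mul_cancel_left]
    ring
  · intro h hh
    rw [hker] at hh
    -- The sign rule for the given `x` implies that for every `y`: if `y` is odd, `y x⁻¹` is even.
    have hodd : ∀ (y : pinPreimage (negForm B) (reflGroup P)) a,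
        h.1 (conjHom y a) = sgn _ (pinProj (negForm B) (reflGroup P) y) * h.1 a := by
      intro y a
      by_cases hy : sgn _ (pinProj (negForm B) (reflGroup P) y) = 1
      · rw [hy, one_mul]
        rw [sgn_apply] at hy
        exact apply_conjHom_of_det_eq_one h.2 (by exact_mod_cast hy) a
      · have hy' := sgn_eq_neg_one_of_ne_one hB hy
        have h1 : sgn _ (pinProj (negForm B) (reflGroup P) (y * x⁻¹)) = 1 := by
          have h2 : sgn _ (pinProj (negForm B) (reflGroup P) (y * x⁻¹)) *
              sgn _ (pinProj (negForm B) (reflGroup P) x) =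
              sgn _ (pinProj (negForm B) (reflGroup P) y) := by
            rw [← map_mul, ← map_mul, inv_mul_cancel_right]
          rw [hx', hy'] at h2
          linear_combination -h2
        rw [sgn_apply] at h1
        have h3 := apply_conjHom_of_det_eq_one h.2 (y := y * x⁻¹) (by exact_mod_cast h1)
          (conjHom x a)
        rw [conjHom_conjHom, inv_mul_cancel_right, hh] at h3
        rw [h3, hy', neg_one_mul]
    have hvan : ∀ a, (halfSpin hB D 1).character a - (halfSpin hB D (-1)).character a = 0 →
        h.1 a = 0 := by
      intro a ha
      have hdet := det_pinProj_evenPart a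
      obtain ⟨i, hi⟩ := hP.exists_fixed_coroot hB
        (evenPart_le _ (pinProj (negForm B) (evenPart (reflGroup P)) a).2)
        (by rw [hdet, hV.neg_one_pow]) fun hfix => by
          rw [halfSpin_character_sub] at ha
          exact D.supertrace_ne_zero hB.symm hB.pos hV a (hB.involute_eq a) hfix ha
      -- The lift of the reflection in the coroot is odd and commutes with `a`.
      obtain ⟨y, hy, hyp⟩ := hB.exists_root_lift i
      have h1 := root_lift_mul a hi
      rw [← hy, hB.involute_eq] at h1
      have h2 : conjHom y a = a := by
        apply Subtype.ext
        change (y : (CliffordAlgebra (negForm B))ˣ) * a * (y : (CliffordAlgebra (negForm B))ˣ)⁻¹ = a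
        rw [mul_inv_eq_iff_eq_mul]
        exact Units.ext h1
      have h3 := hodd y a
      rw [h2, sgn_apply, hyp, det_coreflection] at h3
      push_cast at h3
      linear_combination h3 / 2
    refine (exists_classFunction
      (fun a => Subgroup.inclusion (evenPart_le _) (pinProj (negForm B) (evenPart (reflGroup P)) a))
      h.1 (fun a => (halfSpin hB D 1).character a - (halfSpin hB D (-1)).character a)
      (fun a b hab => ?_) (fun g a => ?_) hvan).elim fun f hf => ?_
    · rcases eq_or_eq_negOne_mul hB.symm hB.pos (Subgroup.inclusion_injective _ hab) with rfl | rfl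
      · rfl
      · rw [genRing_negOne_mul h.2, genRing_negOne_mul
          (character_mem_genRing (isGenuine_halfSpin hB D 1)), genRing_negOne_mul
          (character_mem_genRing (isGenuine_halfSpin hB D (-1)))]
        ring
    · obtain ⟨y, hy, -, -⟩ := hB.exists_pin_lift g.2
      refine ⟨conjHom y a, by rw [pinProj_conjHom, Subtype.ext hy], ?_⟩
      rw [hodd, halfSpin_character_sub_conjHom]
      by_cases hs : sgn _ (pinProj (negForm B) (reflGroup P) y) = 1
      · left; simp [hs]
      · right; simp [sgn_eq_neg_one_of_ne_one hB hs]
    · have := finite_reflGroup (P := P)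
      exact ⟨⟨f, mem_repRing_of_classFunction f hf.1⟩, Subtype.ext (funext fun a => hf.2 a)⟩

/-- The virtual character `S⁺ - S⁻` in odd dimension, in terms of one of the spin modules. -/
lemma oddSpin_character_sub (hB : IsNormalizedInner P B) (D : OddPolarization (B.baseChange ℂ))
    (z : ℂ) (hz : z ^ 2 = -1) (hz' : (-z) ^ 2 = -1)
    (a : pinPreimage (negForm B) (reflGroup P)) :
    (oddSpin hB D z hz).character a - (oddSpin hB D (-z) hz').character a =
      LinearMap.trace ℂ _ (D.spinHom (baseChange_symm hB.symm) z hz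
        (toComplex B ((a : (CliffordAlgebra (negForm B))ˣ) : CliffordAlgebra (negForm B)))) -
      LinearMap.trace ℂ _ (D.spinHom (baseChange_symm hB.symm) z hz (involute
        (toComplex B ((a : (CliffordAlgebra (negForm B))ˣ) : CliffordAlgebra (negForm B))))) := by
  rw [← D.trace_spinHom_neg _ z hz hz']
  rfl

theorem range_iSOdd [Finite ι] [P.IsRootSystem] (hP : IsDihedralOrH P)
    (hB : IsNormalizedInner P B) (hV : Odd (Module.finrank ℝ V))
    (D : OddPolarization (B.baseChange ℂ)) :
    LinearMap.range (iSOdd hB D) =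
      LinearMap.ker (1 + sgnTwist (negForm B) (reflGroup P)) := by
  have hker : ∀ h : genRing (negForm B) (reflGroup P),
      h ∈ LinearMap.ker (1 + sgnTwist (negForm B) (reflGroup P)) ↔
        ∀ a, sgn _ (pinProj (negForm B) (reflGroup P) a) = 1 → h.1 a = 0 := by
    intro h
    rw [LinearMap.mem_ker, ← Subtype.coe_inj, funext_iff]
    refine forall_congr' fun a => ?_
    change h.1 a + sgn _ (pinProj (negForm B) (reflGroup P) a) * h.1 a = 0 ↔ _
    by_cases hs : sgn _ (pinProj (negForm B) (reflGroup P) a) = 1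
    · simp [hs, ← two_mul]
    · simp [sgn_eq_neg_one_of_ne_one hB hs]
      norm_num
  have hz' : (-Complex.I) ^ 2 = -1 := by rw [neg_sq, Complex.I_sq]
  let θ : pinPreimage (negForm B) (reflGroup P) → ℂ := fun a =>
    (oddSpin hB D Complex.I Complex.I_sq).character a - (oddSpin hB D (-Complex.I) hz').character a
  have hp := character_mem_genRing (isGenuine_pinRep (B := B) (reflGroup P)
    (D.spinHom (baseChange_symm hB.symm) Complex.I Complex.I_sq))
  have hm := character_mem_genRing (isGenuine_pinRep (B := B) (reflGroup P)
    (D.spinHom (baseChange_symm hB.symm) (-Complex.I) hz'))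
  have hθ : θ ∈ genRing (negForm B) (reflGroup P) := Submodule.sub_mem _ hp hm
  apply le_antisymm
  · rintro - ⟨f, rfl⟩
    rw [hker]
    intro a ha
    have h1 : θ a = 0 := by
      have hdet : LinearMap.det ((pinProj (negForm B) (reflGroup P) a : V ≃ₗ[ℝ] V) :
          V →ₗ[ℝ] V) = 1 := by
        rw [sgn_apply] at ha
        exact_mod_cast ha
      change _ - _ = (0 : ℂ)
      rw [oddSpin_character_sub, ← toComplex_involute, hB.involute_eq_det_smul, hdet, one_smul,
        sub_self]
    change (f : reflGroup P → ℂ) _ * θ a = 0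
    rw [h1, mul_zero]
  · intro h hh
    rw [hker] at hh
    have hvan : ∀ a, θ a = 0 → h.1 a = 0 := by
      intro a ha
      by_cases hs : sgn _ (pinProj (negForm B) (reflGroup P) a) = 1
      · exact hh a hs
      have hdet : LinearMap.det ((pinProj (negForm B) (reflGroup P) a : V ≃ₗ[ℝ] V) :
          V →ₗ[ℝ] V) = -1 := by
        have := sgn_eq_neg_one_of_ne_one hB hs
        rw [sgn_apply] at this
        exact_mod_cast this
      have hodd : involute ((a : (CliffordAlgebra (negForm B))ˣ) : CliffordAlgebra (negForm B)) =
          -((a : (CliffordAlgebra (negForm B))ˣ) : CliffordAlgebra (negForm B)) := by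
        rw [hB.involute_eq_det_smul, hdet, neg_one_smul]
      obtain ⟨i, hi⟩ := hP.exists_fixed_coroot hB (pinProj (negForm B) (reflGroup P) a).2
        (by rw [hdet, hV.neg_one_pow]) fun hfix => by
          have h1 := oddSpin_character_sub hB D Complex.I Complex.I_sq hz' a
          exact D.trace_sub_ne_zero hB.symm hB.pos hV _ _ a hodd hfix (h1.symm.trans ha)
      obtain ⟨y, hy, -⟩ := hB.exists_root_lift i
      have h1 := root_lift_mul a hi
      rw [← hy, hodd] at h1
      have h2 : y * a = negOne _ _ * a * y := by
        apply Subtype.ext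
        apply Units.ext
        change _ * _ = -1 * _ * _
        rw [neg_one_mul]
        exact h1
      -- Conjugation by the lift of the reflection turns `a` into `-a`.
      have h3 : h.1 a = -h.1 a := by
        rw [← genRing_negOne_mul h.2, ← mul_inv_eq_of_eq_mul h2,
          repRing_mul_comm (genRing_le_repRing h.2), inv_mul_cancel_left]
      linear_combination h3 / 2
    refine (exists_classFunction (pinProj (negForm B) (reflGroup P)) h.1 θ
      (fun a b hab => ?_) (fun g a => ?_) hvan).elim fun f hf => ?_
    · rcases eq_or_eq_negOne_mul hB.symm hB.pos hab with rfl | rfl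
      · rfl
      · rw [genRing_negOne_mul h.2, genRing_negOne_mul hθ]
        ring
    · obtain ⟨y, hy, -, -⟩ := hB.exists_pin_lift g.2
      refine ⟨y * a * y⁻¹, by rw [map_mul, map_mul, map_inv, Subtype.ext hy], Or.inl ⟨?_, ?_⟩⟩
      · rw [repRing_mul_comm (genRing_le_repRing h.2), inv_mul_cancel_left]
      · rw [repRing_mul_comm (genRing_le_repRing hθ), inv_mul_cancel_left]
    · have := finite_reflGroup (P := P)
      exact ⟨⟨f, mem_repRing_of_classFunction f hf.1⟩, Subtype.ext (funext fun a => hf.2 a)⟩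

end Image

end SpinReflection

end

theorem proposition5p7 {ι V₀ V : Type*} [Finite ι] [AddCommGroup V₀] [Module ℝ V₀]
    [AddCommGroup V] [Module ℝ V] [FiniteDimensional ℝ V]
    (P : RootPairing ι ℝ V₀ V) [P.IsRootSystem] [P.IsReduced]
    (hP : SpinReflection.IsDihedralOrH P)
    (B : LinearMap.BilinForm ℝ V) (hB : SpinReflection.IsNormalizedInner P B) :
    (Even (Module.finrank ℝ V₀) →
      ∀ (D : SpinReflection.EvenPolarization (B.baseChange ℂ))
        (x : SpinReflection.pinPreimage (SpinReflection.negForm B) (SpinReflection.reflGroup P)),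
        SpinReflection.sgn (SpinReflection.reflGroup P)
          (SpinReflection.pinProj (SpinReflection.negForm B) (SpinReflection.reflGroup P) x) ≠ 1 →
        LinearMap.range (SpinReflection.iSEven hB D) =
          LinearMap.ker (1 + SpinReflection.conjTwist x)) ∧
    (Odd (Module.finrank ℝ V₀) →
      ∀ D : SpinReflection.OddPolarization (B.baseChange ℂ),
        LinearMap.range (SpinReflection.iSOdd hB D) =
          LinearMap.ker (1 + SpinReflection.sgnTwist (SpinReflection.negForm B)
            (SpinReflection.reflGroup P))) := by
  rw [SpinReflection.finrank_eq_finrank P]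
  exact ⟨fun hV D x hx => SpinReflection.range_iSEven hP hB hV D x hx,
    fun hV D => SpinReflection.range_iSOdd hP hB hV D⟩
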